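/- Let $\mathbb F$ be a field of characteristic $p>3$, let $m>1$ and $n>3$ be integers, and let $\underline t=(t_1,\dots,t_{2m})$ be a tuple of positive integers. Put $Y_0=\{1,\dots,2m\}$, $Y_1=\{2m+1,\dots,2m+n\}$, $Y=Y_0\cup Y_1$, $\pi=(\pi_1,\dots,\pi_{2m})$ with $\pi_i=p^{t_i}-1$, and let $\omega$ be the tuple of all odd indices, $x^\omega=x_{2m+1}\cdots x_{2m+n}$. Let $\mathcal O(2m,n)=\mathcal O(2m)\otimes\Lambda(n)$ be the tensor product of the divided power algebra with basis $x^{(\alpha)}$, $\alpha\in\mathbb N_0^{2m}$, and the exterior algebra on $x_k$, $k\in Y_1$, with basis $x^{(\alpha)}x^u$, $u\subseteq Y_1$, and with the usual superderivations $\partial_i$, $i\in Y$, of parity $\mu(i)=\bar 0$ for $i\in Y_0$ and $\bar 1$ for $i\in Y_1$. Let $\mathcal O$ be the span of the $x^{(\alpha)}x^u$ with $\alpha\le\pi$ componentwise, graded by $\deg x^{(\alpha)}x^u=|\alpha|+|u|$. Let $W=\{\sum_{i\in Y}a_i\partial_i\mid a_i\in\mathcal O\}$, with $W_{[k]}$ spanned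 by the $f\partial_i$ with $f\in\mathcal O$ of degree $k+1$, and let $\mathcal W$ be the even part of $W$, a Lie algebra under the commutator. For $a\in\mathcal O(2m,n)$ homogeneous of parity $\mathrm p(a)$ put $D_H(a)=\sum_{i\in Y}\tau(i)(-1)^{\mu(i)\mathrm p(a)}\partial_i(a)\partial_{i'}$, where $i'=i+m$, $\tau(i)=1$ for $i\le m$; $i'=i-m$, $\tau(i)=-1$ for $m<i\le 2m$; and $i'=i$, $\tau(i)=1$ for $i\in Y_1$. Let $\mathcal H$ be the span of the $D_H(x^{(\alpha)}x^u)$ with $\alpha\le\pi$, $|u|$ even and $(\alpha,u)\ne(\pi,\omega)$; this is the even part of the Hamiltonian superalgebra, a Lie subalgebra of $\mathcal W$, graded by $\mathcal H_{[k]}=\mathcal H\cap W_{[k]}$. For $c\in\mathbb F$, $r\in Y_0$ and $s\ge 1$ define linear maps $\mathcal H\to W$ as follows. The map $\Gamma_c$ sends $D_H(x^{(\pi)})$ to $c\,D_H(x^\omega)$ and $D_H(x^{(\alpha)}x^u)$ to $0$ for all other $(\alpha,u)$ as above. Further, $\Phi_r^{(s)}(D_H(f))=\partial_r^{p^s}(f)\,D_H(x^\omega)$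 and $\Theta_r^{(s)}(D)=x^\omega\,(\mathrm{ad}\,\partial_r)^{p^s}(D)$. Put $\Gamma'=\sum_{k\in Y_1}x_k\partial_k$. Let $\phi:\mathcal H\to\mathcal W$ be a derivation, that is, a linear map with $\phi([x,y])=[x,\phi(y)]-[y,\phi(x)]$, and suppose $\phi(\mathcal H_{[-1]}\oplus\mathcal H_{[0]})=0$. Then there are $\lambda,\mu\in\mathbb F$ and $\lambda_r^{(s)},\mu_r^{(s)},\eta_r^{(s)}\in\mathbb F$ for $r\in Y_0$, $1\le s<t_r$, such that $$\phi=\Gamma_\lambda+\mu\,\mathrm{ad}\,\Gamma'+\sum_{r=1}^{2m}\sum_{s=1}^{t_r-1}\Big(\lambda_r^{(s)}\Phi_r^{(s)}+\mu_r^{(s)}\Theta_r^{(s)}+\eta_r^{(s)}(\mathrm{ad}\,\partial_r)^{p^s}\Big),$$ and they can be chosen so that, moreover: (a) if $\phi$ is $\mathbb Z$-homogeneous (for some $d\in\mathbb Z$, $\phi(\mathcal H_{[k]})\subseteq W_{[d+k]}$ for all $k$), then $\mu_r^{(s)}\eta_r^{(s)}=0$ for all $r,s$; (b) if $n$ is odd,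 then $\lambda=0$ and $\lambda_r^{(s)}=\mu_r^{(s)}=0$ for all $r,s$. -/

import Mathlib

namespace HamSuper

/-- Even indices `Y₀ = {1, …, 2m}`: `inl i` stands for `i` and `inr i` for `m + i`. -/
abbrev Y0 (m : ℕ) := Fin m ⊕ Fin m

/-- All indices `Y = Y₀ ∪ Y₁`; the odd indices `Y₁` are `Fin n`. -/
abbrev Y (m n : ℕ) := Y0 m ⊕ Fin n

/-- The involution `i ↦ i'`. -/
def conj {m n : ℕ} : Y m n → Y m n
  | .inl i => .inl i.swap
  | .inr k => .inr k

/-- The sign `τ(i)`. -/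
def tau {m n : ℕ} : Y m n → ℤ
  | .inl (.inl _) => 1
  | .inl (.inr _) => -1
  | .inr _ => 1

/-- The parity `μ(i)`, as a natural number `0` or `1`. -/
def mu {m n : ℕ} : Y m n → ℕ
  | .inl _ => 0
  | .inr _ => 1

/-- Labels `(α, u)` of the standard monomials `x^(α) x^u`; `u` is a set of odd indices, and `x^u` is
the product of the `x_k`, `k ∈ u`, in increasing order. -/
abbrev Mon (m n : ℕ) := (Y0 m → ℕ) × Finset (Fin n)

/-- The superalgebra `𝒪(2m, n) = 𝒪(2m) ⊗ Λ(n)`, by its monomial basis. Its product is `mul` below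
(the pointwise product of `Finsupp` is never used). -/
abbrev O (F : Type*) [Field F] (m n : ℕ) := Mon m n →₀ F

section

variable (F : Type*) [Field F] {m n : ℕ}

/-- The monomial `x^(α) x^u`. -/
noncomputable def mono (a : Mon m n) : O F m n := Finsupp.single a 1

/-- The number of inversions in the concatenation of the increasing words `u` and `v`. -/
def inversions (u v : Finset (Fin n)) : ℕ := ((u ×ˢ v).filter fun q => q.2 < q.1).card

/-- The product of two monomials. -/
noncomputable def monoMul (a b : Mon m n) : O F m n :=
  if Disjoint a.2 b.2 then
    ((-1) ^ inversions a.2 b.2 * ∏ i, ((a.1 i + b.1 i).choose (a.1 i) : F)) •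
      mono F (a.1 + b.1, a.2 ∪ b.2)
  else 0

/-- The product of `𝒪(2m, n)`: `mul F a` is left multiplication by `a`. -/
noncomputable def mul : O F m n →ₗ[F] Module.End F (O F m n) :=
  Finsupp.linearCombination F fun a => Finsupp.linearCombination F fun b => monoMul F a b

/-- `∂_i` on monomials. -/
noncomputable def monoPartial : Y m n → Mon m n → O F m n
  | .inl i, a => if a.1 i = 0 then 0 else mono F (Function.update a.1 i (a.1 i - 1), a.2)
  | .inr k, a =>
      if k ∈ a.2 then ((-1 : F) ^ (a.2.filter (· < k)).card) • mono F (a.1, a.2.erase k) else 0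

/-- The superderivation `∂_i` of `𝒪(2m, n)`. -/
noncomputable def pd (i : Y m n) : Module.End F (O F m n) :=
  Finsupp.linearCombination F (monoPartial F i)

/-- `a ↦ a ∂_i`, an operator on `𝒪(2m, n)`. -/
noncomputable def field (i : Y m n) : O F m n →ₗ[F] Module.End F (O F m n) :=
  (LinearMap.mulRight F (pd F i)).comp (mul F)

/-- `D_H(x^(α) x^u) = ∑ᵢ τ(i) (-1)^{μ(i)|u|} ∂ᵢ(x^(α) x^u) ∂_{i'}`, extended linearly. -/
noncomputable def ham : O F m n →ₗ[F] Module.End F (O F m n) :=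
  Finsupp.linearCombination F fun a =>
    ∑ i : Y m n, (tau i * (-1) ^ (mu i * a.2.card)) • field F (conj i) (monoPartial F i a)

/-- The variable `x_i`. -/
noncomputable def var : Y m n → O F m n
  | .inl i => mono F (Pi.single i 1, ∅)
  | .inr k => mono F (0, {k})

/-- `x^ω`, the product of all odd variables. -/
noncomputable def xomega : O F m n := mono F (0, Finset.univ)

theorem lie_add_aux (D E E' : Module.End F (O F m n)) : ⁅D, E + E'⁆ = ⁅D, E⁆ + ⁅D, E'⁆ := by
  simp only [Ring.lie_def, mul_add, add_mul]
  abel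

theorem lie_smul_aux (c : F) (D E : Module.End F (O F m n)) : ⁅D, c • E⁆ = c • ⁅D, E⁆ := by
  simp only [Ring.lie_def, mul_smul_comm, smul_mul_assoc, smul_sub]

/-- `ad D : E ↦ D E - E D` on the operators on `𝒪(2m, n)`. -/
noncomputable def ad (D : Module.End F (O F m n)) : Module.End F (Module.End F (O F m n)) where
  toFun E := ⁅D, E⁆
  map_add' E E' := lie_add_aux F D E E'
  map_smul' c E := lie_smul_aux F c D E

/-- `Γ' = ∑_{k ∈ Y₁} x_k ∂_k`. -/
noncomputable def GammaPrime : Module.End F (O F m n) :=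
  ∑ k : Fin n, field F (.inr k) (var F (.inr k))

end

/-- `π_i = p^{t_i} - 1`. -/
def topExp (p : ℕ) {m : ℕ} (t : Y0 m → ℕ) : Y0 m → ℕ := fun i => p ^ t i - 1

section

variable (F : Type*) [Field F] (p m n : ℕ) (t : Y0 m → ℕ)

/-- The elements of `𝒪(2m, n; t)` of parity `e` (mod 2). -/
noncomputable def truncParity (e : ℕ) : Submodule F (O F m n) :=
  Finsupp.supported F F {a | a.1 ≤ topExp p t ∧ a.2.card ≡ e [MOD 2]}

/-- The elements of `𝒪(2m, n; t)` of parity `e` and `ℤ`-degree `k`. -/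
noncomputable def truncParityDeg (e : ℕ) (k : ℤ) : Submodule F (O F m n) :=
  Finsupp.supported F F {a | a.1 ≤ topExp p t ∧ a.2.card ≡ e [MOD 2] ∧
    ((∑ i, a.1 i + a.2.card : ℕ) : ℤ) = k}

/-- `𝒲`, the even part of `W(2m, n; t)`: all `∑ᵢ aᵢ ∂ᵢ` with `aᵢ ∈ 𝒪(2m, n; t)` of parity `μ(i)`.
The bracket of even elements is the commutator of operators on `𝒪(2m, n)`, `⁅D, E⁆ = D E - E D`. -/
noncomputable def Weven : Submodule F (Module.End F (O F m n)) :=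
  ⨆ i : Y m n, (truncParity F p m n t (mu i)).map (field F i)

/-- `𝒲_{[k]}`. -/
noncomputable def WevenDeg (k : ℤ) : Submodule F (Module.End F (O F m n)) :=
  ⨆ i : Y m n, (truncParityDeg F p m n t (mu i) (k + 1)).map (field F i)

/-- The span of the `x^(α) x^u`, `α ≤ π`, `|u|` even, `(α, u) ≠ (π, ω)`. -/
noncomputable def potentials : Submodule F (O F m n) :=
  Finsupp.supported F F {a | a.1 ≤ topExp p t ∧ Even a.2.card ∧ a ≠ (topExp p t, Finset.univ)}

/-- `𝓗`, the even part of the Hamiltonian superalgebra `H(2m, n; t)`. -/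
noncomputable def Heven : Submodule F (Module.End F (O F m n)) :=
  (potentials F p m n t).map (ham F)

/-- The potentials without constant term. -/
noncomputable def potentials0 : Submodule F (O F m n) :=
  Finsupp.supported F F ({a | a.1 ≤ topExp p t ∧ Even a.2.card ∧
    a ≠ (topExp p t, Finset.univ)} \ {(0, ∅)})

end

section

variable {F : Type*} [Field F] {m n : ℕ}

theorem conj_conj (i : Y m n) : conj (conj i) = i := by
  rcases i with i | k <;> simp [conj]

theorem mul_mono (a b : Mon m n) : mul F (mono F a) (mono F b) = monoMul F a b := by
  simp [mul, mono]

theorem mul_one' (f : O F m n) : mul F f (mono F (0, ∅)) = f := by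
  induction f using Finsupp.induction_linear with
  | zero => simp
  | add f g hf hg => simp [hf, hg]
  | single a c =>
    have h : (Finsupp.single a c : O F m n) = c • mono F a := by simp [mono]
    rw [h, map_smul, LinearMap.smul_apply, mul_mono]
    simp [monoMul, inversions]

theorem pd_mono (i : Y m n) (a : Mon m n) : pd F i (mono F a) = monoPartial F i a := by
  simp [pd, mono]

theorem pd_var (i j : Y m n) : pd F i (var F j) = if i = j then mono F (0, ∅) else 0 := by
  rcases i with i | i <;> rcases j with j | j <;>
    simp only [var, pd_mono, monoPartial]
  · by_cases h : i = j
    · subst h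
      have : Function.update (Pi.single i 1 : Y0 m → ℕ) i 0 = 0 := by
        ext k; by_cases hk : k = i
        · subst hk; simp
        · simp [hk]
      simp [this]
    · simp [h]
  · simp
  · simp
  · by_cases h : i = j
    · subst h
      have : ({i} : Finset (Fin n)).filter (· < i) = ∅ := by
        ext k; simp; rintro rfl; simp
      simp [this]
    · simp [h]

theorem ham_mono_var (a : Mon m n) (i : Y m n) :
    ham F (mono F a) (var F (conj i)) =
      (tau i * (-1) ^ (mu i * a.2.card)) • monoPartial F i a := by
  simp only [ham, mono, Finsupp.linearCombination_single, one_smul, LinearMap.sum_apply]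
  rw [Finset.sum_eq_single i]
  · rw [LinearMap.smul_apply]
    simp [field, pd_var, mul_one']
  · intro j _ hj
    have : conj j ≠ conj i := fun h => hj (by rw [← conj_conj j, h, conj_conj])
    rw [LinearMap.smul_apply]
    simp [field, pd_var, this]
  · simp

theorem ham_const (c : F) : ham F (Finsupp.single ((0, ∅) : Mon m n) c) = 0 := by
  simp only [ham, Finsupp.linearCombination_single]
  rw [Finset.sum_eq_zero, smul_zero]
  rintro (i | k) _ <;> simp [monoPartial]

/-- The coefficients of `ham F f` applied to a variable. -/
theorem ham_var_coeff (f : O F m n) (i : Y m n) (a b : Mon m n)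
    (hb : ∀ c, monoPartial F i c b ≠ 0 → c = a) :
    ham F f (var F (conj i)) b =
      f a * ((tau i * (-1) ^ (mu i * a.2.card) : ℤ) • monoPartial F i a b) := by
  induction f using Finsupp.induction_linear with
  | zero => simp
  | add f g hf hg => simp [hf, hg, add_mul]
  | single c r =>
    have h : (Finsupp.single c r : O F m n) = r • mono F c := by simp [mono]
    rw [h, map_smul, LinearMap.smul_apply, ham_mono_var]
    by_cases hc : c = a
    · subst hc
      simp [mono]
    · have h0 : monoPartial F i c b = 0 := by
        by_contra hne; exact hc (hb c hne)
      simp [mono, h0, hc]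

/-- The kernel of `D_H` consists of the constants. -/
theorem ham_ker (f : O F m n) (hf : ham F f = 0) (a : Mon m n) (ha : a ≠ (0, ∅)) : f a = 0 := by
  have tau_ne : ∀ (i : Y m n) (k : ℕ), (((tau i * (-1) ^ k : ℤ)) : F) ≠ 0 := by
    rintro ((i | i) | i) k <;> simp [tau]
  obtain ⟨α, u⟩ := a
  by_cases hα : α = 0
  · have hu : u.Nonempty := by
      rw [Finset.nonempty_iff_ne_empty]; rintro rfl; exact ha (by simp [hα])
    obtain ⟨k, hk⟩ := hu
    have h := ham_var_coeff f (.inr k) (α, u) (α, u.erase k) (by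
      rintro ⟨β, v⟩ hne
      simp only [monoPartial] at hne
      split_ifs at hne with hv
      · simp only [mono, Finsupp.smul_apply, Finsupp.single_apply, smul_eq_mul] at hne
        split_ifs at hne with he
        · simp only [Prod.mk.injEq] at he
          refine Prod.ext he.1 ?_
          have := congrArg (insert k) he.2
          rwa [Finset.insert_erase hv, Finset.insert_erase hk] at this
        · simp at hne
      · simp at hne)
    rw [hf] at h
    simp only [monoPartial, if_pos hk, mono, Finsupp.smul_apply, Finsupp.single_eq_same,
      zsmul_eq_mul, LinearMap.zero_apply, Finsupp.coe_zero, Pi.zero_apply] at h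
    have h2 : ((-1 : F) ^ (u.filter (· < k)).card) ≠ 0 := by simp
    have := tau_ne (.inr k) (mu (.inr k : Y m n) * u.card)
    rw [eq_comm, mul_eq_zero, mul_eq_zero] at h
    simp only [smul_eq_mul, mul_one] at h
    tauto
  · obtain ⟨i, hi⟩ : ∃ i, α i ≠ 0 := by
      by_contra hcon; push Not at hcon; exact hα (funext hcon)
    have h := ham_var_coeff f (.inl i) (α, u) (Function.update α i (α i - 1), u) (by
      rintro ⟨β, v⟩ hne
      simp only [monoPartial] at hne
      split_ifs at hne with hv
      · simp at hne
      · simp only [mono, Finsupp.single_apply] at hne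
        split_ifs at hne with he
        · simp only [Prod.mk.injEq] at he
          refine Prod.ext (funext fun j => ?_) he.2
          have := congrFun he.1 j
          by_cases hj : j = i
          · subst hj
            simp at this
            simp only
            omega
          · simpa [hj] using this
        · simp at hne)
    rw [hf] at h
    simp only [monoPartial, if_neg hi, mono, Finsupp.single_eq_same,
      zsmul_eq_mul, LinearMap.zero_apply, Finsupp.coe_zero, Pi.zero_apply] at h
    have := tau_ne (.inl i) (mu (.inl i : Y m n) * u.card)
    rw [mul_one, eq_comm, mul_eq_zero] at h
    tauto

end

section

variable (F : Type*) [Field F] (p m n : ℕ) (t : Y0 m → ℕ)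

theorem ham_mem (f : potentials0 F p m n t) : ham F f.1 ∈ Heven F p m n t :=
  Submodule.mem_map_of_mem (Finsupp.supported_mono Set.sdiff_subset f.2)

/-- `D_H` as a linear map from the potentials without constant term to `𝓗`. -/
noncomputable def hamRestrict : potentials0 F p m n t →ₗ[F] Heven F p m n t :=
  ((ham F).domRestrict _).codRestrict _ (ham_mem F p m n t)

theorem hamRestrict_bijective : Function.Bijective (hamRestrict F p m n t) := by
  constructor
  · intro f g h
    have h0 : ham F (f.1 - g.1) = 0 := by
      have h1 : ham F f.1 = ham F g.1 := congrArg Subtype.val h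
      rw [map_sub, h1, sub_self]
    have hfg : f.1 - g.1 ∈ potentials0 F p m n t := Submodule.sub_mem _ f.2 g.2
    refine Subtype.ext (sub_eq_zero.1 (Finsupp.ext fun a => ?_))
    by_cases ha : a = (0, ∅)
    · by_contra hne
      exact ((Finsupp.mem_supported F _).1 hfg (Finsupp.mem_support_iff.2 hne)).2 ha
    · exact ham_ker _ h0 a ha
  · rintro ⟨X, f, hf, rfl⟩
    refine ⟨⟨f.erase (0, ∅), ?_⟩, Subtype.ext ?_⟩
    · refine (Finsupp.mem_supported F _).2 fun a ha => ?_
      have ha' : a ∈ f.support.erase (0, ∅) := by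
        simpa only [Finsupp.support_erase, Finset.mem_coe] using ha
      rw [Finset.mem_erase] at ha'
      exact ⟨(Finsupp.mem_supported F f).1 hf ha'.2, ha'.1⟩
    · change ham F (f.erase (0, ∅)) = ham F f
      conv_rhs => rw [← Finsupp.single_add_erase (0, ∅) f]
      rw [map_add, ham_const, zero_add]

/-- The potential without constant term of an element of `𝓗`: the unique such `f` with
`X = D_H(f)`. -/
noncomputable def potential : Heven F p m n t →ₗ[F] O F m n :=
  (potentials0 F p m n t).subtype.comp
    (LinearEquiv.ofBijective (hamRestrict F p m n t)
      (hamRestrict_bijective F p m n t)).symm.toLinearMap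

/-- The linear map `Γ_c : 𝓗 → W` with `D_H(x^(π)) ↦ c D_H(x^ω)` that kills `D_H(x^(α) x^u)` for all
other `(α, u)`. -/
noncomputable def Gamma (c : F) : Heven F p m n t →ₗ[F] Module.End F (O F m n) :=
  ((Finsupp.lapply (topExp p t, (∅ : Finset (Fin n)))).comp (potential F p m n t)).smulRight
    (c • ham F (xomega F))

/-- `Φ_i^{(q)} : D_H(f) ↦ ∂_i^{p^q}(f) D_H(x^ω)`. -/
noncomputable def Phi (i : Y0 m) (q : ℕ) : Heven F p m n t →ₗ[F] Module.End F (O F m n) :=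
  (LinearMap.mulRight F (ham F (xomega F))).comp
    ((mul F).comp ((pd F (.inl i) ^ p ^ q).comp (potential F p m n t)))

/-- `(ad ∂_i)^{p^q}` on `𝓗`. -/
noncomputable def adPow (i : Y0 m) (q : ℕ) : Heven F p m n t →ₗ[F] Module.End F (O F m n) :=
  (ad F (pd F (.inl i)) ^ p ^ q).comp
    (Heven F p m n t).subtype

/-- `Θ_i^{(q)} : X ↦ x^ω (ad ∂_i)^{p^q}(X)`. -/
noncomputable def Theta (i : Y0 m) (q : ℕ) : Heven F p m n t →ₗ[F] Module.End F (O F m n) :=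
  (LinearMap.mulLeft F (mul F (xomega F))).comp (adPow F p m n t i q)

/-- `ad Γ'` on `𝓗`. -/
noncomputable def adGammaPrime : Heven F p m n t →ₗ[F] Module.End F (O F m n) :=
  (ad F (GammaPrime F)).comp (Heven F p m n t).subtype

variable {F p m n t}

/-- `φ` is a derivation from the Lie algebra `𝓗` into the `𝓗`-module `𝒲`. -/
def IsDerivation (φ : Heven F p m n t →ₗ[F] Weven F p m n t) : Prop :=
  ∀ X Z T : Heven F p m n t, (T : Module.End F (O F m n)) = ⁅X.1, Z.1⁆ →
    (φ T : Module.End F (O F m n)) = ⁅X.1, (φ Z).1⁆ - ⁅Z.1, (φ X).1⁆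

/-- `φ` is `ℤ`-homogeneous: for some `d`, it maps `𝓗_{[k]} = 𝓗 ∩ 𝒲_{[k]}` into `𝒲_{[d+k]}` for
all `k`. -/
def IsHomogeneous (φ : Heven F p m n t →ₗ[F] Weven F p m n t) : Prop :=
  ∃ d : ℤ, ∀ k : ℤ, ∀ X : Heven F p m n t, X.1 ∈ WevenDeg F p m n t k →
    (φ X).1 ∈ WevenDeg F p m n t (d + k)

end

end HamSuper

namespace HamSuper

/-! ### Signs in the exterior algebra -/

section Signs

variable {n : ℕ}

/-! Write ψ(f) = φ(D_H(f)) and {g, f} = D_H(g)(f). Up to sign D_H(x_{i'}) is ∂_i, and φ kills degree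
-1, so ψ commutes with the even partial derivatives. Hence the coefficients of ψ(f) are recovered,
by Taylor expansion, from their values at the origin of the even variables for f and its even
derivatives. All of φ is encoded in the linear maps χ_j (`chi`), which send f to the value in Λ(n)
of the ∂_j-coefficient of ψ(f). It suffices to compute χ_j on the monomials x^(α) x^u and to compare
with the same data of the right-hand side (`IsNormalized.eq_model`).

The computation rests on the recursion `chi_ham`: χ_j({g, f}) is the value at the origin of [D_H(g),
ψ(f)] minus that of [D_H(f), ψ(g)]. By `act_eq` the first term sees g only through its derivatives
of order one and two at the origin. Two consequences are used throughout. For quadratic g, ψ(g) = 0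
makes χ equivariant under the symplectic transformations and the rotations. If g has degree at least
3 in the even variables, the first term vanishes (`act_high`); so χ_j({g, f}) = 0 as soon as g and f
both have high degree, or g has high degree and ψ(g) = 0.

Weights for x_l x_{l'} and p > 3 give ψ = 0 on cubics such as x_i^(3), and bracketing with these
kills χ on most monomials. What survives (`live_odd`, `live_even`) has α = π or α ≡ 0 mod p for odd
∂_k, and α ≡ ε_{j'} mod p for even ∂_j. If γ ≠ 0 is divisible by p and is not some p^s ε_r, then by
Lucas x^(γ) is, up to a unit, a product of two divided powers with exponents divisible by p, hence
essentially a bracket of two elements of high degree, and χ vanishes again (`chi_split`).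

There remain α = π, γ = p^s ε_r and γ = 0. On pure even monomials rotation invariance allows only 1
and x^ω for even ∂_j, and multiples of ∂_l(x^ω) for odd ∂_l (`chi_pure_even`, `chi_pure_odd`). This
yields Γ from π and the parameters of Φ, Θ and (ad ∂_r)^{p^s} from p^s ε_r; brackets with x_i x^u
extend the values to all u (`exists_parameters`). For γ = 0, χ on x_i x^u is a derivation in x^u
fixed by its values on pairs, which gives ad Γ' (`exists_parameter_zero`).

If n is odd, x^ω has the wrong parity to occur, which is (b). For (a), the coefficients η and μ
multiply 1 and x^ω in the same χ_j, and these have different degrees. -/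

theorem inversions_union_left {u v w : Finset (Fin n)} (h : Disjoint u v) :
    inversions (u ∪ v) w = inversions u w + inversions v w := by
  unfold inversions
  rw [Finset.union_product, Finset.filter_union, Finset.card_union_of_disjoint]
  refine Finset.disjoint_filter_filter ?_
  rw [Finset.disjoint_product]
  exact Or.inl h

theorem inversions_union_right {u v w : Finset (Fin n)} (h : Disjoint u v) :
    inversions w (u ∪ v) = inversions w u + inversions w v := by
  unfold inversions
  rw [Finset.product_union, Finset.filter_union, Finset.card_union_of_disjoint]
  refine Finset.disjoint_filter_filter ?_
  rw [Finset.disjoint_product]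
  exact Or.inr h

/-- Disjointness excludes ties, so each pair in u × v is counted on exactly one side. All
supercommutation signs come from this identity. -/
theorem inversions_add_swap {u v : Finset (Fin n)} (h : Disjoint u v) :
    inversions u v + inversions v u = u.card * v.card := by
  have h1 : inversions v u = ((u ×ˢ v).filter fun q => ¬ q.2 < q.1).card := by
    unfold inversions
    refine Finset.card_bij' (fun q _ => (q.2, q.1)) (fun q _ => (q.2, q.1)) ?_ ?_ ?_ ?_
    · rintro ⟨a, b⟩ hab
      simp only [Finset.mem_filter, Finset.mem_product] at hab ⊢
      exact ⟨⟨hab.1.2, hab.1.1⟩, not_lt.2 hab.2.le⟩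
    · rintro ⟨a, b⟩ hab
      simp only [Finset.mem_filter, Finset.mem_product] at hab ⊢
      refine ⟨⟨hab.1.2, hab.1.1⟩, lt_of_le_of_ne (not_lt.1 hab.2) ?_⟩
      rintro rfl
      exact Finset.disjoint_left.1 h hab.1.1 hab.1.2
    · simp
    · simp
  rw [h1, inversions, Finset.card_filter_add_card_filter_not, Finset.card_product]

theorem inversions_singleton (k : Fin n) (u : Finset (Fin n)) :
    inversions {k} u = (u.filter (· < k)).card := by
  unfold inversions
  refine Finset.card_bij' (fun q _ => q.2) (fun l _ => (k, l)) ?_ ?_ ?_ ?_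
  · rintro ⟨a, b⟩ hab
    simp only [Finset.mem_filter, Finset.mem_product, Finset.mem_singleton] at hab ⊢
    obtain ⟨⟨rfl, h2⟩, h3⟩ := hab
    exact ⟨h2, h3⟩
  · intro a ha
    simpa using ha
  · rintro ⟨a, b⟩ hab
    simp only [Finset.mem_filter, Finset.mem_product, Finset.mem_singleton] at hab
    simp [hab.1.1]
  · simp

/-- Expresses the sign in ∂_k as that of multiplication by x_k, so that all later sign computations
involve `inversions` only. -/
theorem filter_lt_card_eq (k : Fin n) (u : Finset (Fin n)) :
    (u.filter (· < k)).card = inversions {k} (u.erase k) := by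
  rw [inversions_singleton]
  congr 1
  ext l
  simp only [Finset.mem_filter, Finset.mem_erase]
  exact ⟨fun h => ⟨⟨h.2.ne, h.1⟩, h.2⟩, fun h => ⟨h.1.2, h.2⟩⟩

end Signs

/-! ### The superalgebra 𝒪(2m, n) and its superderivations -/

section Algebra

variable {F : Type*} [Field F] {m n : ℕ}

/-- The structure constant of the divided power algebra. -/
noncomputable def divCoeff (F : Type*) [Field F] {m : ℕ} (α β : Y0 m → ℕ) : F :=
  ∏ i, ((α i + β i).choose (α i) : F)

theorem divCoeff_comm (α β : Y0 m → ℕ) : divCoeff F α β = divCoeff F β α := by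
  unfold divCoeff
  refine Finset.prod_congr rfl fun i _ => ?_
  rw [add_comm (β i), Nat.choose_symm_add]

/-- Both sides are products of trinomial coefficients. -/
theorem divCoeff_assoc (α β γ : Y0 m → ℕ) :
    divCoeff F α β * divCoeff F (α + β) γ = divCoeff F β γ * divCoeff F α (β + γ) := by
  unfold divCoeff
  rw [← Finset.prod_mul_distrib, ← Finset.prod_mul_distrib]
  refine Finset.prod_congr rfl fun i _ => ?_
  rw [← Nat.cast_mul, ← Nat.cast_mul]
  congr 1
  simp only [Pi.add_apply]
  have h := Nat.choose_mul (n := α i + β i + γ i) (k := α i + β i) (s := α i)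
    (by omega)
  have e1 : α i + β i + γ i - α i = β i + γ i := by omega
  have e2 : α i + β i - α i = β i := by omega
  rw [e1, e2] at h
  rw [mul_comm, h, mul_comm, ← add_assoc]

theorem O_induction {P : O F m n → Prop} (f : O F m n) (zero : P 0)
    (add : ∀ f g, P f → P g → P (f + g)) (smul : ∀ (c : F) f, P f → P (c • f))
    (mono : ∀ a, P (mono F a)) : P f := by
  induction f using Finsupp.induction_linear with
  | zero => exact zero
  | add f g hf hg => exact add f g hf hg
  | single a c =>
    have h : (Finsupp.single a c : O F m n) = c • HamSuper.mono F a := by simp [HamSuper.mono]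
    rw [h]
    exact smul c _ (mono a)

theorem supported_induction {S : Set (Mon m n)}
    {P : ∀ f : O F m n, f ∈ Finsupp.supported F F S → Prop} {f : O F m n}
    (hf : f ∈ Finsupp.supported F F S) (zero : P 0 (Submodule.zero_mem _))
    (add : ∀ f g hf hg, P f hf → P g hg → P (f + g) (Submodule.add_mem _ hf hg))
    (smul : ∀ (c : F) f hf, P f hf → P (c • f) (Submodule.smul_mem _ c hf))
    (mono : ∀ a (ha : a ∈ S), P (mono F a) (Finsupp.single_mem_supported F _ ha)) : P f hf := by
  -- Quantifying over the membership proof frees the induction predicate from it; proof irrelevance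
  -- then returns the given one.
  have key : ∃ hf, P f hf := by
    have hf' := hf
    rw [Finsupp.supported_eq_span_single] at hf'
    induction hf' using Submodule.span_induction with
    | mem x hx =>
      obtain ⟨a, ha, rfl⟩ := hx
      exact ⟨_, mono a ha⟩
    | zero => exact ⟨_, zero⟩
    | add x y hx' hy' hx hy =>
      rw [← Finsupp.supported_eq_span_single] at hx' hy'
      obtain ⟨h1, h2⟩ := hx hx'
      obtain ⟨h3, h4⟩ := hy hy'
      exact ⟨_, add x y h1 h3 h2 h4⟩
    | smul c x hx' hx =>
      rw [← Finsupp.supported_eq_span_single] at hx'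
      obtain ⟨h1, h2⟩ := hx hx'
      exact ⟨_, smul c x h1 h2⟩
  exact key.2

theorem monoMul_eq (a b : Mon m n) : monoMul F a b =
    if Disjoint a.2 b.2 then
      ((-1) ^ inversions a.2 b.2 * divCoeff F a.1 b.1) • mono F (a.1 + b.1, a.2 ∪ b.2)
    else 0 := rfl

theorem mul_mono_mono (α β : Y0 m → ℕ) (u v : Finset (Fin n)) :
    mul F (mono F (α, u)) (mono F (β, v)) = if Disjoint u v then
      ((-1) ^ inversions u v * divCoeff F α β) • mono F (α + β, u ∪ v) else 0 := by
  rw [mul_mono, monoMul_eq]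

theorem mul_assoc' (f g h : O F m n) : mul F f (mul F g h) = mul F (mul F f g) h := by
  induction f using O_induction with
  | zero => simp
  | add f f' hf hf' => simp [hf, hf']
  | smul c f hf => simp [hf]
  | mono a =>
  induction g using O_induction with
  | zero => simp
  | add f f' hf hf' => simp [hf, hf']
  | smul c f hf => simp [hf]
  | mono b =>
  induction h using O_induction with
  | zero => simp
  | add f f' hf hf' => simp [hf, hf']
  | smul c f hf => simp [hf]
  | mono c =>
  obtain ⟨α, u⟩ := a
  obtain ⟨β, v⟩ := b
  obtain ⟨γ, w⟩ := c
  simp only [mul_mono_mono]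
  by_cases huv : Disjoint u v
  · by_cases hvw : Disjoint v w
    · by_cases huw : Disjoint u w
      · simp only [huv, hvw, if_true, map_smul, LinearMap.smul_apply, mul_mono_mono,
          Finset.disjoint_union_left, Finset.disjoint_union_right, huw, and_self, smul_smul,
          Finset.union_assoc, add_assoc, inversions_union_left huv, inversions_union_right hvw]
        congr 1
        have := divCoeff_assoc (F := F) α β γ
        rw [pow_add, pow_add]
        linear_combination (-((-1) ^ inversions v w * (-1) ^ inversions u v *
          (-1) ^ inversions u w)) * this
      · simp [huv, hvw, huw, mul_mono_mono, Finset.disjoint_union_left,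
          Finset.disjoint_union_right]
    · simp [huv, hvw, mul_mono_mono, Finset.disjoint_union_left]
  · by_cases hvw : Disjoint v w
    · simp [huv, hvw, mul_mono_mono, Finset.disjoint_union_right]
    · simp [huv, hvw]

/-- The elements of `𝒪(2m, n)` of parity `e`. -/
noncomputable def par (F : Type*) [Field F] (m n : ℕ) (e : ℕ) : Submodule F (O F m n) :=
  Finsupp.supported F F {a | a.2.card ≡ e [MOD 2]}

theorem neg_one_pow_congr {a b : ℕ} (h : a ≡ b [MOD 2]) : (-1 : F) ^ a = (-1) ^ b := by
  rw [neg_one_pow_eq_pow_mod_two (n := a), neg_one_pow_eq_pow_mod_two (n := b)]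
  rw [show a % 2 = b % 2 from h]

theorem mono_mem_par {e : ℕ} (a : Mon m n) (h : a.2.card ≡ e [MOD 2]) : mono F a ∈ par F m n e :=
  Finsupp.single_mem_supported F _ h

theorem mul_super_comm {e e' : ℕ} {f g : O F m n} (hf : f ∈ par F m n e) (hg : g ∈ par F m n e') :
    mul F f g = (-1 : F) ^ (e * e') • mul F g f := by
  induction hf using supported_induction with
  | zero => simp
  | add f f' _ _ hf hf' => simp [hf, hf']
  | smul c f _ hf => simp [hf, smul_comm c]
  | mono a ha =>
  induction hg using supported_induction with
  | zero => simp
  | add f f' _ _ hf hf' => simp [hf, hf']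
  | smul c f _ hf => simp [hf, smul_comm c]
  | mono b hb =>
  obtain ⟨α, u⟩ := a
  obtain ⟨β, v⟩ := b
  simp only [mul_mono_mono, disjoint_comm (a := v)]
  split_ifs with h
  · rw [smul_smul, add_comm, Finset.union_comm, divCoeff_comm]
    congr 1
    have h1 : (-1 : F) ^ (e * e') = (-1) ^ (u.card * v.card) :=
      neg_one_pow_congr (Nat.ModEq.mul (Nat.ModEq.symm ha) (Nat.ModEq.symm hb))
    rw [h1, ← inversions_add_swap h, pow_add]
    have h2 : ((-1 : F) ^ inversions v u) * (-1) ^ inversions v u = 1 := by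
      rw [← pow_add, ← two_mul, pow_mul]; simp
    linear_combination (-((-1) ^ inversions u v * divCoeff F β α)) * h2
  · simp

theorem mul_mem_par {e e' : ℕ} {f g : O F m n} (hf : f ∈ par F m n e) (hg : g ∈ par F m n e') :
    mul F f g ∈ par F m n (e + e') := by
  induction hf using supported_induction with
  | zero => simp
  | add f f' _ _ hf hf' => simpa using Submodule.add_mem _ hf hf'
  | smul c f _ hf => simpa using Submodule.smul_mem _ c hf
  | mono a ha =>
  induction hg using supported_induction with
  | zero => simp
  | add f f' _ _ hf hf' => simpa using Submodule.add_mem _ hf hf'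
  | smul c f _ hf => simpa using Submodule.smul_mem _ c hf
  | mono b hb =>
  obtain ⟨α, u⟩ := a
  obtain ⟨β, v⟩ := b
  rw [mul_mono_mono]
  split_ifs with h
  · refine Submodule.smul_mem _ _ (mono_mem_par _ ?_)
    rw [Finset.card_union_of_disjoint h]
    exact Nat.ModEq.add ha hb
  · exact Submodule.zero_mem _

theorem pd_odd_mono (k : Fin n) (α : Y0 m → ℕ) (u : Finset (Fin n)) :
    pd F (.inr k) (mono F (α, u)) =
      if k ∈ u then ((-1 : F) ^ inversions {k} (u.erase k)) • mono F (α, u.erase k) else 0 := by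
  rw [pd_mono, monoPartial, filter_lt_card_eq]

theorem pd_even_mono (i : Y0 m) (α : Y0 m → ℕ) (u : Finset (Fin n)) :
    pd F (.inl i) (mono F (α, u)) =
      if α i = 0 then 0 else mono F (Function.update α i (α i - 1), u) := by
  rw [pd_mono, monoPartial]

theorem pd_mem_par {e : ℕ} {f : O F m n} (hf : f ∈ par F m n e) (i : Y m n) :
    pd F i f ∈ par F m n (e + mu i) := by
  induction hf using supported_induction with
  | zero => simp
  | add f f' _ _ hf hf' => simpa using Submodule.add_mem _ hf hf'
  | smul c f _ hf => simpa using Submodule.smul_mem _ c hf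
  | mono a ha =>
  obtain ⟨α, u⟩ := a
  rcases i with i | k
  · rw [pd_even_mono]
    split_ifs
    · exact Submodule.zero_mem _
    · exact mono_mem_par _ ha
  · rw [pd_odd_mono]
    split_ifs with hk
    · refine Submodule.smul_mem _ _ (mono_mem_par _ ?_)
      have h1 := Finset.card_erase_add_one hk
      simp only [Set.mem_ofPred_eq, Nat.ModEq, mu] at ha ⊢
      omega
    · exact Submodule.zero_mem _

theorem divCoeff_update_left (i : Y0 m) (α β : Y0 m → ℕ) (x : ℕ) :
    divCoeff F (Function.update α i x) β =
      ((x + β i).choose x : F) * ∏ j ∈ Finset.univ.erase i, ((α j + β j).choose (α j) : F) := by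
  unfold divCoeff
  rw [← Finset.mul_prod_erase _ _ (Finset.mem_univ i)]
  congr 1
  · simp
  · refine Finset.prod_congr rfl fun j hj => ?_
    rw [Function.update_of_ne (Finset.ne_of_mem_erase hj)]

theorem divCoeff_update_right (i : Y0 m) (α β : Y0 m → ℕ) (x : ℕ) :
    divCoeff F α (Function.update β i x) =
      ((α i + x).choose (α i) : F) *
        ∏ j ∈ Finset.univ.erase i, ((α j + β j).choose (α j) : F) := by
  unfold divCoeff
  rw [← Finset.mul_prod_erase _ _ (Finset.mem_univ i)]
  congr 1
  · simp
  · refine Finset.prod_congr rfl fun j hj => ?_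
    rw [Function.update_of_ne (Finset.ne_of_mem_erase hj)]

theorem divCoeff_erase (i : Y0 m) (α β : Y0 m → ℕ) :
    divCoeff F α β =
      ((α i + β i).choose (α i) : F) *
        ∏ j ∈ Finset.univ.erase i, ((α j + β j).choose (α j) : F) := by
  unfold divCoeff
  rw [← Finset.mul_prod_erase _ _ (Finset.mem_univ i)]

/-- Pascal's rule in the variable x_i. The cases α_i = 0 and β_i = 0 are separate because a term on
the right disappears there. -/
theorem pd_even_mul (i : Y0 m) (f g : O F m n) :
    pd F (.inl i) (mul F f g) = mul F (pd F (.inl i) f) g + mul F f (pd F (.inl i) g) := by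
  induction f using O_induction with
  | zero => simp
  | add f f' hf hf' => simp only [map_add, LinearMap.add_apply, hf, hf']; abel
  | smul c f hf => simp [hf]
  | mono a =>
  induction g using O_induction with
  | zero => simp
  | add f f' hf hf' => simp only [map_add, hf, hf']; abel
  | smul c f hf => simp [hf]
  | mono b =>
  obtain ⟨α, u⟩ := a
  obtain ⟨β, v⟩ := b
  simp only [pd_even_mono, mul_mono_mono]
  by_cases h : Disjoint u v
  swap
  · split_ifs <;> simp [mul_mono_mono, h]
  simp only [h, if_true, map_smul, pd_even_mono, Pi.add_apply]
  rcases Nat.eq_zero_or_pos (α i) with ha | ha <;> rcases Nat.eq_zero_or_pos (β i) with hb | hb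
  · simp [ha, hb]
  · have e : Function.update (α + β) i (α i + β i - 1) = α + Function.update β i (β i - 1) := by
      ext j; by_cases hj : j = i
      · subst hj; simp; omega
      · simp [hj]
    rw [if_neg (by omega), if_pos ha, if_neg (by omega), mul_mono_mono, if_pos h, e,
      divCoeff_update_right, divCoeff_erase i, ha]
    simp
  · have e : Function.update (α + β) i (α i + β i - 1) = Function.update α i (α i - 1) + β := by
      ext j; by_cases hj : j = i
      · subst hj; simp; omega
      · simp [hj]
    rw [if_neg (by omega), if_pos hb, if_neg (by omega), mul_mono_mono, if_pos h, e,
      divCoeff_update_left, divCoeff_erase i, hb]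
    simp
  · have e : Function.update (α + β) i (α i + β i - 1) = Function.update α i (α i - 1) + β := by
      ext j; by_cases hj : j = i
      · subst hj; simp; omega
      · simp [hj]
    have e' : Function.update (α + β) i (α i + β i - 1) = α + Function.update β i (β i - 1) := by
      ext j; by_cases hj : j = i
      · subst hj; simp; omega
      · simp [hj]
    rw [if_neg (by omega), if_neg (by omega), if_neg (by omega), mul_mono_mono, mul_mono_mono,
      if_pos h, if_pos h, ← e, ← e', divCoeff_update_left, divCoeff_update_right,
      divCoeff_erase i α β, ← add_smul]
    congr 1
    obtain ⟨x, hx⟩ := Nat.exists_eq_add_of_lt ha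
    obtain ⟨y, hy⟩ := Nat.exists_eq_add_of_lt hb
    rw [hx, hy]
    have : (0 + x + 1 + (0 + y + 1)).choose (0 + x + 1) =
        (0 + x + 1 - 1 + (0 + y + 1)).choose (0 + x + 1 - 1) +
          (0 + x + 1 + (0 + y + 1 - 1)).choose (0 + x + 1) := by
      have := Nat.choose_succ_succ (x + y + 1) x
      convert this using 3 <;> omega
    rw [this]
    push_cast
    ring

theorem neg_one_pow_mul_self (a : ℕ) : (-1 : F) ^ a * (-1) ^ a = 1 := by
  rw [← pow_add, ← two_mul, pow_mul]; simp

theorem pd_odd_mul (k : Fin n) {e : ℕ} {f : O F m n} (hf : f ∈ par F m n e) (g : O F m n) :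
    pd F (.inr k) (mul F f g) =
      mul F (pd F (.inr k) f) g + (-1 : F) ^ e • mul F f (pd F (.inr k) g) := by
  induction hf using supported_induction with
  | zero => simp
  | add f f' _ _ hf hf' => simp only [map_add, LinearMap.add_apply, hf, hf', smul_add]; abel
  | smul c f _ hf => simp [hf, smul_comm c]
  | mono a ha =>
  induction g using O_induction with
  | zero => simp
  | add f f' hf hf' => simp only [map_add, hf, hf', smul_add]; abel
  | smul c f hf => simp [hf, smul_comm c]
  | mono b =>
  obtain ⟨α, u⟩ := a
  obtain ⟨β, v⟩ := b
  simp only [Set.mem_ofPred_eq] at ha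
  rw [← neg_one_pow_congr ha]
  simp only [pd_odd_mono, mul_mono_mono]
  have key : ∀ w : Finset (Fin n), k ∈ w → ∃ w', k ∉ w' ∧ w = {k} ∪ w' := fun w hw =>
    ⟨w.erase k, Finset.notMem_erase k w, by
      rw [Finset.singleton_union, Finset.insert_erase hw]⟩
  have er : ∀ w : Finset (Fin n), k ∉ w → ({k} ∪ w).erase k = w := fun w hw => by
    rw [Finset.singleton_union, Finset.erase_insert hw]
  have ds : ∀ w : Finset (Fin n), k ∉ w → Disjoint {k} w := fun w hw => by simpa using hw
  by_cases hu : k ∈ u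
  · obtain ⟨u, hku, rfl⟩ := key u hu
    by_cases hv : k ∈ v
    · obtain ⟨v, hkv, rfl⟩ := key v hv
      -- With x_k in both factors the product is zero, and the two terms on the right must cancel.
      have hnd : ¬ Disjoint ({k} ∪ u) ({k} ∪ v) := fun h =>
        Finset.disjoint_left.1 h (by simp : k ∈ _) (by simp)
      simp only [hnd, if_false, map_zero, hu, hv, if_true, map_smul, LinearMap.smul_apply,
        mul_mono_mono, er _ hku, er _ hkv]
      by_cases h : Disjoint u v
      · have h1 : Disjoint u ({k} ∪ v) := by
          rw [Finset.disjoint_union_right]; exact ⟨(ds _ hku).symm, h⟩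
        have h2 : Disjoint ({k} ∪ u) v := by
          rw [Finset.disjoint_union_left]; exact ⟨ds _ hkv, h⟩
        rw [if_pos h1, if_pos h2, Finset.card_union_of_disjoint (ds _ hku),
          inversions_union_right (ds _ hkv), inversions_union_left (ds _ hku),
          show u ∪ ({k} ∪ v) = {k} ∪ u ∪ v by
            rw [← Finset.union_assoc, Finset.union_comm u]]
        simp only [smul_smul, ← add_smul]
        rw [eq_comm, smul_eq_zero]
        left
        have h3 := inversions_add_swap (ds _ hku)
        rw [Finset.card_singleton, one_mul] at h3
        rw [Finset.card_singleton]
        have h4 := neg_one_pow_mul_self (F := F) (inversions {k} v)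
        rw [← h3]
        simp only [pow_add, pow_one]
        linear_combination (- (-1) ^ inversions {k} u * (-1) ^ inversions u {k} *
          (-1) ^ inversions u v * divCoeff F α β) * h4
      · have h1 : ¬ Disjoint u ({k} ∪ v) := by
          rw [Finset.disjoint_union_right]; tauto
        have h2 : ¬ Disjoint ({k} ∪ u) v := by
          rw [Finset.disjoint_union_left]; tauto
        rw [if_neg h1, if_neg h2]
        simp
    · simp only [hu, hv, if_true, if_false, map_zero, smul_zero, add_zero, er _ hku, map_smul,
        LinearMap.smul_apply, mul_mono_mono, Finset.disjoint_union_left, ds _ hv, true_and]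
      by_cases h : Disjoint u v
      · simp only [h, if_true, map_smul, pd_odd_mono]
        rw [if_pos (by simp), Finset.union_assoc,
          er _ (by simp [hku, hv]), smul_smul, smul_smul]
        congr 1
        rw [inversions_union_right h, inversions_union_left (ds _ hku), pow_add, pow_add]
        have h4 := neg_one_pow_mul_self (F := F) (inversions {k} v)
        linear_combination ((-1) ^ inversions {k} u *
          (-1) ^ inversions u v * divCoeff F α β) * h4
      · simp [h]
  · by_cases hv : k ∈ v
    · obtain ⟨v, hkv, rfl⟩ := key v hv
      simp only [hu, hv, if_true, if_false, map_zero, LinearMap.zero_apply, zero_add, er _ hkv,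
        map_smul, mul_mono_mono, Finset.disjoint_union_right, (ds _ hu).symm, true_and]
      by_cases h : Disjoint u v
      · simp only [h, if_true, map_smul, pd_odd_mono]
        rw [if_pos (by simp), show u ∪ ({k} ∪ v) = {k} ∪ (u ∪ v) by
            rw [← Finset.union_assoc, Finset.union_comm u, Finset.union_assoc],
          er _ (by simp [hkv, hu]), smul_smul, smul_smul, smul_smul]
        congr 1
        have h3 := inversions_add_swap (ds _ hu)
        rw [Finset.card_singleton, one_mul] at h3
        rw [← h3, inversions_union_right h, inversions_union_right (ds _ hkv)]
        simp only [pow_add]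
        ring
      · simp [h]
    · have : k ∉ u ∪ v := by simp [hu, hv]
      split_ifs <;> simp [pd_odd_mono, hu, hv]

theorem pd_mul (i : Y m n) {e : ℕ} {f : O F m n} (hf : f ∈ par F m n e) (g : O F m n) :
    pd F i (mul F f g) = mul F (pd F i f) g + (-1 : F) ^ (mu i * e) • mul F f (pd F i g) := by
  rcases i with i | k
  · simpa [mu] using pd_even_mul i f g
  · simpa [mu] using pd_odd_mul k hf g

theorem pd_comm_odd {k l : Fin n} (hkl : k ≠ l) (f : O F m n) :
    pd F (.inr k) (pd F (.inr l) f) = - pd F (.inr l) (pd F (.inr k) f) := by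
  induction f using O_induction with
  | zero => simp
  | add f f' hf hf' => simp only [map_add, hf, hf']; abel
  | smul c f hf => simp [hf]
  | mono a =>
  obtain ⟨α, u⟩ := a
  simp only [pd_odd_mono]
  by_cases hk : k ∈ u <;> by_cases hl : l ∈ u
  · have hk' : k ∈ u.erase l := Finset.mem_erase.2 ⟨hkl, hk⟩
    have hl' : l ∈ u.erase k := Finset.mem_erase.2 ⟨hkl.symm, hl⟩
    simp only [hk, hl, if_true, map_smul, pd_odd_mono, hk', hl', smul_smul]
    rw [Finset.erase_right_comm, ← neg_smul]
    congr 1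
    set w := (u.erase k).erase l with hw
    have hkw : k ∉ w := by simp [hw]
    have hlw : l ∉ w := by simp [hw]
    have e1 : u.erase l = {k} ∪ w := by
      rw [hw, Finset.erase_right_comm, Finset.singleton_union, Finset.insert_erase hk']
    have e2 : u.erase k = {l} ∪ w := by
      rw [hw, Finset.singleton_union, Finset.insert_erase hl']
    rw [e1, e2, inversions_union_right (by simpa using hkw),
      inversions_union_right (by simpa using hlw)]
    have h := inversions_add_swap (u := ({k} : Finset (Fin n))) (v := {l}) (by simpa using hkl)
    rw [Finset.card_singleton, Finset.card_singleton, one_mul] at h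
    have h' : (-1 : F) ^ inversions {k} {l} = - (-1) ^ inversions {l} {k} := by
      have h1 := neg_one_pow_mul_self (F := F) (inversions {l} {k})
      have h2 : (-1 : F) ^ inversions {k} {l} * (-1) ^ inversions {l} {k} = -1 := by
        rw [← pow_add, h, pow_one]
      linear_combination (- (-1) ^ inversions {k} {l}) * h1 + (-1) ^ inversions {l} {k} * h2
    rw [pow_add, pow_add, h']
    ring
  · simp [hk, hl, pd_odd_mono]
  · simp [hk, hl, pd_odd_mono]
  · simp [hk, hl]

theorem pd_odd_sq (k : Fin n) (f : O F m n) : pd F (.inr k) (pd F (.inr k) f) = 0 := by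
  induction f using O_induction with
  | zero => simp
  | add f f' hf hf' => simp [hf, hf']
  | smul c f hf => simp [hf]
  | mono a =>
  obtain ⟨α, u⟩ := a
  rw [pd_odd_mono]
  split_ifs <;> simp [pd_odd_mono]

theorem pd_comm (i j : Y m n) (f : O F m n) :
    pd F i (pd F j f) = (-1 : F) ^ (mu i * mu j) • pd F j (pd F i f) := by
  rcases i with i | k <;> rcases j with j | l
  · simp only [mu, mul_zero, pow_zero, one_smul]
    induction f using O_induction with
    | zero => simp
    | add f f' hf hf' => simp only [map_add, hf, hf']
    | smul c f hf => simp [hf]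
    | mono a =>
    obtain ⟨α, u⟩ := a
    by_cases hij : i = j
    · rw [hij]
    simp only [pd_even_mono]
    split_ifs with h1 h2 h2 <;> simp [pd_even_mono, h1, h2, hij, Ne.symm hij]
    rw [Function.update_comm hij]
  · simp only [mu, zero_mul, pow_zero, one_smul]
    induction f using O_induction with
    | zero => simp
    | add f f' hf hf' => simp only [map_add, hf, hf']
    | smul c f hf => simp [hf]
    | mono a =>
    obtain ⟨α, u⟩ := a
    simp only [pd_even_mono, pd_odd_mono]
    split_ifs with h1 h2 h2 <;> simp [pd_even_mono, pd_odd_mono, h1, h2]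
  · simp only [mu, mul_zero, pow_zero, one_smul]
    induction f using O_induction with
    | zero => simp
    | add f f' hf hf' => simp only [map_add, hf, hf']
    | smul c f hf => simp [hf]
    | mono a =>
    obtain ⟨α, u⟩ := a
    simp only [pd_even_mono, pd_odd_mono]
    split_ifs with h1 h2 h2 <;> simp [pd_even_mono, pd_odd_mono, h1, h2]
  · by_cases hkl : k = l
    · subst hkl
      simp [pd_odd_sq]
    · simp [mu, pd_comm_odd hkl]

end Algebra

end HamSuper

namespace HamSuper

/-! ### Vector fields and the Hamiltonian bracket -/

section VectorFields

variable {F : Type*} [Field F] {m n : ℕ}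

theorem field_apply (i : Y m n) (f h : O F m n) : field F i f h = mul F f (pd F i h) := by
  simp [field]

/-- The operator `E` is a vector field `∑ᵢ aᵢ ∂ᵢ`, necessarily with `aᵢ = E(xᵢ)`. -/
def IsVectorField (E : Module.End F (O F m n)) : Prop :=
  ∀ h, E h = ∑ i, mul F (E (var F i)) (pd F i h)

/-- The vector field `E` is even: the coefficient of `∂ᵢ` has parity `μ(i)`. -/
def IsEvenField (E : Module.End F (O F m n)) : Prop :=
  ∀ i, E (var F i) ∈ par F m n (mu i)

theorem isVectorField_field (i : Y m n) (f : O F m n) : IsVectorField (field F i f) := by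
  intro h
  rw [Finset.sum_eq_single i]
  · simp [field_apply, pd_var, mul_one']
  · intro j _ hj
    simp [field_apply, pd_var, Ne.symm hj]
  · simp

theorem IsVectorField.zero : IsVectorField (0 : Module.End F (O F m n)) := by
  intro h; simp

theorem IsVectorField.add {E E' : Module.End F (O F m n)} (h : IsVectorField E)
    (h' : IsVectorField E') : IsVectorField (E + E') := by
  intro g
  rw [LinearMap.add_apply, h g, h' g, ← Finset.sum_add_distrib]
  simp

theorem IsVectorField.smul {E : Module.End F (O F m n)} (c : F) (h : IsVectorField E) :
    IsVectorField (c • E) := by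
  intro g
  rw [LinearMap.smul_apply, h g, Finset.smul_sum]
  simp

theorem IsVectorField.sum {ι : Type*} {s : Finset ι} {E : ι → Module.End F (O F m n)}
    (h : ∀ i ∈ s, IsVectorField (E i)) : IsVectorField (∑ i ∈ s, E i) :=
  Finset.sum_induction _ _ (fun _ _ => IsVectorField.add) IsVectorField.zero h

theorem IsVectorField.mulLeft {E : Module.End F (O F m n)} (h : IsVectorField E) (f : O F m n) :
    IsVectorField (mul F f * E) := by
  intro g
  rw [Module.End.mul_apply, h g, map_sum]
  refine Finset.sum_congr rfl fun i _ => ?_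
  rw [Module.End.mul_apply, mul_assoc']

theorem IsVectorField.ext {E E' : Module.End F (O F m n)} (h : IsVectorField E)
    (h' : IsVectorField E') (hv : ∀ i, E (var F i) = E' (var F i)) : E = E' := by
  refine LinearMap.ext fun g => ?_
  rw [h g, h' g]
  simp [hv]

/-- Even vector fields are derivations. -/
theorem IsVectorField.leibniz {E : Module.End F (O F m n)} (h : IsVectorField E)
    (he : IsEvenField E) {e : ℕ} {f : O F m n} (hf : f ∈ par F m n e) (g : O F m n) :
    E (mul F f g) = mul F (E f) g + mul F f (E g) := by
  rw [h (mul F f g), h f, h g, map_sum, map_sum, LinearMap.sum_apply, ← Finset.sum_add_distrib]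
  refine Finset.sum_congr rfl fun i _ => ?_
  rw [pd_mul i hf, map_add, map_smul, mul_assoc', mul_assoc', mul_assoc',
    mul_super_comm (he i) hf, map_smul, LinearMap.smul_apply, smul_smul, neg_one_pow_mul_self,
    one_smul]

/-- A composite of two vector fields is a first-order part plus a second-order part. The
second-order parts of the two composites agree by supercommutativity of the coefficients and of the
partial derivatives, so they cancel in the commutator. -/
theorem IsVectorField.lie {E E' : Module.End F (O F m n)} (h : IsVectorField E)
    (he : IsEvenField E) (h' : IsVectorField E') (he' : IsEvenField E') :
    IsVectorField ⁅E, E'⁆ := by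
  have key : ∀ {X Z : Module.End F (O F m n)} (_ : IsVectorField X) (_ : IsEvenField X)
      (_ : IsVectorField Z) (_ : IsEvenField Z) (g : O F m n),
      X (Z g) = ∑ j, mul F (X (Z (var F j))) (pd F j g) +
        ∑ j, ∑ i, mul F (mul F (Z (var F j)) (X (var F i))) (pd F i (pd F j g)) := by
    intro X Z hX heX hZ heZ g
    rw [hZ g, map_sum, ← Finset.sum_add_distrib]
    refine Finset.sum_congr rfl fun j _ => ?_
    rw [hX.leibniz heX (heZ j), hX (pd F j g), map_sum]
    simp [mul_assoc']
  intro g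
  simp only [Ring.lie_def, LinearMap.sub_apply, Module.End.mul_apply, map_sub,
    Finset.sum_sub_distrib]
  rw [key h he h' he' g, key h' he' h he g]
  have : ∑ j, ∑ i, mul F (mul F (E' (var F j)) (E (var F i))) (pd F i (pd F j g)) =
      ∑ j, ∑ i, mul F (mul F (E (var F j)) (E' (var F i))) (pd F i (pd F j g)) := by
    rw [Finset.sum_comm]
    refine Finset.sum_congr rfl fun j _ => Finset.sum_congr rfl fun i _ => ?_
    rw [mul_super_comm (he' i) (he j), pd_comm, map_smul, map_smul, LinearMap.smul_apply,
      smul_smul, mul_comm (mu i), neg_one_pow_mul_self, one_smul]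
  rw [this]
  abel

theorem tau_conj_even (i : Y0 m) : tau (conj (.inl i : Y m n)) = - tau (.inl i : Y m n) := by
  rcases i with i | i <;> simp [tau, conj]

theorem tau_swap (i : Y0 m) : tau (.inl i.swap : Y m n) = - tau (.inl i : Y m n) :=
  tau_conj_even i

theorem conj_inl (i : Y0 m) : conj (.inl i : Y m n) = .inl i.swap := rfl

theorem conj_inr (k : Fin n) : conj (.inr k : Y m n) = .inr k := rfl

theorem mu_conj (i : Y m n) : mu (conj i) = mu i := by
  rcases i with i | k <;> rfl

theorem tau_mul_self (i : Y m n) : (tau i : F) * (tau i : F) = 1 := by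
  rcases i with (i | i) | k <;> simp [tau]

theorem ham_even {f : O F m n} (hf : f ∈ par F m n 0) :
    ham F f = ∑ i, (tau i : F) • field F (conj i) (pd F i f) := by
  induction hf using supported_induction with
  | zero => simp
  | add f f' _ _ hf hf' => simp [hf, hf', Finset.sum_add_distrib]
  | smul c f _ hf => simp only [map_smul, hf, Finset.smul_sum, smul_comm c]
  | mono a ha =>
  have h2 : Even a.2.card := Nat.even_iff.2 ha
  simp only [ham, mono, Finsupp.linearCombination_single, one_smul]
  refine Finset.sum_congr rfl fun i _ => ?_
  rw [(h2.mul_left _).neg_one_pow, mul_one, ← pd_mono]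
  refine LinearMap.ext fun h => ?_
  exact (Int.cast_smul_eq_zsmul F (tau i) (field F (conj i) (pd F i (mono F a)) h)).symm

theorem ham_apply {f : O F m n} (hf : f ∈ par F m n 0) (h : O F m n) :
    ham F f h = ∑ i, (tau i : F) • mul F (pd F i f) (pd F (conj i) h) := by
  rw [ham_even hf, LinearMap.sum_apply]
  simp [field_apply]

theorem isVectorField_ham {f : O F m n} (hf : f ∈ par F m n 0) : IsVectorField (ham F f) := by
  rw [ham_even hf]
  exact IsVectorField.sum fun i _ => (isVectorField_field _ _).smul _

theorem ham_var {f : O F m n} (hf : f ∈ par F m n 0) (j : Y m n) :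
    ham F f (var F j) = (tau (conj j) : F) • pd F (conj j) f := by
  rw [ham_apply hf, Finset.sum_eq_single (conj j)]
  · simp [conj_conj, pd_var, mul_one']
  · intro i _ hi
    have : conj i ≠ j := fun h => hi (by rw [← h, conj_conj])
    simp [pd_var, this]
  · simp

theorem isEvenField_ham {f : O F m n} (hf : f ∈ par F m n 0) : IsEvenField (ham F f) := by
  intro i
  rw [ham_var hf]
  have := pd_mem_par hf (conj i)
  rw [mu_conj, zero_add] at this
  exact Submodule.smul_mem _ _ this

theorem par_congr {e e' : ℕ} (h : e ≡ e' [MOD 2]) : par F m n e = par F m n e' := by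
  unfold par
  congr 1
  ext a
  exact ⟨fun h' => Nat.ModEq.trans h' h, fun h' => Nat.ModEq.trans h' h.symm⟩

theorem sum_conj {M : Type*} [AddCommMonoid M] (f : Y m n → M) :
    ∑ i, f (conj i) = ∑ i, f i :=
  Fintype.sum_equiv ⟨conj, conj, conj_conj, conj_conj⟩ _ _ fun _ => rfl

theorem ham_mem_par {f g : O F m n} (hf : f ∈ par F m n 0) (hg : g ∈ par F m n 0) :
    ham F f g ∈ par F m n 0 := by
  rw [ham_apply hf]
  refine Submodule.sum_mem _ fun i _ => Submodule.smul_mem _ _ ?_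
  have := mul_mem_par (pd_mem_par hf i) (pd_mem_par hg (conj i))
  rw [mu_conj] at this
  rwa [par_congr (e' := 0)] at this
  simp only [Nat.ModEq]
  omega

theorem pd_ham (j : Y m n) {f g : O F m n} (hf : f ∈ par F m n 0) (hg : g ∈ par F m n 0) :
    pd F j (ham F g f) = ham F g (pd F j f) - ham F f (pd F j g) := by
  -- The last sum is reindexed by i ↦ i', so that the two sides match term by term; the change of
  -- sign is τ(i') = -τ(i) for even i and comes from anticommuting factors for odd i.
  rw [ham_apply hg, ham_apply hg, ham_apply hf, map_sum, sub_eq_add_neg, ← Finset.sum_neg_distrib,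
    ← sum_conj fun i => - ((tau i : F) • mul F (pd F i f) (pd F (conj i) (pd F j g))),
    ← Finset.sum_add_distrib]
  refine Finset.sum_congr rfl fun i _ => ?_
  rw [map_smul, pd_mul j (pd_mem_par hg i), zero_add, pd_comm j (conj i) f, mu_conj, map_smul,
    smul_smul, neg_one_pow_mul_self, one_smul, smul_add, add_comm]
  congr 1
  have h2 := pd_mem_par (pd_mem_par hg i) j
  have h3 := pd_mem_par hf (conj i)
  rw [mul_super_comm h2 h3, pd_comm j i, map_smul, smul_smul, smul_smul, conj_conj, ← neg_smul]
  congr 1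
  rcases i with i | k
  · rw [tau_conj_even]
    simp [mu, conj]
  · rw [conj_inr]
    rcases j with j | l <;> simp [mu, tau]

/-- `D_H` is a homomorphism of Lie algebras. -/
theorem lie_ham {f g : O F m n} (hf : f ∈ par F m n 0) (hg : g ∈ par F m n 0) :
    ⁅ham F g, ham F f⁆ = ham F (ham F g f) := by
  refine ((isVectorField_ham hg).lie (isEvenField_ham hg) (isVectorField_ham hf)
    (isEvenField_ham hf)).ext (isVectorField_ham (ham_mem_par hg hf)) fun j => ?_
  rw [Ring.lie_def, LinearMap.sub_apply, Module.End.mul_apply, Module.End.mul_apply, ham_var hf,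
    ham_var hg, ham_var (ham_mem_par hg hf), pd_ham _ hf hg, map_smul, map_smul, smul_sub]

end VectorFields

/-! ### Evaluation at the origin of the even variables -/

section Evaluation

variable {F : Type*} [Field F] {m n : ℕ}

/-- The projection of `𝒪(2m, n)` onto the exterior algebra that kills the even variables. -/
noncomputable def ev0 (F : Type*) [Field F] (m n : ℕ) : Module.End F (O F m n) :=
  Finsupp.linearCombination F fun a => if a.1 = 0 then mono F a else 0

theorem ev0_mono (α : Y0 m → ℕ) (u : Finset (Fin n)) :
    ev0 F m n (mono F (α, u)) = if α = 0 then mono F (α, u) else 0 := by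
  simp [ev0, mono]

theorem ev0_mono_zero (u : Finset (Fin n)) :
    ev0 F m n (mono F (0, u)) = mono F (0, u) := by
  simp [ev0_mono]

theorem ev0_apply_zero (f : O F m n) (u : Finset (Fin n)) : ev0 F m n f (0, u) = f (0, u) := by
  induction f using O_induction with
  | zero => simp
  | add f f' hf hf' => simp [hf, hf']
  | smul c f hf => simp [hf]
  | mono a =>
  obtain ⟨α, v⟩ := a
  rw [ev0_mono]
  split_ifs with h
  · rfl
  · rw [mono, Finsupp.single_apply, if_neg (by simp [h])]
    simp

theorem ev0_apply_of_ne (f : O F m n) {α : Y0 m → ℕ} (hα : α ≠ 0) (u : Finset (Fin n)) :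
    ev0 F m n f (α, u) = 0 := by
  induction f using O_induction with
  | zero => simp
  | add f f' hf hf' => simp [hf, hf']
  | smul c f hf => simp [hf]
  | mono a =>
  obtain ⟨β, v⟩ := a
  rw [ev0_mono]
  split_ifs with h
  · subst h
    rw [mono, Finsupp.single_apply, if_neg (by simp [Ne.symm hα])]
  · simp

/-- Exponents are nonnegative, so α + β = 0 only if both vanish; the positive-degree part is an
ideal. -/
theorem ev0_mul (f g : O F m n) :
    ev0 F m n (mul F f g) = mul F (ev0 F m n f) (ev0 F m n g) := by
  induction f using O_induction with
  | zero => simp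
  | add f f' hf hf' => simp [hf, hf']
  | smul c f hf => simp [hf]
  | mono a =>
  induction g using O_induction with
  | zero => simp
  | add f f' hf hf' => simp [hf, hf']
  | smul c f hf => simp [hf]
  | mono b =>
  obtain ⟨α, u⟩ := a
  obtain ⟨β, v⟩ := b
  rw [mul_mono_mono]
  simp only [ev0_mono]
  by_cases hα : α = 0
  · by_cases hβ : β = 0
    · subst hα hβ
      split_ifs <;> simp_all [mul_mono_mono, ev0_mono]
    · have : α + β ≠ 0 := by simpa [hα] using hβ
      split_ifs <;> simp [ev0_mono, *]
  · have : α + β ≠ 0 := fun h => hα (add_eq_zero.1 h).1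
    split_ifs <;> simp [ev0_mono, *]

theorem ev0_pd_odd (k : Fin n) (f : O F m n) :
    ev0 F m n (pd F (.inr k) f) = pd F (.inr k) (ev0 F m n f) := by
  induction f using O_induction with
  | zero => simp
  | add f f' hf hf' => simp [hf, hf']
  | smul c f hf => simp [hf]
  | mono a =>
  obtain ⟨α, u⟩ := a
  rw [pd_odd_mono, ev0_mono]
  split_ifs <;> simp [pd_odd_mono, ev0_mono, *]

theorem ev0_mem_par {e : ℕ} {f : O F m n} (hf : f ∈ par F m n e) : ev0 F m n f ∈ par F m n e := by
  induction hf using supported_induction with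
  | zero => simp
  | add f f' _ _ hf hf' => simpa using Submodule.add_mem _ hf hf'
  | smul c f _ hf => simpa using Submodule.smul_mem _ c hf
  | mono a ha =>
  obtain ⟨α, u⟩ := a
  rw [ev0_mono]
  split_ifs
  · exact mono_mem_par _ ha
  · exact Submodule.zero_mem _

theorem pd_even_apply (i : Y0 m) (f : O F m n) (α : Y0 m → ℕ) (u : Finset (Fin n)) :
    pd F (.inl i) f (α, u) = f (α + Pi.single i 1, u) := by
  induction f using O_induction with
  | zero => simp
  | add f f' hf hf' => simp [hf, hf']
  | smul c f hf => simp [hf]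
  | mono a =>
  obtain ⟨β, v⟩ := a
  rw [pd_even_mono]
  split_ifs with h
  · rw [mono, Finsupp.single_apply, if_neg]
    · simp
    · intro he
      have := congrFun (congrArg Prod.fst he) i
      simp at this
      omega
  · simp only [mono, Finsupp.single_apply]
    refine if_congr ?_ rfl rfl
    simp only [Prod.mk.injEq]
    refine and_congr_left fun _ => ⟨fun he => ?_, fun he => ?_⟩
    · ext j
      have := congrFun he j
      by_cases hj : j = i
      · subst hj; simp at this ⊢; omega
      · simpa [hj] using this
    · ext j
      have := congrFun he j
      by_cases hj : j = i
      · subst hj; simp at this ⊢; omega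
      · simpa [hj] using this

/-- An element is determined by its value at `0` and its even derivatives. -/
theorem eq_zero_of_ev0_of_pd {f : O F m n} (h0 : ev0 F m n f = 0)
    (h1 : ∀ i, pd F (.inl i) f = 0) : f = 0 := by
  refine Finsupp.ext fun a => ?_
  obtain ⟨α, u⟩ := a
  by_cases hα : α = 0
  · subst hα
    rw [← ev0_apply_zero, h0]
  · obtain ⟨i, hi⟩ : ∃ i, α i ≠ 0 := by
      by_contra hcon; push Not at hcon; exact hα (funext hcon)
    have : α = Function.update α i (α i - 1) + Pi.single i 1 := by
      ext j
      by_cases hj : j = i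
      · subst hj; simp; omega
      · simp [hj]
    rw [this, ← pd_even_apply, h1]
    rfl

end Evaluation

end HamSuper

namespace HamSuper

/-! ### Degree in the even variables -/

section Degree

variable {F : Type*} [Field F] {m n : ℕ}

/-- The elements of `𝒪(2m, n)` all of whose monomials have degree at least `d` in the even
variables. -/
noncomputable def evenDegGE (F : Type*) [Field F] (m n d : ℕ) : Submodule F (O F m n) :=
  Finsupp.supported F F {a | d ≤ ∑ i, a.1 i}

theorem mono_mem_evenDegGE {d : ℕ} {a : Mon m n} (h : d ≤ ∑ i, a.1 i) :
    mono F a ∈ evenDegGE F m n d :=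
  Finsupp.single_mem_supported F _ h

theorem evenDegGE_anti {d d' : ℕ} (h : d ≤ d') : evenDegGE F m n d' ≤ evenDegGE F m n d :=
  Finsupp.supported_mono fun _ ha => h.trans ha

theorem sum_update_pred {α : Y0 m → ℕ} {i : Y0 m} (h : α i ≠ 0) :
    ∑ j, Function.update α i (α i - 1) j + 1 = ∑ j, α j := by
  rw [← Finset.add_sum_erase _ _ (Finset.mem_univ i), ← Finset.add_sum_erase _ α (Finset.mem_univ i)]
  rw [Finset.sum_congr rfl (fun j hj => Function.update_of_ne (Finset.ne_of_mem_erase hj) _ _)]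
  simp
  omega

theorem pd_mem_evenDegGE {d : ℕ} {f : O F m n} (hf : f ∈ evenDegGE F m n (d + 1)) (i : Y m n) :
    pd F i f ∈ evenDegGE F m n d := by
  induction hf using supported_induction with
  | zero => simp
  | add f f' _ _ hf hf' => simpa using Submodule.add_mem _ hf hf'
  | smul c f _ hf => simpa using Submodule.smul_mem _ c hf
  | mono a ha =>
  obtain ⟨α, u⟩ := a
  simp only [Set.mem_ofPred_eq] at ha
  rcases i with i | k
  · rw [pd_even_mono]
    split_ifs with h
    · exact Submodule.zero_mem _
    · refine mono_mem_evenDegGE ?_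
      have := sum_update_pred h
      simp only
      omega
  · rw [pd_odd_mono]
    split_ifs
    · refine Submodule.smul_mem _ _ (mono_mem_evenDegGE ?_)
      simp only
      omega
    · exact Submodule.zero_mem _

theorem ev0_eq_zero {f : O F m n} (hf : f ∈ evenDegGE F m n 1) : ev0 F m n f = 0 := by
  induction hf using supported_induction with
  | zero => simp
  | add f f' _ _ hf hf' => simp [hf, hf']
  | smul c f _ hf => simp [hf]
  | mono a ha =>
  obtain ⟨α, u⟩ := a
  rw [ev0_mono, if_neg]
  rintro rfl
  simp at ha

theorem pd_even_mono_add (i : Y0 m) (α : Y0 m → ℕ) (u : Finset (Fin n)) :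
    pd F (.inl i) (mono F (α + Pi.single i 1, u)) = mono F (α, u) := by
  rw [pd_even_mono, if_neg (by simp)]
  congr 2
  ext j
  by_cases hj : j = i
  · subst hj; simp
  · simp [hj]

theorem pd_even_mono_single (i j : Y0 m) (u : Finset (Fin n)) :
    pd F (.inl i) (mono F (Pi.single j 1, u)) = if i = j then mono F (0, u) else 0 := by
  split_ifs with h
  · subst h
    have := pd_even_mono_add (F := F) i 0 u
    rwa [zero_add] at this
  · rw [pd_even_mono, if_pos (by simp [h])]

theorem pd_even_mono_zero (i : Y0 m) (u : Finset (Fin n)) :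
    pd F (.inl i) (mono F (0, u)) = 0 := by
  simp [pd_even_mono]

end Degree

/-! ### Normalized derivations and the recursion for χ -/

section NormalizedDerivations

variable {F : Type*} [Field F] {m n : ℕ}

/-- The map `f ↦ φ(D_H(f))` of a derivation `φ : 𝓗 → 𝒲` that vanishes on `𝓗_{[-1]} ⊕ 𝓗_{[0]}`,
with the standing hypotheses on the parameters. -/
structure IsNormalized (p : ℕ) (t : Y0 m → ℕ) (ψ : O F m n →ₗ[F] Module.End F (O F m n)) :
    Prop where
  charP : CharP F p
  three_lt_p : 3 < p
  one_lt_m : 1 < m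
  three_lt_n : 3 < n
  t_pos : ∀ i, 0 < t i
  vectorField : ∀ f, IsVectorField (ψ f)
  evenField : ∀ f, IsEvenField (ψ f)
  der : ∀ f g, f ∈ potentials F p m n t → g ∈ potentials F p m n t →
    ham F g f ∈ potentials F p m n t → ψ (ham F g f) = ⁅ham F g, ψ f⁆ - ⁅ham F f, ψ g⁆
  low : ∀ a : Mon m n, Even a.2.card → ∑ i, a.1 i + a.2.card ≤ 2 → ψ (mono F a) = 0

/-- The coefficient of `∂_j` in `ψ(f)` at the origin of the even variables. -/
noncomputable def chi (ψ : O F m n →ₗ[F] Module.End F (O F m n)) (j : Y m n) :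
    Module.End F (O F m n) :=
  (ev0 F m n).comp ((LinearMap.applyₗ (var F j)).comp ψ)

theorem chi_apply (ψ : O F m n →ₗ[F] Module.End F (O F m n)) (j : Y m n) (f : O F m n) :
    chi ψ j f = ev0 F m n (ψ f (var F j)) := rfl

/-- The coefficient of `∂_j` in `[D_H(g), ψ(f)]` at the origin of the even variables. -/
noncomputable def act (ψ : O F m n →ₗ[F] Module.End F (O F m n)) (g f : O F m n) (j : Y m n) :
    O F m n :=
  ev0 F m n (⁅ham F g, ψ f⁆ (var F j))

theorem potentials_le_par (p : ℕ) (t : Y0 m → ℕ) : potentials F p m n t ≤ par F m n 0 :=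
  Finsupp.supported_mono fun _ ha => Nat.even_iff.1 ha.2.1

theorem mono_mem_potentials {p : ℕ} {t : Y0 m → ℕ} {α : Y0 m → ℕ} {u : Finset (Fin n)}
    (h1 : α ≤ topExp p t) (h2 : Even u.card) (h3 : ¬ (α = topExp p t ∧ u = Finset.univ)) :
    mono F (α, u) ∈ potentials F p m n t :=
  Finsupp.single_mem_supported F _ ⟨h1, h2, by simpa using h3⟩

theorem pd_mem_potentials {p : ℕ} {t : Y0 m → ℕ} {f : O F m n} (hf : f ∈ potentials F p m n t)
    (i : Y0 m) : pd F (.inl i) f ∈ potentials F p m n t := by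
  induction hf using supported_induction with
  | zero => simp
  | add f f' _ _ hf hf' => simpa using Submodule.add_mem _ hf hf'
  | smul c f _ hf => simpa using Submodule.smul_mem _ c hf
  | mono a ha =>
  obtain ⟨α, u⟩ := a
  obtain ⟨h1, h2, h3⟩ := ha
  rw [pd_even_mono]
  split_ifs with h
  · exact Submodule.zero_mem _
  · refine mono_mem_potentials (fun j => ?_) h2 ?_
    · by_cases hj : j = i
      · subst hj; simpa using (Nat.sub_le _ _).trans (h1 j)
      · simpa [hj] using h1 j
    · rintro ⟨h4, -⟩
      have := congrFun h4 i
      have h5 := h1 i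
      simp at this h5
      omega

theorem ham_var_even (l : Y0 m) (h : O F m n) :
    ham F (var F (.inl l)) h = (tau (.inl l : Y m n) : F) • pd F (.inl l.swap) h := by
  have hl : var F (.inl l : Y m n) ∈ par F m n 0 := mono_mem_par _ (by simp; rfl)
  rw [ham_apply hl, Finset.sum_eq_single (.inl l)]
  · rw [pd_var, if_pos rfl, conj_inl]
    congr 1
    induction (pd F (.inl l.swap) h) using O_induction with
    | zero => simp
    | add f f' hf hf' => rw [map_add, hf, hf']
    | smul c f hf => rw [map_smul, hf]
    | mono a => rw [mul_mono_mono]; simp [inversions, divCoeff]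
  · intro i _ hi
    rw [pd_var, if_neg hi]
    simp
  · simp

variable {p : ℕ} {t : Y0 m → ℕ} {ψ : O F m n →ₗ[F] Module.End F (O F m n)}

theorem act_of_eq_zero {f : O F m n} (hf : ψ f = 0) (g : O F m n) (j : Y m n) :
    act ψ g f j = 0 := by
  simp [act, hf, Ring.lie_def]

namespace IsNormalized

theorem prime (H : IsNormalized p t ψ) : p.Prime := by
  have := H.charP
  rcases CharP.char_is_prime_or_zero F p with h | h
  · exact h
  · have := H.three_lt_p; omega

/-- The bound is 4 rather than 3 because a prime p > 3 is at least 5. It lets every monomial of even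
degree at most 4 be a legitimate potential. -/
theorem three_le_topExp (H : IsNormalized p t ψ) (i : Y0 m) : 4 ≤ topExp p t i ∧
    topExp p t i + 1 = p ^ t i := by
  have h1 := H.three_lt_p
  have h2 : p ^ 1 ≤ p ^ t i := Nat.pow_le_pow_right (by omega) (H.t_pos i)
  have h3 : p ≠ 4 := by
    rintro rfl
    exact absurd H.prime (by norm_num)
  rw [pow_one] at h2
  unfold topExp
  omega

theorem cast_topExp (H : IsNormalized p t ψ) (i : Y0 m) : (topExp p t i : F) = -1 := by
  have := H.charP
  have h := (H.three_le_topExp i).2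
  have h2 : ((topExp p t i + 1 : ℕ) : F) = 0 := by
    rw [h, CharP.cast_eq_zero_iff F p]
    exact dvd_pow_self p (H.t_pos i).ne'
  push_cast at h2
  linear_combination h2

theorem var_mem (H : IsNormalized p t ψ) (l : Y0 m) :
    var F (.inl l) ∈ potentials F p m n t := by
  refine mono_mem_potentials (fun j => ?_) (by simp) ?_
  · have := (H.three_le_topExp j).1
    by_cases hj : j = l
    · subst hj; simp; omega
    · simp [hj]
  · rintro ⟨-, h⟩
    have h2 := congrArg Finset.card h
    have := H.three_lt_n
    simp at h2
    omega

/-- ∂_i is a multiple of D_H(x_{i'}), on which ψ vanishes, so the derivation law loses one of its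
two terms. -/
theorem psi_pd_lie (H : IsNormalized p t ψ) {f : O F m n} (hf : f ∈ potentials F p m n t)
    (i : Y0 m) : ψ (pd F (.inl i) f) = ⁅(pd F (.inl i) : Module.End F (O F m n)), ψ f⁆ := by
  have h0 : ψ (var F (.inl i.swap)) = 0 := H.low _ (by simp) (by simp)
  have e : ham F (var F (.inl i.swap : Y m n)) = (tau (.inl i.swap : Y m n) : F) • pd F (.inl i) := by
    refine LinearMap.ext fun h => ?_
    rw [ham_var_even, Sum.swap_swap]
    rfl
  have h := H.der f _ hf (H.var_mem i.swap) (by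
    rw [e]; exact Submodule.smul_mem _ _ (pd_mem_potentials hf i))
  rw [h0, e] at h
  have hτ := tau_mul_self (F := F) (.inl i.swap : Y m n)
  have h2 := congrArg (fun E => (tau (.inl i.swap : Y m n) : F) • E) h
  simp only [LinearMap.smul_apply, map_smul, smul_smul, hτ, one_smul] at h2
  rw [h2]
  refine LinearMap.ext fun x => ?_
  simp only [Ring.lie_def, LinearMap.smul_apply, LinearMap.sub_apply, Module.End.mul_apply,
    map_smul, smul_sub, smul_smul, hτ, one_smul, LinearMap.zero_apply, map_zero,
    sub_zero]

theorem psi_const (H : IsNormalized p t ψ) (f : O F m n) : ψ f (mono F (0, ∅)) = 0 := by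
  rw [H.vectorField f]
  refine Finset.sum_eq_zero fun i _ => ?_
  rcases i with i | k
  · rw [pd_even_mono_zero, map_zero]
  · rw [pd_odd_mono]; simp

/-- The commutator with ∂_i acts coefficientwise: the correction ψ(f)(∂_i x_j) is a vector field
applied to a constant. -/
theorem psi_pd (H : IsNormalized p t ψ) {f : O F m n} (hf : f ∈ potentials F p m n t)
    (i : Y0 m) (j : Y m n) : ψ (pd F (.inl i) f) (var F j) = pd F (.inl i) (ψ f (var F j)) := by
  rw [H.psi_pd_lie hf, Ring.lie_def, LinearMap.sub_apply, Module.End.mul_apply,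
    Module.End.mul_apply, pd_var]
  split_ifs
  · rw [H.psi_const, sub_zero]
  · rw [map_zero, sub_zero]

/-- `ψ(f)` is determined by its value at the origin and the `ψ(∂ᵢ f)`. -/
theorem psi_eq_zero (H : IsNormalized p t ψ) {f : O F m n} (hf : f ∈ potentials F p m n t)
    (h0 : ∀ j, chi ψ j f = 0) (h1 : ∀ i, ψ (pd F (.inl i) f) = 0) : ψ f = 0 := by
  refine (H.vectorField f).ext IsVectorField.zero fun j => ?_
  refine eq_zero_of_ev0_of_pd (h0 j) fun i => ?_
  rw [← H.psi_pd hf, h1]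
  rfl

theorem chi_mem_par (H : IsNormalized p t ψ) (f : O F m n) (j : Y m n) :
    chi ψ j f ∈ par F m n (mu j) :=
  ev0_mem_par (H.evenField f j)

theorem chi_ham (H : IsNormalized p t ψ) {f g : O F m n} (hf : f ∈ potentials F p m n t)
    (hg : g ∈ potentials F p m n t) (hgf : ham F g f ∈ potentials F p m n t) (j : Y m n) :
    chi ψ j (ham F g f) = act ψ g f j - act ψ f g j := by
  rw [chi_apply, H.der f g hf hg hgf, LinearMap.sub_apply, map_sub]
  rfl

/-- Even derivatives of the coefficients of ψ(f) are coefficients of ψ at derivatives of f, so the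
value at the origin involves ψ only through χ. Of g only first and second derivatives at the origin
enter; the special cases below read this formula for g of even degree 0, 1, 2 and at least 3. -/
theorem act_eq (H : IsNormalized p t ψ) {f g : O F m n} (hf : f ∈ potentials F p m n t)
    (hg : g ∈ potentials F p m n t) (j : Y m n) :
    act ψ g f j =
      ∑ i : Y0 m, (tau (.inl i : Y m n) : F) •
        mul F (ev0 F m n (pd F (.inl i) g)) (chi ψ j (pd F (.inl i.swap) f)) +
      ∑ k : Fin n, mul F (ev0 F m n (pd F (.inr k) g)) (pd F (.inr k) (chi ψ j f)) -
      (tau (conj j) : F) •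
        (∑ i : Y0 m, mul F (chi ψ (.inl i) f) (ev0 F m n (pd F (.inl i) (pd F (conj j) g))) +
        ∑ k : Fin n, mul F (chi ψ (.inr k) f)
          (ev0 F m n (pd F (.inr k) (pd F (conj j) g)))) := by
  have hg' := potentials_le_par p t hg
  rw [act, Ring.lie_def, LinearMap.sub_apply, Module.End.mul_apply, Module.End.mul_apply,
    ham_var hg', ham_apply hg', map_smul, H.vectorField f (pd F (conj j) g), map_sub, map_smul,
    map_sum, map_sum, Fintype.sum_sum_type (α₁ := Y0 m) (α₂ := Fin n),
    Fintype.sum_sum_type (α₁ := Y0 m) (α₂ := Fin n)]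
  refine congrArg₂ _ (congrArg₂ _ ?_ ?_) (congrArg _ (congrArg₂ _ ?_ ?_))
  · refine Finset.sum_congr rfl fun i _ => ?_
    rw [map_smul, ev0_mul, conj_inl, ← H.psi_pd hf]
    rfl
  · refine Finset.sum_congr rfl fun k _ => ?_
    rw [map_smul, ev0_mul, conj_inr, ev0_pd_odd k (ψ f _)]
    simp [tau, chi_apply]
  · refine Finset.sum_congr rfl fun i _ => ?_
    rw [ev0_mul]; rfl
  · refine Finset.sum_congr rfl fun i _ => ?_
    rw [ev0_mul]; rfl

/-- First and second derivatives of such a g vanish at the origin. This is the source of nearly all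
vanishing of χ on brackets. -/
theorem act_high (H : IsNormalized p t ψ) {f g : O F m n} (hf : f ∈ potentials F p m n t)
    (hg : g ∈ potentials F p m n t) (hd : g ∈ evenDegGE F m n 3) (j : Y m n) :
    act ψ g f j = 0 := by
  have h1 : ∀ i, ev0 F m n (pd F i g) = 0 := fun i =>
    ev0_eq_zero (evenDegGE_anti one_le_two (pd_mem_evenDegGE hd i))
  have h2 : ∀ i l, ev0 F m n (pd F i (pd F l g)) = 0 := fun i l =>
    ev0_eq_zero (pd_mem_evenDegGE (pd_mem_evenDegGE hd l) i)
  rw [H.act_eq hf hg]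
  simp [h1, h2]

/-- Among the second derivatives only those in two even directions survive at the origin, and these
do not occur in the coefficient of an odd ∂_l. -/
theorem act_two_odd (H : IsNormalized p t ψ) {f g : O F m n} (hf : f ∈ potentials F p m n t)
    (hg : g ∈ potentials F p m n t) (hd : g ∈ evenDegGE F m n 2) (l : Fin n) :
    act ψ g f (.inr l) = 0 := by
  have h1 : ∀ i, ev0 F m n (pd F i g) = 0 := fun i => ev0_eq_zero (pd_mem_evenDegGE hd i)
  have h2 : ∀ i, ev0 F m n (pd F i (pd F (.inr l) g)) = 0 := fun i => by
    rw [pd_comm, map_smul]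
    have : mu (.inr l : Y m n) = 1 := rfl
    rw [ev0_pd_odd, h1, map_zero, smul_zero]
  rw [H.act_eq hf hg]
  simp [h1, h2, conj_inr]

theorem act_two (H : IsNormalized p t ψ) {f : O F m n} (hf : f ∈ potentials F p m n t)
    {a b : Y0 m} {v : Finset (Fin n)}
    (hg : mono F (Pi.single a 1 + Pi.single b 1, v) ∈ potentials F p m n t) (j : Y0 m) :
    act ψ (mono F (Pi.single a 1 + Pi.single b 1, v)) f (.inl j) =
      if j.swap = b then (tau (.inl j : Y m n) : F) • mul F (chi ψ (.inl a) f) (mono F (0, v))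
      else if j.swap = a then (tau (.inl j : Y m n) : F) •
        mul F (chi ψ (.inl b) f) (mono F (0, v))
      else 0 := by
  have hd : mono F (Pi.single a 1 + Pi.single b 1, v) ∈ evenDegGE F m n 2 :=
    mono_mem_evenDegGE (by simp [Finset.sum_add_distrib])
  have h1 : ∀ i, ev0 F m n (pd F i (mono F (Pi.single a 1 + Pi.single b 1, v))) = 0 := fun i =>
    ev0_eq_zero (pd_mem_evenDegGE hd i)
  have h2 : ∀ (k : Fin n) i, ev0 F m n (pd F (.inr k) (pd F i
      (mono F (Pi.single a 1 + Pi.single b 1, v)))) = 0 := fun k i => by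
    rw [ev0_pd_odd, h1, map_zero]
  rw [H.act_eq hf hg]
  simp only [h1, h2, map_zero, LinearMap.zero_apply, smul_zero, Finset.sum_const_zero, add_zero,
    conj_inl, zero_sub, tau_swap]
  have key : ∀ (c : Y0 m), ∑ i, mul F (chi ψ (.inl i) f) (ev0 F m n (pd F (.inl i)
      (mono F (Pi.single c 1, v)))) = mul F (chi ψ (.inl c) f) (mono F (0, v)) := by
    intro c
    rw [Finset.sum_eq_single c]
    · rw [pd_even_mono_single, if_pos rfl, ev0_mono_zero]
    · intro i _ hi
      rw [pd_even_mono_single, if_neg hi]; simp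
    · simp
  split_ifs with hb ha
  · rw [hb, pd_even_mono_add, key]
    simp
  · rw [ha, add_comm, pd_even_mono_add, key]
    simp
  · rw [pd_even_mono, if_pos (by simp [ha, hb])]
    simp

theorem act_one_odd (H : IsNormalized p t ψ) {f : O F m n} (hf : f ∈ potentials F p m n t)
    {i : Y0 m} {v : Finset (Fin n)} (hg : mono F (Pi.single i 1, v) ∈ potentials F p m n t)
    (l : Fin n) :
    act ψ (mono F (Pi.single i 1, v)) f (.inr l) =
      (tau (.inl i : Y m n) : F) • mul F (mono F (0, v)) (chi ψ (.inr l) (pd F (.inl i.swap) f)) -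
        mul F (chi ψ (.inl i) f) (pd F (.inr l) (mono F (0, v))) := by
  have hd : mono F (Pi.single i 1, v) ∈ evenDegGE F m n 1 :=
    mono_mem_evenDegGE (by simp)
  rw [H.act_eq hf hg]
  have h1 : ∀ k, ev0 F m n (pd F (.inr k) (mono F (Pi.single i 1, v))) = 0 := fun k => by
    rw [ev0_pd_odd, ev0_eq_zero hd, map_zero]
  have h2 : ∀ k, ev0 F m n (pd F (.inr k) (pd F (.inr l) (mono F (Pi.single i 1, v)))) = 0 :=
    fun k => by rw [ev0_pd_odd, h1, map_zero]
  simp only [h1, h2, map_zero, LinearMap.zero_apply, Finset.sum_const_zero, add_zero, conj_inr]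
  rw [Finset.sum_eq_single i, Finset.sum_eq_single i]
  · rw [pd_comm, pd_even_mono_single, if_pos rfl, ev0_mono_zero, map_smul, ev0_pd_odd,
      ev0_mono_zero]
    simp [tau, mu]
  · intro l' _ hl
    rw [pd_comm, pd_even_mono_single, if_neg hl]; simp
  · simp
  · intro l' _ hl
    rw [pd_even_mono_single, if_neg hl]; simp
  · simp

theorem act_one (H : IsNormalized p t ψ) {f : O F m n} (hf : f ∈ potentials F p m n t)
    {i : Y0 m} {v : Finset (Fin n)} (hg : mono F (Pi.single i 1, v) ∈ potentials F p m n t)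
    (j : Y0 m) :
    act ψ (mono F (Pi.single i 1, v)) f (.inl j) =
      (tau (.inl i : Y m n) : F) • mul F (mono F (0, v)) (chi ψ (.inl j) (pd F (.inl i.swap) f)) -
        if j.swap = i then (tau (.inl i : Y m n) : F) •
          ∑ k, mul F (chi ψ (.inr k) f) (pd F (.inr k) (mono F (0, v))) else 0 := by
  have hd : mono F (Pi.single i 1, v) ∈ evenDegGE F m n 1 :=
    mono_mem_evenDegGE (by simp)
  rw [H.act_eq hf hg]
  have h1 : ∀ k, ev0 F m n (pd F (.inr k) (mono F (Pi.single i 1, v))) = 0 := fun k => by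
    rw [ev0_pd_odd, ev0_eq_zero hd, map_zero]
  simp only [h1, map_zero, LinearMap.zero_apply, Finset.sum_const_zero, add_zero, conj_inl]
  rw [Finset.sum_eq_single i]
  · rw [pd_even_mono_single, if_pos rfl, ev0_mono_zero]
    congr 1
    rw [pd_even_mono_single]
    split_ifs with h
    · subst h
      simp only [pd_even_mono_zero, map_zero, Finset.sum_const_zero, zero_add, ev0_pd_odd,
        ev0_mono_zero]
    · simp
  · intro l' _ hl
    rw [pd_even_mono_single, if_neg hl]; simp
  · simp

theorem act_zero_odd (H : IsNormalized p t ψ) {f : O F m n} (hf : f ∈ potentials F p m n t)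
    {v : Finset (Fin n)} (hg : mono F (0, v) ∈ potentials F p m n t) (l : Fin n) :
    act ψ (mono F (0, v)) f (.inr l) =
      ∑ k : Fin n, mul F (pd F (.inr k) (mono F (0, v))) (pd F (.inr k) (chi ψ (.inr l) f)) -
        ∑ k : Fin n, mul F (chi ψ (.inr k) f) (pd F (.inr k) (pd F (.inr l) (mono F (0, v)))) := by
  rw [H.act_eq hf hg]
  simp only [pd_even_mono_zero, map_zero, LinearMap.zero_apply, smul_zero, Finset.sum_const_zero,
    zero_add, conj_inr, ev0_pd_odd, ev0_mono_zero]
  have : ∀ i : Y0 m, pd F (.inl i) (pd F (.inr l) (mono F ((0, v) : Mon m n))) = 0 := fun i => by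
    rw [pd_comm, pd_even_mono_zero]; simp
  simp [this, tau]

theorem act_zero (H : IsNormalized p t ψ) {f : O F m n} (hf : f ∈ potentials F p m n t)
    {v : Finset (Fin n)} (hg : mono F (0, v) ∈ potentials F p m n t) (j : Y0 m) :
    act ψ (mono F (0, v)) f (.inl j) =
      ∑ k : Fin n, mul F (pd F (.inr k) (mono F (0, v))) (pd F (.inr k) (chi ψ (.inl j) f)) := by
  rw [H.act_eq hf hg]
  simp [pd_even_mono_zero, conj_inl, ev0_pd_odd, ev0_mono_zero]

end IsNormalized

end NormalizedDerivations

end HamSuper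

namespace HamSuper

/-! ### Brackets with monomials in the even variables -/

section Brackets

variable {F : Type*} [Field F] {m n : ℕ}

theorem mono_mem_potentials_iff {p : ℕ} {t : Y0 m → ℕ} {α : Y0 m → ℕ} {u : Finset (Fin n)} :
    mono F (α, u) ∈ potentials F p m n t ↔
      α ≤ topExp p t ∧ Even u.card ∧ ¬ (α = topExp p t ∧ u = Finset.univ) := by
  refine ⟨fun h => ?_, fun h => mono_mem_potentials h.1 h.2.1 h.2.2⟩
  have := (Finsupp.mem_supported F _).1 h (show (α, u) ∈ (mono F (α, u)).support by
    simp [mono])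
  obtain ⟨h1, h2, h3⟩ := this
  exact ⟨h1, h2, by simpa using h3⟩

theorem mono_mem_potentials_of_lt {p : ℕ} {t : Y0 m → ℕ} {α : Y0 m → ℕ} {u : Finset (Fin n)}
    (h1 : α ≤ topExp p t) (h2 : Even u.card) {i : Y0 m} (hi : α i < topExp p t i) :
    mono F (α, u) ∈ potentials F p m n t :=
  mono_mem_potentials h1 h2 fun h => hi.ne (congrFun h.1 i)

theorem exists_add_single {α : Y0 m → ℕ} {i : Y0 m} {k : ℕ} (h : k ≤ α i) :
    ∃ β : Y0 m → ℕ, α = β + Pi.single i k := by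
  refine ⟨Function.update α i (α i - k), ?_⟩
  ext j
  by_cases hj : j = i
  · subst hj; simp; omega
  · simp [hj]

theorem mul_pure_mono (α β : Y0 m → ℕ) (u : Finset (Fin n)) :
    mul F (mono F (α, ∅)) (mono F (β, u)) = divCoeff F α β • mono F (α + β, u) := by
  rw [mul_mono_mono, if_pos (Finset.disjoint_empty_left u)]
  simp [inversions]

theorem divCoeff_single (i : Y0 m) (k : ℕ) (β : Y0 m → ℕ) :
    divCoeff F (Pi.single i k) β = ((k + β i).choose k : F) := by
  rw [divCoeff, Finset.prod_eq_single i]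
  · simp
  · intro j _ hj
    simp [hj]
  · simp

theorem mul_single_pd_self (i : Y0 m) (α : Y0 m → ℕ) (u : Finset (Fin n)) :
    mul F (mono F (Pi.single i 1, ∅)) (pd F (.inl i) (mono F (α, u))) =
      (α i : F) • mono F (α, u) := by
  by_cases h : α i = 0
  · rw [pd_even_mono, if_pos h, h]; simp
  · obtain ⟨β, rfl⟩ := exists_add_single (k := 1) (Nat.one_le_iff_ne_zero.2 h)
    rw [pd_even_mono_add, mul_pure_mono, divCoeff_single, add_comm]
    simp [add_comm]

theorem ham_pure (δ : Y0 m → ℕ) (h : O F m n) :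
    ham F (mono F (δ, ∅)) h = ∑ i : Y0 m, (tau (.inl i : Y m n) : F) •
      mul F (pd F (.inl i) (mono F (δ, ∅))) (pd F (.inl i.swap) h) := by
  have h0 : mono F ((δ, ∅) : Mon m n) ∈ par F m n 0 := mono_mem_par _ (by simp; rfl)
  rw [ham_apply h0, Fintype.sum_sum_type (α₁ := Y0 m) (α₂ := Fin n)]
  simp [pd_odd_mono, conj_inl]

theorem ham_single (i : Y0 m) (k : ℕ) (h : O F m n) :
    ham F (mono F (Pi.single i (k + 1), ∅)) h = (tau (.inl i : Y m n) : F) •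
      mul F (mono F (Pi.single i k, ∅)) (pd F (.inl i.swap) h) := by
  rw [ham_pure, Finset.sum_eq_single i]
  · rw [Pi.single_add, pd_even_mono_add]
  · intro j _ hj
    rw [pd_even_mono, if_pos (by simp [hj])]
    simp
  · simp

theorem ham_single_add_single {i l : Y0 m} (hil : i ≠ l) (k : ℕ) (h : O F m n) :
    ham F (mono F (Pi.single i (k + 1) + Pi.single l 1, ∅)) h =
      (tau (.inl i : Y m n) : F) •
        mul F (mono F (Pi.single i k + Pi.single l 1, ∅)) (pd F (.inl i.swap) h) +
      (tau (.inl l : Y m n) : F) •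
        mul F (mono F (Pi.single i (k + 1), ∅)) (pd F (.inl l.swap) h) := by
  rw [ham_pure, Finset.sum_eq_add_of_mem i l (Finset.mem_univ _) (Finset.mem_univ _) hil]
  · congr 3
    · rw [Pi.single_add, add_right_comm, pd_even_mono_add]
    · rw [pd_even_mono_add]
  · intro j _ hj
    rw [pd_even_mono, if_pos (by simp [hj.1, hj.2])]
    simp

theorem tau_ne_zero (i : Y m n) : (tau i : F) ≠ 0 := by
  intro h
  have := tau_mul_self (F := F) i
  simp [h] at this

theorem swap_ne_self (i : Y0 m) : i.swap ≠ i := by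
  rcases i with i | i <;> simp

theorem swap_eq_iff {i j : Y0 m} : i.swap = j ↔ i = j.swap := by
  constructor
  · rintro rfl; simp
  · rintro rfl; simp

end Brackets

/-! ### Exponents on which χ can be nonzero -/

section Symplectic

variable {F : Type*} [Field F] {m n : ℕ} {p : ℕ} {t : Y0 m → ℕ}
  {ψ : O F m n →ₗ[F] Module.End F (O F m n)}

namespace IsNormalized

theorem two_ne (H : IsNormalized p t ψ) : (2 : F) ≠ 0 := by
  have := H.charP
  have h3 := H.three_lt_p
  intro h
  have h2 : ((2 : ℕ) : F) = 0 := by exact_mod_cast h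
  rw [CharP.cast_eq_zero_iff F p] at h2
  exact absurd (Nat.le_of_dvd (by norm_num) h2) (by omega)

theorem three_ne (H : IsNormalized p t ψ) : (3 : F) ≠ 0 := by
  have := H.charP
  have h3 := H.three_lt_p
  intro h
  have h2 : ((3 : ℕ) : F) = 0 := by exact_mod_cast h
  rw [CharP.cast_eq_zero_iff F p] at h2
  exact absurd (Nat.le_of_dvd (by norm_num) h2) (by omega)

theorem pure_mem (H : IsNormalized p t ψ) {δ : Y0 m → ℕ} (hδ : ∑ i, δ i ≤ 4) :
    mono F (δ, ∅) ∈ potentials F p m n t := by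
  refine mono_mem_potentials (fun i => ?_) (by simp) ?_
  · exact ((Finset.single_le_sum (fun _ _ => Nat.zero_le _) (Finset.mem_univ i)).trans hδ).trans
      (H.three_le_topExp i).1
  · rintro ⟨-, h⟩
    have h2 := congrArg Finset.card h
    have := H.three_lt_n
    simp at h2
    omega

/-- In F the top exponent is -1, which differs from 0 and 1. Hence there is room to raise an
exponent with one of these residues. -/
theorem lt_of_cast_eq (H : IsNormalized p t ψ) {α : Y0 m → ℕ} (hα : α ≤ topExp p t) {i : Y0 m}
    (h : (α i : F) = 0 ∨ (α i : F) = 1) : α i < topExp p t i := by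
  refine lt_of_le_of_ne (hα i) fun he => ?_
  rw [he, H.cast_topExp] at h
  rcases h with h | h
  · simp at h
  · exact H.two_ne (by linear_combination -h)

/-- The x_l x_{l'} span the diagonal torus of the symplectic algebra, and monomials are weight
vectors. -/
theorem ham_weight (l : Y0 m) (α : Y0 m → ℕ) (u : Finset (Fin n)) :
    ham F (mono F (Pi.single l 1 + Pi.single l.swap 1, ∅)) (mono F (α, u)) =
      ((tau (.inl l : Y m n) : F) * ((α l.swap : F) - α l)) • mono F (α, u) := by
  rw [ham_single_add_single (swap_ne_self l).symm 0]
  simp only [Pi.single_zero, zero_add, Sum.swap_swap, mul_single_pd_self, smul_smul, ← add_smul]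
  congr 1
  rw [tau_swap]
  push_cast
  ring

theorem chi_weight (H : IsNormalized p t ψ) {α : Y0 m → ℕ} {u : Finset (Fin n)}
    (hf : mono F (α, u) ∈ potentials F p m n t) (l : Y0 m) (j : Y m n) :
    ((tau (.inl l : Y m n) : F) * ((α l.swap : F) - α l)) • chi ψ j (mono F (α, u)) =
      act ψ (mono F (Pi.single l 1 + Pi.single l.swap 1, ∅)) (mono F (α, u)) j := by
  have hs : ∑ i, (Pi.single l 1 + Pi.single l.swap 1 : Y0 m → ℕ) i = 2 := by
    simp [Finset.sum_add_distrib]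
  have hg := H.pure_mem (hs.le.trans (by norm_num))
  have h := H.chi_ham hf hg (by rw [ham_weight]; exact Submodule.smul_mem _ _ hf) j
  rw [ham_weight, map_smul, act_of_eq_zero (H.low _ (by simp) (by simp only [Finset.card_empty]; omega))
    (mono F (α, u)),
    sub_zero] at h
  exact h

/-- An odd ∂_k and all of Λ(n) have weight zero for the torus, so a monomial with nonzero χ_k must
have weight zero too. -/
theorem weight_odd (H : IsNormalized p t ψ) {α : Y0 m → ℕ} {u : Finset (Fin n)}
    (hf : mono F (α, u) ∈ potentials F p m n t) {k : Fin n}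
    (hk : chi ψ (.inr k) (mono F (α, u)) ≠ 0) (l : Y0 m) : (α l.swap : F) = α l := by
  have hs : ∑ i, (Pi.single l 1 + Pi.single l.swap 1 : Y0 m → ℕ) i = 2 := by
    simp [Finset.sum_add_distrib]
  have h := H.chi_weight hf l (.inr k)
  rw [H.act_two_odd hf (H.pure_mem (by omega)) (mono_mem_evenDegGE hs.ge), smul_eq_zero,
    mul_eq_zero] at h
  rcases h with (h | h) | h
  · exact absurd h (tau_ne_zero _)
  · exact sub_eq_zero.1 h
  · exact absurd h hk

theorem weight_other (H : IsNormalized p t ψ) {α : Y0 m → ℕ} {u : Finset (Fin n)}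
    (hf : mono F (α, u) ∈ potentials F p m n t) {j : Y0 m}
    (hj : chi ψ (.inl j) (mono F (α, u)) ≠ 0) {l : Y0 m} (h1 : l ≠ j) (h2 : l ≠ j.swap) :
    (α l.swap : F) = α l := by
  have hs : ∑ i, (Pi.single l 1 + Pi.single l.swap 1 : Y0 m → ℕ) i = 2 := by
    simp [Finset.sum_add_distrib]
  have h := H.chi_weight hf l (.inl j)
  rw [H.act_two hf (H.pure_mem (by omega)), if_neg, if_neg h2.symm, smul_eq_zero,
    mul_eq_zero] at h
  · rcases h with (h | h) | h
    · exact absurd h (tau_ne_zero _)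
    · exact sub_eq_zero.1 h
    · exact absurd h hj
  · rw [swap_eq_iff, Sum.swap_swap]
    exact h1.symm

/-- Here ∂_j itself carries a weight for x_j x_{j'}, which shifts the condition by one; for the
other pairs `weight_other` gives weight zero. -/
theorem weight_self (H : IsNormalized p t ψ) {α : Y0 m → ℕ} {u : Finset (Fin n)}
    (hf : mono F (α, u) ∈ potentials F p m n t) {j : Y0 m}
    (hj : chi ψ (.inl j) (mono F (α, u)) ≠ 0) : (α j.swap : F) = α j + 1 := by
  have hs : ∑ i, (Pi.single j 1 + Pi.single j.swap 1 : Y0 m → ℕ) i = 2 := by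
    simp [Finset.sum_add_distrib]
  have h := H.chi_weight hf j (.inl j)
  rw [H.act_two hf (H.pure_mem (by omega)), if_pos rfl, mul_one', ← sub_eq_zero, ← sub_smul,
    smul_eq_zero] at h
  rcases h with h | h
  · have h2 : (tau (.inl j : Y m n) : F) * ((α j.swap : F) - α j - 1) = 0 := by
      linear_combination h
    have := (mul_eq_zero.1 h2).resolve_left (tau_ne_zero _)
    linear_combination this
  · exact absurd h hj

/-- The weights of the ∂_j for x_i x_{i'} are 0, 1 and -1 only. -/
theorem chi_eq_zero_of_diff (H : IsNormalized p t ψ) {α : Y0 m → ℕ} {u : Finset (Fin n)}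
    (hf : mono F (α, u) ∈ potentials F p m n t) {i : Y0 m} (h0 : (α i : F) - α i.swap ≠ 0)
    (h1 : (α i : F) - α i.swap ≠ 1) (h2 : (α i : F) - α i.swap ≠ -1) (j : Y m n) :
    chi ψ j (mono F (α, u)) = 0 := by
  by_contra hne
  rcases j with j | k
  · by_cases hij : i = j
    · subst hij
      have := H.weight_self hf hne
      exact h2 (by linear_combination -this)
    · by_cases hij' : i = j.swap
      · subst hij'
        have := H.weight_self hf hne
        exact h1 (by rw [Sum.swap_swap]; linear_combination this)
      · have := H.weight_other hf hne hij hij'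
        exact h0 (by linear_combination -this)
  · have := H.weight_odd hf hne i
    exact h0 (by linear_combination -this)

/-- The weight at the pair of i is 2 or 3, and p > 3 separates these from 0, 1 and -1, so χ
vanishes. The derivatives are quadratic, where ψ vanishes already. These cubics are the test
elements below. -/
theorem psi_pure_three (H : IsNormalized p t ψ) {δ : Y0 m → ℕ} (hs : ∑ i, δ i = 3) {i : Y0 m}
    (hi : 2 ≤ δ i) (hi' : δ i.swap = 0) : ψ (mono F (δ, ∅)) = 0 := by
  have hf := H.pure_mem (hs.le.trans (by norm_num))
  refine H.psi_eq_zero hf (H.chi_eq_zero_of_diff (i := i) hf ?_ ?_ ?_) fun l => ?_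
  · have hle : δ i ≤ 3 := hs ▸ Finset.single_le_sum (fun _ _ => Nat.zero_le _) (Finset.mem_univ i)
    rw [hi', Nat.cast_zero, sub_zero]
    interval_cases h : δ i
    · exact_mod_cast H.two_ne
    · exact_mod_cast H.three_ne
  · have hle : δ i ≤ 3 := hs ▸ Finset.single_le_sum (fun _ _ => Nat.zero_le _) (Finset.mem_univ i)
    rw [hi', Nat.cast_zero, sub_zero]
    interval_cases h : δ i
    · intro h; push_cast at h; exact one_ne_zero (α := F) (by linear_combination h)
    · intro h; push_cast at h; exact H.two_ne (by linear_combination h)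
  · have hle : δ i ≤ 3 := hs ▸ Finset.single_le_sum (fun _ _ => Nat.zero_le _) (Finset.mem_univ i)
    rw [hi', Nat.cast_zero, sub_zero]
    interval_cases h : δ i
    · intro h; push_cast at h; exact H.three_ne (by linear_combination h)
    · intro h; push_cast at h
      exact mul_ne_zero H.two_ne H.two_ne (by linear_combination h)
  · rw [pd_even_mono]
    split_ifs with h
    · simp
    · have := sum_update_pred h
      exact H.low _ (by simp) (by simp only [Finset.card_empty]; omega)

/-- Up to sign, {x_i^(3), x^(α - 2ε_i + ε_{i'}) x^u} is α_i(α_i - 1)/2 times the monomial, and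
ψ(x_i^(3)) = 0. The bound on α_{i'} is what makes the second factor admissible. -/
theorem chi_eq_zero_of_lt (H : IsNormalized p t ψ) {α : Y0 m → ℕ} {u : Finset (Fin n)}
    (hf : mono F (α, u) ∈ potentials F p m n t) {i : Y0 m} (h0 : (α i : F) ≠ 0)
    (h1 : (α i : F) ≠ 1) (h2 : α i.swap < topExp p t i.swap) (j : Y m n) :
    chi ψ j (mono F (α, u)) = 0 := by
  have hge : 2 ≤ α i := by
    by_contra h
    interval_cases hh : α i
    · simp at h0
    · simp at h1
  obtain ⟨hle, hu, -⟩ := mono_mem_potentials_iff.1 hf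
  obtain ⟨β, rfl⟩ := exists_add_single hge
  have hβ : mono F (β + Pi.single i.swap 1, u) ∈ potentials F p m n t := by
    refine mono_mem_potentials_of_lt (i := i) (fun l => ?_) hu ?_
    · have := hle l
      by_cases hl : l = i.swap
      · subst hl
        simp [swap_ne_self] at h2 this ⊢
        omega
      · simp [hl] at this ⊢
        omega
    · have := hle i
      simp [(swap_ne_self i).symm] at this ⊢
      omega
  have hg := H.pure_mem (δ := Pi.single i 3) (by simp)
  have e : ham F (mono F (Pi.single i 3, ∅)) (mono F (β + Pi.single i.swap 1, u)) =
      ((tau (.inl i : Y m n) : F) * ((β i + 2).choose 2 : ℕ)) •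
        mono F (β + Pi.single i 2, u) := by
    rw [ham_single i 2, pd_even_mono_add, mul_pure_mono, divCoeff_single, smul_smul, add_comm β]
    simp [add_comm]
  have : NeZero (2 : F) := ⟨H.two_ne⟩
  have h := H.chi_ham hβ hg (by rw [e]; exact Submodule.smul_mem _ _ hf) j
  rw [e, H.act_high hβ hg (mono_mem_evenDegGE (by simp)),
    act_of_eq_zero (H.psi_pure_three (i := i) (by simp) (by simp) (by simp [swap_ne_self])),
    sub_zero, map_smul, smul_eq_zero, mul_eq_zero, show β i + 2 = (β + Pi.single i 2 : Y0 m → ℕ) i by simp, Nat.cast_choose_two] at h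
  rcases h with (h | h) | h
  · exact absurd h (tau_ne_zero _)
  · rw [div_eq_zero_iff, mul_eq_zero, sub_eq_zero] at h
    rcases h with (h | h) | h
    · exact absurd h h0
    · exact absurd h h1
    · exact absurd h H.two_ne
  · exact h

/-- There is no room to raise α_{i'}, so the cubic is x_i^(2) x_l and α_{l'} is raised instead. The
bracket produces the monomial with the unit coefficient (-1)(-2)/2, up to sign, and one further
monomial. -/
theorem chi_eq_zero_of_top (H : IsNormalized p t ψ) {α : Y0 m → ℕ} {u : Finset (Fin n)}
    (hf : mono F (α, u) ∈ potentials F p m n t) {i l : Y0 m} (hi : α i = topExp p t i)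
    (hi' : α i.swap = topExp p t i.swap) (hl : α l < topExp p t l)
    (hl' : α l.swap < topExp p t l.swap) (j : Y m n) :
    chi ψ j (mono F (α, u)) = 0 := by
  obtain ⟨hle, hu, -⟩ := mono_mem_potentials_iff.1 hf
  have hil : i ≠ l := by rintro rfl; omega
  have hil' : i ≠ l.swap := by rintro rfl; omega
  have hil2 : i.swap ≠ l := fun h => hil' (swap_eq_iff.1 h)
  have hil3 : i.swap ≠ l.swap := by rw [Ne, swap_eq_iff, Sum.swap_swap]; exact hil
  have h4 := (H.three_le_topExp i).1
  have h4' := (H.three_le_topExp i.swap).1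
  have hsw := swap_ne_self i
  have hswl := swap_ne_self l
  obtain ⟨β, rfl⟩ := exists_add_single (α := α) (i := i) (k := 2) (by omega)
  have hβi : β i + 2 = topExp p t i := by simpa using hi
  have hβi' : β i.swap = topExp p t i.swap := by simpa [hsw] using hi'
  have hβl : β l < topExp p t l := by simpa [hil.symm] using hl
  have hβl' : β l.swap < topExp p t l.swap := by simpa [hil'.symm] using hl'
  have hβle : β ≤ topExp p t := fun x => le_trans (by simp) (hle x)
  have hβ : mono F (β + Pi.single l.swap 1, u) ∈ potentials F p m n t := by
    refine mono_mem_potentials_of_lt (i := i) (fun x => ?_) hu ?_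
    · have := hβle x
      by_cases hx : x = l.swap
      · subst hx; simp; omega
      · simpa [hx] using this
    · simp [hil']; omega
  have hs : ∑ x, (Pi.single i 2 + Pi.single l 1 : Y0 m → ℕ) x = 3 := by
    simp [Finset.sum_add_distrib]
  have hg := H.pure_mem (δ := Pi.single i 2 + Pi.single l 1) (by omega)
  obtain ⟨γ, hγ⟩ := exists_add_single (α := β) (i := i.swap) (k := 1) (by omega)
  set ε : Y0 m → ℕ := Pi.single i 1 + Pi.single l 1 + (γ + Pi.single l.swap 1) with hε
  have hγx : ∀ x, β x = γ x + (Pi.single i.swap 1 : Y0 m → ℕ) x := fun x => congrFun hγ x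
  have hγi : β i = γ i := by simpa [hsw.symm] using hγx i
  have hγi' : β i.swap = γ i.swap + 1 := by simpa using hγx i.swap
  have hεi : ε i = β i + 1 := by simp [hε, hil, hil', hγi, add_comm]
  have hεi' : ε i.swap + 1 = topExp p t i.swap := by
    simp [hε, hsw, hil2, hil3]; omega
  have hεmem : mono F (ε, u) ∈ potentials F p m n t := by
    refine mono_mem_potentials_of_lt (i := i) (fun x => ?_) hu (by omega)
    by_cases h1 : x = i
    · rw [h1]; change ε i ≤ topExp p t i; omega
    by_cases h2 : x = i.swap
    · rw [h2]; change ε i.swap ≤ topExp p t i.swap; omega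
    have h3 : γ x = β x := by rw [hγx x]; simp [h2]
    have := hβle x
    by_cases h5 : x = l
    · rw [h5] at h3 ⊢; simp [hε, hil.symm, hswl.symm]; omega
    by_cases h6 : x = l.swap
    · rw [h6] at h3 ⊢; simp [hε, hil'.symm, hswl]; omega
    simpa [hε, h1, h5, h6, h3] using this
  -- The further monomial has exponent -2 mod p at i and is one below the top at i', so it is
  -- covered by `chi_eq_zero_of_lt`; 3 ≠ 0 is used for -2 ≠ 1.
  have hεchi : chi ψ j (mono F (ε, u)) = 0 := by
    have hc : (ε i : F) = -2 := by
      have := congrArg (Nat.cast : ℕ → F) hβi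
      rw [H.cast_topExp] at this
      push_cast at this
      rw [hεi]
      push_cast
      linear_combination this
    refine H.chi_eq_zero_of_lt hεmem (i := i) ?_ ?_ (by omega) j
    · rw [hc]; exact neg_ne_zero.2 H.two_ne
    · rw [hc]; intro h; exact H.three_ne (by linear_combination -h)
  have e : ham F (mono F (Pi.single i 2 + Pi.single l 1, ∅)) (mono F (β + Pi.single l.swap 1, u)) =
      ((tau (.inl i : Y m n) : F) *
        divCoeff F (Pi.single i 1 + Pi.single l 1) (γ + Pi.single l.swap 1)) • mono F (ε, u) +
      ((tau (.inl l : Y m n) : F) * ((β i + 2).choose 2 : ℕ)) •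
        mono F (β + Pi.single i 2, u) := by
    rw [ham_single_add_single hil 1, pd_even_mono_add l.swap, mul_pure_mono, divCoeff_single,
      smul_smul, hγ, add_right_comm, pd_even_mono_add, mul_pure_mono, smul_smul, ← hγ,
      add_comm (Pi.single i (1 + 1)), add_comm (1 + 1)]
  have : NeZero (2 : F) := ⟨H.two_ne⟩
  have h := H.chi_ham hβ hg (by
    rw [e]
    exact Submodule.add_mem _ (Submodule.smul_mem _ _ hεmem) (Submodule.smul_mem _ _ hf)) j
  rw [e, H.act_high hβ hg (mono_mem_evenDegGE hs.ge),
    act_of_eq_zero (H.psi_pure_three (i := i) hs (by simp) (by simp [hsw, hil2])),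
    sub_zero, map_add, map_smul, map_smul, hεchi, smul_zero, zero_add, smul_eq_zero, mul_eq_zero,
    Nat.cast_choose_two, hβi, H.cast_topExp] at h
  rcases h with (h | h) | h
  · exact absurd h (tau_ne_zero _)
  · rw [div_eq_zero_iff] at h
    rcases h with h | h
    · exact absurd (show (2 : F) = 0 by linear_combination h) H.two_ne
    · exact absurd h H.two_ne
  · exact h

/-- A residue other than 0 and 1 at i forces α_{i'} to be maximal, and then, by the same argument at
i', also α_i. If another pair is not maximal, `chi_eq_zero_of_top` applies. -/
theorem eq_top_or_cast (H : IsNormalized p t ψ) {α : Y0 m → ℕ} {u : Finset (Fin n)}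
    (hf : mono F (α, u) ∈ potentials F p m n t) {j : Y m n}
    (hj : chi ψ j (mono F (α, u)) ≠ 0) :
    α = topExp p t ∨ ∀ i, (α i : F) = 0 ∨ (α i : F) = 1 := by
  obtain ⟨hle, hu, -⟩ := mono_mem_potentials_iff.1 hf
  have key : ∀ i, ¬ ((α i : F) = 0 ∨ (α i : F) = 1) →
      α i.swap = topExp p t i.swap ∧ α i = topExp p t i := by
    intro i hi
    rw [not_or] at hi
    have h1 : ∀ i, ¬ ((α i : F) = 0 ∨ (α i : F) = 1) → α i.swap = topExp p t i.swap := by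
      intro i hi
      rw [not_or] at hi
      by_contra hne
      exact hj (H.chi_eq_zero_of_lt hf hi.1 hi.2 (lt_of_le_of_ne (hle _) hne) j)
    have h2 := h1 i (by tauto)
    refine ⟨h2, ?_⟩
    have h3 := h1 i.swap fun h => (H.lt_of_cast_eq hle h).ne h2
    rwa [Sum.swap_swap] at h3
  by_cases hall : ∀ i, (α i : F) = 0 ∨ (α i : F) = 1
  · exact Or.inr hall
  push Not at hall
  obtain ⟨i, hi⟩ := hall
  obtain ⟨hi1, hi2⟩ := key i (by tauto)
  left
  funext l
  by_contra hne
  have hl := lt_of_le_of_ne (hle l) hne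
  have hl' : α l.swap < topExp p t l.swap := by
    refine lt_of_le_of_ne (hle _) fun he => ?_
    have h5 : ¬ ((α l.swap : F) = 0 ∨ (α l.swap : F) = 1) := fun h =>
      (H.lt_of_cast_eq hle h).ne he
    have := (key l.swap h5).1
    rw [Sum.swap_swap] at this
    exact hne this
  exact hj (H.chi_eq_zero_of_top hf hi2 hi1 hl hl' j)

/-- The quadratic x_i^(2) carries x^(α - ε_i + ε_{i'}) x^u to the given monomial. The former has
exponent 2 mod p at i', so all its χ vanish, and equivariance transports this. -/
theorem chi_eq_zero_of_one_one (H : IsNormalized p t ψ) {α : Y0 m → ℕ} {u : Finset (Fin n)}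
    (hf : mono F (α, u) ∈ potentials F p m n t) {i : Y0 m} (h1 : (α i : F) = 1)
    (h2 : (α i.swap : F) = 1) (j : Y m n) : chi ψ j (mono F (α, u)) = 0 := by
  obtain ⟨hle, hu, -⟩ := mono_mem_potentials_iff.1 hf
  have hsw := swap_ne_self i
  have hpos : 1 ≤ α i := by
    rw [Nat.one_le_iff_ne_zero]
    intro h
    rw [h] at h1
    simp at h1
  have hlt := H.lt_of_cast_eq hle (Or.inr h2)
  obtain ⟨β, rfl⟩ := exists_add_single hpos
  have hβ : mono F (β + Pi.single i.swap 1, u) ∈ potentials F p m n t := by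
    refine mono_mem_potentials_of_lt (i := i) (fun l => ?_) hu ?_
    · have := hle l
      by_cases hl : l = i.swap
      · subst hl
        simp [hsw] at hlt ⊢
        omega
      · simp [hl] at this ⊢
        omega
    · have := hle i
      simp [hsw.symm] at this ⊢
      omega
  have hβi : (β i : F) = 0 := by simpa using h1
  have hβi' : (β i.swap : F) = 1 := by simpa [hsw] using h2
  have hz : ∀ j, chi ψ j (mono F (β + Pi.single i.swap 1, u)) = 0 := by
    refine H.chi_eq_zero_of_lt hβ (i := i.swap) ?_ ?_ ?_
    · simp [hβi']
      intro h; exact H.two_ne (by linear_combination h)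
    · simp [hβi']
    · rw [Sum.swap_swap]
      refine H.lt_of_cast_eq (mono_mem_potentials_iff.1 hβ).1 (Or.inl ?_)
      simp [hsw.symm, hβi]
  have hs : ∑ x, (Pi.single i 1 + Pi.single i 1 : Y0 m → ℕ) x = 2 := by
    simp [Finset.sum_add_distrib]
  have hg := H.pure_mem (δ := Pi.single i 1 + Pi.single i 1) (by omega)
  have e : ham F (mono F (Pi.single i 1 + Pi.single i 1, ∅)) (mono F (β + Pi.single i.swap 1, u)) =
      (tau (.inl i : Y m n) : F) • mono F (β + Pi.single i 1, u) := by
    rw [← Pi.single_add, ham_single i 1, pd_even_mono_add, mul_pure_mono, divCoeff_single,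
      add_comm β]
    simp [hβi]
  have h := H.chi_ham hβ hg (by rw [e]; exact Submodule.smul_mem _ _ hf) j
  rw [e, act_of_eq_zero (H.low (Pi.single i 1 + Pi.single i 1, ∅) (by simp)
    (by simp only [Finset.card_empty]; omega)) (mono F (β + Pi.single i.swap 1, u)), sub_zero,
    map_smul] at h
  have h0 : act ψ (mono F (Pi.single i 1 + Pi.single i 1, ∅)) (mono F (β + Pi.single i.swap 1, u)) j
      = 0 := by
    rcases j with j | k
    · rw [H.act_two hβ hg]
      simp [hz]
    · exact H.act_two_odd hβ hg (mono_mem_evenDegGE hs.ge) k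
  rw [h0, smul_eq_zero] at h
  exact h.resolve_left (tau_ne_zero _)

theorem live_odd (H : IsNormalized p t ψ) {α : Y0 m → ℕ} {u : Finset (Fin n)}
    (hf : mono F (α, u) ∈ potentials F p m n t) {k : Fin n}
    (hk : chi ψ (.inr k) (mono F (α, u)) ≠ 0) : (∀ i, (α i : F) = 0) ∨ α = topExp p t := by
  rcases H.eq_top_or_cast hf hk with h | h
  · exact Or.inr h
  · refine Or.inl fun i => (h i).resolve_right fun h1 => hk ?_
    exact H.chi_eq_zero_of_one_one hf h1 ((H.weight_odd hf hk i).trans h1) _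

theorem live_even (H : IsNormalized p t ψ) {α : Y0 m → ℕ} {u : Finset (Fin n)}
    (hf : mono F (α, u) ∈ potentials F p m n t) {j : Y0 m}
    (hj : chi ψ (.inl j) (mono F (α, u)) ≠ 0) :
    (α j.swap : F) = 1 ∧ ∀ i, i ≠ j.swap → (α i : F) = 0 := by
  have hw := H.weight_self hf hj
  rcases H.eq_top_or_cast hf hj with h | h
  · subst h
    rw [H.cast_topExp, H.cast_topExp] at hw
    exact absurd (by linear_combination -hw : (1 : F) = 0) one_ne_zero
  have h0 : (α j : F) = 0 := by
    refine (h j).resolve_right fun h1 => ?_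
    rw [h1] at hw
    rcases h j.swap with h2 | h2
    · exact H.two_ne (by linear_combination h2 - hw)
    · exact one_ne_zero (α := F) (by linear_combination h2 - hw)
  refine ⟨by rw [hw, h0, zero_add], fun i hi => ?_⟩
  by_cases hij : i = j
  · rw [hij, h0]
  refine (h i).resolve_right fun h1 => hj ?_
  exact H.chi_eq_zero_of_one_one hf h1 ((H.weight_other hf hj hij hi).trans h1) _

end IsNormalized

end Symplectic

end HamSuper

namespace HamSuper

/-! ### Infinitesimal rotations of the odd variables -/

section Rotations

variable {F : Type*} [Field F] {m n : ℕ}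

/-- The rotation `x_s ∂_r - x_r ∂_s`. -/
noncomputable def rot (F : Type*) [Field F] {m n : ℕ} (r s : Fin n) : Module.End F (O F m n) :=
  field F (.inr r) (mono F (0, {s})) - field F (.inr s) (mono F (0, {r}))

theorem rot_apply (r s : Fin n) (h : O F m n) : rot F r s h =
    mul F (mono F (0, {s})) (pd F (.inr r) h) - mul F (mono F (0, {r})) (pd F (.inr s) h) := by
  rw [rot, LinearMap.sub_apply, field_apply, field_apply]

theorem divCoeff_zero_left (α : Y0 m → ℕ) : divCoeff F 0 α = 1 := by
  simp [divCoeff]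

theorem divCoeff_zero_right (α : Y0 m → ℕ) : divCoeff F α 0 = 1 := by
  simp [divCoeff]

theorem rot_mono {r s : Fin n} {w : Finset (Fin n)} (hr : r ∈ w) (hs : s ∉ w) (α : Y0 m → ℕ) :
    rot F r s (mono F (α, w)) = ((-1 : F) ^ inversions {r} (w.erase r) *
      (-1) ^ inversions {s} (w.erase r)) • mono F (α, insert s (w.erase r)) := by
  rw [rot_apply, pd_odd_mono, if_pos hr, pd_odd_mono, if_neg hs, map_smul, mul_mono_mono,
    if_pos (by simp [hs]), divCoeff_zero_left, smul_smul, mul_one, zero_add,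
    Finset.singleton_union]
  simp

theorem rot_mono_of_notMem {r s : Fin n} {w : Finset (Fin n)} (hr : r ∉ w) (hs : s ∉ w)
    (α : Y0 m → ℕ) : rot F r s (mono F (α, w)) = 0 := by
  rw [rot_apply, pd_odd_mono, if_neg hr, pd_odd_mono, if_neg hs]
  simp

theorem rot_mono_of_mem {r s : Fin n} (hrs : r ≠ s) {w : Finset (Fin n)} (hr : r ∈ w) (hs : s ∈ w)
    (α : Y0 m → ℕ) : rot F r s (mono F (α, w)) = 0 := by
  rw [rot_apply, pd_odd_mono, if_pos hr, pd_odd_mono, if_pos hs, map_smul, map_smul,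
    mul_mono_mono, mul_mono_mono, if_neg (by simp [hs, hrs.symm]), if_neg (by simp [hr, hrs])]
  simp

theorem rot_swap (r s : Fin n) (h : O F m n) : rot F s r h = - rot F r s h := by
  rw [rot_apply, rot_apply, neg_sub]

theorem mono_apply (a b : Mon m n) : mono F a b = if a = b then 1 else 0 := by
  rw [mono, Finsupp.single_apply]

/-- Only x^w contributes to the monomial in which r is replaced by s. Hence a rotation-invariant
element has no monomial that contains r but not s (`coeff_eq_zero_of_rot`). -/
theorem rot_coeff {r s : Fin n} (hrs : r ≠ s) {w : Finset (Fin n)} (hr : r ∈ w) (hs : s ∉ w)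
    (α : Y0 m → ℕ) (h : O F m n) :
    rot F r s h (α, insert s (w.erase r)) = ((-1) ^ inversions {r} (w.erase r) *
      (-1) ^ inversions {s} (w.erase r)) * h (α, w) := by
  induction h using O_induction with
  | zero => simp
  | add f f' hf hf' => simp only [map_add, Finsupp.add_apply, hf, hf']; ring
  | smul c f hf => simp only [map_smul, Finsupp.smul_apply, hf, smul_eq_mul]; ring
  | mono a =>
  obtain ⟨β, v⟩ := a
  by_cases hrv : r ∈ v <;> by_cases hsv : s ∈ v
  · rw [rot_mono_of_mem hrs hrv hsv, mono_apply, if_neg]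
    · simp
    · rintro h; rw [Prod.mk.injEq] at h; exact hs (h.2 ▸ hsv)
  · rw [rot_mono hrv hsv, Finsupp.smul_apply, mono_apply, mono_apply, smul_eq_mul]
    by_cases hvw : v = w
    · subst hvw
      simp
    · rw [if_neg, if_neg]
      · simp
      · simp [hvw]
      · rw [Prod.mk.injEq]
        rintro ⟨-, h⟩
        apply hvw
        have h2 := congrArg (fun x => insert r (x.erase s)) h
        rwa [Finset.erase_insert (by simp [hsv]), Finset.erase_insert (by simp [hs]),
          Finset.insert_erase hrv, Finset.insert_erase hr] at h2
  · rw [← neg_neg (rot F r s _), ← rot_swap, rot_mono hsv hrv, Finsupp.neg_apply,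
      Finsupp.smul_apply, mono_apply, mono_apply, if_neg, if_neg]
    · simp
    · rw [Prod.mk.injEq]
      rintro ⟨-, h⟩
      exact hs (h ▸ hsv)
    · rw [Prod.mk.injEq]
      rintro ⟨-, h⟩
      have : r ∈ insert s (w.erase r) := h ▸ Finset.mem_insert_self _ _
      simp [hrs] at this
  · rw [rot_mono_of_notMem hrv hsv, mono_apply, if_neg]
    · simp
    · rw [Prod.mk.injEq]
      rintro ⟨-, h⟩
      exact hrv (h ▸ hr)

theorem neg_one_pow_ne_zero (a : ℕ) : (-1 : F) ^ a ≠ 0 := by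
  simp

theorem coeff_eq_zero_of_rot {r s : Fin n} (hrs : r ≠ s) {h : O F m n} (h0 : rot F r s h = 0)
    {w : Finset (Fin n)} (hr : r ∈ w) (hs : s ∉ w) (α : Y0 m → ℕ) : h (α, w) = 0 := by
  have := rot_coeff hrs hr hs α h
  rw [h0] at this
  simpa using this

theorem one_mul' (f : O F m n) : mul F (mono F (0, ∅)) f = f := by
  induction f using O_induction with
  | zero => simp
  | add f g hf hg => rw [map_add, hf, hg]
  | smul c f hf => rw [map_smul, hf]
  | mono a => rw [mul_mono_mono]; simp [inversions, divCoeff]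

theorem pd_pair_left {r s : Fin n} (hrs : r ≠ s) (α : Y0 m → ℕ) :
    pd F (.inr r) (mono F (α, {r, s})) = ((-1 : F) ^ inversions {r} {s}) • mono F (α, {s}) := by
  rw [pd_odd_mono, if_pos (by simp), Finset.erase_insert (by simpa using hrs)]

theorem neg_one_pow_inversions_pair {r s : Fin n} (hrs : r ≠ s) :
    (-1 : F) ^ inversions {s} {r} = - (-1) ^ inversions {r} {s} := by
  have h := inversions_add_swap (u := ({r} : Finset (Fin n))) (v := {s}) (by simpa using hrs)
  rw [Finset.card_singleton, Finset.card_singleton, one_mul] at h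
  have h1 := neg_one_pow_mul_self (F := F) (inversions {r} {s})
  have h2 : (-1 : F) ^ inversions {r} {s} * (-1) ^ inversions {s} {r} = -1 := by
    rw [← pow_add, h, pow_one]
  linear_combination (- (-1) ^ inversions {s} {r}) * h1 + (-1) ^ inversions {r} {s} * h2

theorem pd_pair_right {r s : Fin n} (hrs : r ≠ s) (α : Y0 m → ℕ) :
    pd F (.inr s) (mono F (α, {r, s})) = - (((-1 : F) ^ inversions {r} {s}) • mono F (α, {r})) := by
  rw [Finset.pair_comm, pd_pair_left hrs.symm, neg_one_pow_inversions_pair hrs, neg_smul]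

theorem sum_pair (r s : Fin n) (hrs : r ≠ s) (h : O F m n) :
    ∑ k, mul F (pd F (.inr k) (mono F (0, {r, s}))) (pd F (.inr k) h) =
      ((-1 : F) ^ inversions {r} {s}) • rot F r s h := by
  rw [Finset.sum_eq_add_of_mem r s (Finset.mem_univ _) (Finset.mem_univ _) hrs, pd_pair_left hrs,
    pd_pair_right hrs, rot_apply]
  · simp [sub_eq_add_neg]
  · intro k _ hk
    rw [pd_odd_mono, if_neg (by simp [hk.1, hk.2])]
    simp

theorem ham_odd (v : Finset (Fin n)) (hv : Even v.card) (h : O F m n) :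
    ham F (mono F (0, v)) h = ∑ k, mul F (pd F (.inr k) (mono F (0, v))) (pd F (.inr k) h) := by
  have h0 : mono F ((0, v) : Mon m n) ∈ par F m n 0 := mono_mem_par _ (Nat.even_iff.1 hv)
  rw [ham_apply h0, Fintype.sum_sum_type (α₁ := Y0 m) (α₂ := Fin n)]
  simp [pd_even_mono_zero, conj_inr, tau]

theorem ham_pair (r s : Fin n) (hrs : r ≠ s) (h : O F m n) :
    ham F (mono F (0, {r, s})) h = ((-1 : F) ^ inversions {r} {s}) • rot F r s h := by
  rw [ham_odd _ (by rw [Finset.card_pair hrs]; exact even_two), sum_pair r s hrs]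

end Rotations

/-! ### Rotation invariance of χ on pure even monomials -/

section Exterior

variable {F : Type*} [Field F] {m n : ℕ} {p : ℕ} {t : Y0 m → ℕ}
  {ψ : O F m n →ₗ[F] Module.End F (O F m n)}

theorem chi_apply_of_ne {ψ : O F m n →ₗ[F] Module.End F (O F m n)} (j : Y m n) (f : O F m n)
    {α : Y0 m → ℕ} (hα : α ≠ 0) (u : Finset (Fin n)) : chi ψ j f (α, u) = 0 :=
  ev0_apply_of_ne _ hα u

theorem apply_eq_zero_of_par {e : ℕ} {f : O F m n} (hf : f ∈ par F m n e) {a : Mon m n}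
    (ha : ¬ a.2.card ≡ e [MOD 2]) : f a = 0 := by
  by_contra hne
  exact ha ((Finsupp.mem_supported F f).1 hf (Finsupp.mem_support_iff.2 hne))

namespace IsNormalized

theorem zero_mem (H : IsNormalized p t ψ) {u : Finset (Fin n)} (hu : Even u.card) :
    mono F (0, u) ∈ potentials F p m n t := by
  have hm := H.one_lt_m
  refine mono_mem_potentials_of_lt (i := .inl ⟨0, by omega⟩) (fun i => Nat.zero_le _) hu ?_
  have := (H.three_le_topExp (.inl ⟨0, by omega⟩)).1
  simp only [Pi.zero_apply]
  omega

theorem single_mem (H : IsNormalized p t ψ) (i : Y0 m) {u : Finset (Fin n)} (hu : Even u.card) :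
    mono F (Pi.single i 1, u) ∈ potentials F p m n t := by
  have h4 := (H.three_le_topExp i).1
  refine mono_mem_potentials_of_lt (i := i) (fun j => ?_) hu ?_
  · by_cases hj : j = i
    · subst hj; simp; omega
    · simp [hj]
  · simp; omega

theorem pair_low (H : IsNormalized p t ψ) {r s : Fin n} (hrs : r ≠ s) :
    ψ (mono F (0, {r, s})) = 0 :=
  H.low _ (by simp only [Finset.card_pair hrs]; exact even_two) (by simp [Finset.card_pair hrs])

/-- ψ vanishes on x_r x_s, and the rotation it generates fixes the even ∂_j, so χ_j is equivariant.
-/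
theorem chi_rot_even (H : IsNormalized p t ψ) {f : O F m n} (hf : f ∈ potentials F p m n t)
    {r s : Fin n} (hrs : r ≠ s) (hr : rot F r s f ∈ potentials F p m n t) (j : Y0 m) :
    chi ψ (.inl j) (rot F r s f) = rot F r s (chi ψ (.inl j) f) := by
  have hg := H.zero_mem (u := {r, s}) (by rw [Finset.card_pair hrs]; exact even_two)
  have h := H.chi_ham hf hg (by rw [ham_pair r s hrs]; exact Submodule.smul_mem _ _ hr) (.inl j)
  rw [act_of_eq_zero (H.pair_low hrs), sub_zero, H.act_zero hf hg, sum_pair r s hrs,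
    ham_pair r s hrs, map_smul] at h
  exact smul_right_injective _ (neg_one_pow_ne_zero _) h

theorem chi_rot_odd (H : IsNormalized p t ψ) {f : O F m n} (hf : f ∈ potentials F p m n t)
    {r s : Fin n} (hrs : r ≠ s) (hr : rot F r s f = 0) {l : Fin n} (h1 : l ≠ r) (h2 : l ≠ s) :
    rot F r s (chi ψ (.inr l) f) = 0 := by
  have hg := H.zero_mem (u := {r, s}) (by rw [Finset.card_pair hrs]; exact even_two)
  have h := H.chi_ham hf hg (by rw [ham_pair r s hrs, hr, smul_zero]; exact Submodule.zero_mem _)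
    (.inr l)
  rw [act_of_eq_zero (H.pair_low hrs), sub_zero, H.act_zero_odd hf hg, sum_pair r s hrs,
    ham_pair r s hrs, hr, smul_zero, map_zero, Finset.sum_eq_zero, sub_zero, eq_comm,
    smul_eq_zero] at h
  · exact h.resolve_left (neg_one_pow_ne_zero _)
  · intro k _
    rw [pd_odd_mono l, if_neg (by simp [h1, h2])]
    simp

/-- The rotation moves ∂_r to ∂_s. So for a rotation-invariant f the value χ_r determines all the
others. -/
theorem chi_rot_odd_left (H : IsNormalized p t ψ) {f : O F m n} (hf : f ∈ potentials F p m n t)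
    {r s : Fin n} (hrs : r ≠ s) (hr : rot F r s f = 0) :
    chi ψ (.inr s) f = rot F r s (chi ψ (.inr r) f) := by
  have hg := H.zero_mem (u := {r, s}) (by rw [Finset.card_pair hrs]; exact even_two)
  have h := H.chi_ham hf hg (by rw [ham_pair r s hrs, hr, smul_zero]; exact Submodule.zero_mem _)
    (.inr r)
  rw [act_of_eq_zero (H.pair_low hrs), sub_zero, H.act_zero_odd hf hg, sum_pair r s hrs,
    ham_pair r s hrs, hr, smul_zero, map_zero, pd_pair_left hrs, Finset.sum_eq_single s,
    map_smul, map_smul, pd_odd_mono, if_pos (by simp), eq_comm, sub_eq_zero] at h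
  · have := smul_right_injective _ (neg_one_pow_ne_zero _) h
    rw [this]
    simp [inversions, mul_one']
  · intro k _ hk
    rw [map_smul, pd_odd_mono, if_neg (by simp [hk])]
    simp
  · simp

theorem rot_pure (r s : Fin n) (α : Y0 m → ℕ) : rot F r s (mono F (α, ∅)) = 0 :=
  rot_mono_of_notMem (by simp) (by simp) α

theorem exists_fin_ne (H : IsNormalized p t ψ) (r s : Fin n) : ∃ k : Fin n, k ≠ r ∧ k ≠ s := by
  have := H.three_lt_n
  have hc : ({r, s} : Finset (Fin n)).card < (Finset.univ : Finset (Fin n)).card := by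
    refine (Finset.card_insert_le _ _).trans_lt ?_
    simp
    omega
  obtain ⟨k, -, hk⟩ := Finset.exists_mem_notMem_of_card_lt_card hc
  simp only [Finset.mem_insert, Finset.mem_singleton, not_or] at hk
  exact ⟨k, hk⟩

/-- On pure even monomials the even components of `χ` are rotation invariant. -/
theorem chi_pure_even (H : IsNormalized p t ψ) {α : Y0 m → ℕ}
    (hf : mono F (α, ∅) ∈ potentials F p m n t) (j : Y0 m) :
    ∃ c d : F, chi ψ (.inl j) (mono F (α, ∅)) = c • mono F (0, ∅) + d • xomega F ∧
      (Odd n → d = 0) := by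
  set b := chi ψ (.inl j) (mono F (α, ∅)) with hb
  have hrot : ∀ r s : Fin n, r ≠ s → rot F r s b = 0 := by
    intro r s hrs
    have := H.chi_rot_even hf hrs (by rw [rot_pure]; exact Submodule.zero_mem _) j
    rw [rot_pure, map_zero] at this
    exact this.symm
  refine ⟨b (0, ∅), b (0, Finset.univ), ?_, ?_⟩
  · refine Finsupp.ext fun a => ?_
    obtain ⟨β, w⟩ := a
    rw [Finsupp.add_apply, Finsupp.smul_apply, Finsupp.smul_apply, xomega, mono_apply, mono_apply]
    have hn := H.three_lt_n
    have hne : (∅ : Finset (Fin n)) ≠ Finset.univ := by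
      intro h
      have := congrArg Finset.card h
      simp at this
      omega
    by_cases hβ : β = 0
    · subst hβ
      by_cases hw : w = ∅
      · subst hw
        simp [hne.symm]
      by_cases hw' : w = Finset.univ
      · subst hw'
        simp [hne]
      -- A set that is neither empty nor full admits an exchange r ∈ w, s ∉ w, so invariance kills
      -- its coefficient.
      obtain ⟨r, hr⟩ := Finset.nonempty_iff_ne_empty.2 hw
      obtain ⟨s, hs⟩ : ∃ s, s ∉ w := by
        by_contra hcon; push Not at hcon
        exact hw' (Finset.eq_univ_iff_forall.2 hcon)
      have hrs : r ≠ s := by rintro rfl; exact hs hr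
      rw [coeff_eq_zero_of_rot hrs (hrot r s hrs) hr hs]
      simp [Ne.symm hw, Ne.symm hw']
    · rw [hb, chi_apply_of_ne _ _ hβ]
      simp [Ne.symm hβ]
  · intro hn
    refine apply_eq_zero_of_par (H.chi_mem_par _ (.inl j)) ?_
    simp only [Finset.card_univ, Fintype.card_fin, mu, Nat.ModEq]
    rw [Nat.odd_iff] at hn
    omega

theorem pd_xomega (l : Fin n) : pd F (.inr l) (xomega F : O F m n) =
    ((-1 : F) ^ inversions {l} (Finset.univ.erase l)) • mono F (0, Finset.univ.erase l) := by
  rw [xomega, pd_odd_mono, if_pos (Finset.mem_univ _)]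

theorem rot_pd_xomega {r s : Fin n} (hrs : r ≠ s) :
    rot F r s (pd F (.inr r) (xomega F : O F m n)) = pd F (.inr s) (xomega F) := by
  rw [rot_apply, pd_odd_sq, map_zero, zero_sub, pd_comm_odd hrs.symm, map_neg, neg_neg,
    pd_xomega s, map_smul, map_smul, pd_odd_mono, if_pos (by simp [hrs]), map_smul, mul_mono_mono,
    if_pos (by simp), divCoeff_zero_left, mul_one, zero_add, Finset.singleton_union,
    Finset.insert_erase (by simp [hrs]), smul_smul, smul_smul]
  congr 1
  rw [mul_assoc, neg_one_pow_mul_self, mul_one]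

/-- Apply the recursion to the bracket of x_{i'} x^v with x^(α), which is a multiple of x^(α - ε_i)
x^v. There χ_i vanishes, since by `live_even` it would need α_i ≡ 1; what remains of the recursion
is the relation among the χ_k. It excludes the invariant solution χ_k = x_k in `chi_pure_odd`. -/
theorem act_pure_odd_var (H : IsNormalized p t ψ) {α : Y0 m → ℕ}
    (hf : mono F (α, ∅) ∈ potentials F p m n t) (hd : 3 ≤ ∑ i, α i) {i : Y0 m}
    (hi : (α i : F) ≠ 1) {v : Finset (Fin n)} (hv : Even v.card) :
    ∑ k, mul F (chi ψ (.inr k) (mono F (α, ∅))) (pd F (.inr k) (mono F (0, v))) = 0 := by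
  have hg := H.single_mem i.swap hv
  have e : ham F (mono F (Pi.single i.swap 1, v)) (mono F (α, ∅)) =
      (tau (.inl i.swap : Y m n) : F) •
        mul F (mono F (0, v)) (pd F (.inl i) (mono F (α, ∅))) := by
    rw [ham_apply (potentials_le_par p t hg), Finset.sum_eq_single (.inl i.swap)]
    · rw [pd_even_mono_single, if_pos rfl, conj_inl, Sum.swap_swap]
    · rintro (l | k) _ hl
      · rw [pd_even_mono_single, if_neg (fun h => hl (by rw [h]))]
        simp
      · rw [conj_inr, pd_odd_mono k α, if_neg (by simp)]
        simp
    · simp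
  have key : ∀ u : Finset (Fin n), Even u.card →
      mul F (mono F (0, u)) (pd F (.inl i) (mono F (α, ∅))) ∈ potentials F p m n t ∧
      chi ψ (.inl i) (mul F (mono F (0, u)) (pd F (.inl i) (mono F (α, ∅)))) = 0 := by
    intro u hu
    rw [pd_even_mono]
    split_ifs with h
    · simp
    have e2 : mul F (mono F (0, u)) (mono F (Function.update α i (α i - 1), ∅)) =
        mono F (Function.update α i (α i - 1), u) := by
      rw [mul_mono_mono]
      simp [inversions, divCoeff_zero_left]
    have hle := (mono_mem_potentials_iff.1 hf).1
    have hmem : mono F (Function.update α i (α i - 1), u) ∈ potentials F p m n t := by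
      refine mono_mem_potentials_of_lt (i := i) (fun l => ?_) hu ?_
      · by_cases hl : l = i
        · subst hl; simpa using (Nat.sub_le _ _).trans (hle l)
        · simpa [hl] using hle l
      · have : α i ≤ topExp p t i := hle i
        simp
        omega
    rw [e2]
    refine ⟨hmem, ?_⟩
    by_contra hne
    have h3 := (H.live_even hmem hne).2 i (swap_ne_self i).symm
    rw [Function.update_self, Nat.cast_pred (Nat.pos_of_ne_zero h)] at h3
    exact hi (by linear_combination h3)
  have h := H.chi_ham hf hg (by rw [e]; exact Submodule.smul_mem _ _ (key v hv).1) (.inl i)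
  have h4 := (key ∅ (by simp)).2
  rw [one_mul'] at h4
  rw [e, map_smul, (key v hv).2, H.act_high hg hf (mono_mem_evenDegGE hd), H.act_one hf hg,
    if_pos rfl, Sum.swap_swap, h4, map_zero] at h
  simp only [smul_zero, sub_zero, zero_sub] at h
  rw [eq_comm, neg_eq_zero, smul_eq_zero] at h
  exact h.resolve_left (tau_ne_zero _)

/-- On pure even monomials of high degree the odd components of `χ` are those of a multiple of
`D_H(x^ω)`. -/
theorem chi_pure_odd (H : IsNormalized p t ψ) {α : Y0 m → ℕ}
    (hf : mono F (α, ∅) ∈ potentials F p m n t) (hd : 3 ≤ ∑ i, α i) {i : Y0 m}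
    (hi : (α i : F) ≠ 1) :
    ∃ b : F, (∀ l, chi ψ (.inr l) (mono F (α, ∅)) = b • pd F (.inr l) (xomega F)) ∧
      (Odd n → b = 0) := by
  have hn := H.three_lt_n
  let r : Fin n := ⟨0, by omega⟩
  obtain ⟨s, hsr, -⟩ := H.exists_fin_ne r r
  set E := chi ψ (.inr r) (mono F (α, ∅)) with hE
  set ε : F := (-1 : F) ^ inversions {r} (Finset.univ.erase r) with hε
  have hεε : ε * ε = 1 := neg_one_pow_mul_self _
  have hr1 : ({r} : Finset (Fin n)) ≠ Finset.univ.erase r := by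
    intro h
    have : r ∈ Finset.univ.erase r := h ▸ Finset.mem_singleton_self r
    simp at this
  have hr2 : ({r} : Finset (Fin n)) ≠ Finset.univ := by
    intro h
    have := congrArg Finset.card h
    simp at this
    omega
  have hr3 : Finset.univ.erase r ≠ Finset.univ := by
    intro h
    have h2 := Finset.mem_univ r
    rw [← h] at h2
    simp at h2
  -- Rotations not involving r leave only 1, x_r, ∂_r(x^ω) and x^ω; parity removes 1.
  have hexp : E = E (0, {r}) • mono F (0, {r}) +
      (E (0, Finset.univ.erase r) * ε) • pd F (.inr r) (xomega F) +
      E (0, Finset.univ) • xomega F := by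
    refine Finsupp.ext fun a => ?_
    obtain ⟨β, w⟩ := a
    rw [pd_xomega, smul_smul, mul_assoc, hεε, mul_one]
    simp only [Finsupp.add_apply, Finsupp.smul_apply, xomega, mono_apply, smul_eq_mul]
    by_cases hβ : β = 0
    swap
    · rw [hE, chi_apply_of_ne _ _ hβ]
      simp [Ne.symm hβ]
    subst hβ
    by_cases h1 : w = {r}
    · subst h1
      simp [hr1.symm, hr2.symm]
    by_cases h2 : w = Finset.univ.erase r
    · subst h2
      simp [hr1, hr3.symm]
    by_cases h3 : w = Finset.univ
    · subst h3
      simp [hr2, hr3]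
    have h0 : E (0, w) = 0 := by
      by_cases hwr : w.erase r = ∅
      · have hw : w = ∅ := by
          rw [Finset.erase_eq_empty_iff] at hwr
          tauto
        refine apply_eq_zero_of_par (H.chi_mem_par _ (.inr r)) ?_
        subst hw
        simp [mu, Nat.ModEq]
      obtain ⟨x, hx⟩ := Finset.nonempty_iff_ne_empty.2 hwr
      rw [Finset.mem_erase] at hx
      obtain ⟨y, hyr, hyw⟩ : ∃ y, y ≠ r ∧ y ∉ w := by
        by_contra hcon
        push Not at hcon
        by_cases hrw : r ∈ w
        · refine h3 (Finset.eq_univ_iff_forall.2 fun y => ?_)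
          by_cases hy : y = r
          · rwa [hy]
          · exact hcon y hy
        · refine h2 (Finset.ext fun y => ?_)
          simp only [Finset.mem_erase, Finset.mem_univ, and_true]
          exact ⟨fun hy => by rintro rfl; exact hrw hy, hcon y⟩
      have hxy : x ≠ y := by rintro rfl; exact hyw hx.2
      exact coeff_eq_zero_of_rot hxy (H.chi_rot_odd hf hxy (rot_pure _ _ _) hx.1.symm hyr.symm)
        hx.2 hyw 0
    simp [h0, Ne.symm h1, Ne.symm h2, Ne.symm h3]
  set c := E (0, {r})
  set b := E (0, Finset.univ.erase r) * ε with hb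
  have hx0 : ∀ s, r ≠ s → rot F r s (xomega F : O F m n) = 0 := fun s hs =>
    rot_mono_of_mem hs (Finset.mem_univ _) (Finset.mem_univ _) 0
  have hEs : ∀ s, r ≠ s → chi ψ (.inr s) (mono F (α, ∅)) =
      c • mono F (0, {s}) + b • pd F (.inr s) (xomega F) := by
    intro s hs
    rw [H.chi_rot_odd_left hf hs (rot_pure _ _ _), ← hE, hexp, map_add, map_add, map_smul,
      map_smul, map_smul, hx0 s hs, rot_pd_xomega hs, rot_mono (Finset.mem_singleton_self r)
      (by simpa using hs.symm)]
    simp [inversions]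
  -- Rotating from r to s and back returns χ_r, but the first rotation has already killed x^ω.
  have hEr : E = c • mono F (0, {r}) + b • pd F (.inr r) (xomega F) := by
    have h1 := H.chi_rot_odd_left hf hsr (rot_pure _ _ _)
    rw [← hE, hEs s hsr.symm, map_add, map_smul, map_smul, rot_pd_xomega hsr,
      rot_mono (Finset.mem_singleton_self s) (by simpa using hsr.symm)] at h1
    rw [h1]
    simp [inversions]
  -- For v = {r, s} the relation reads ±2c x_r x_s = 0; the terms from ∂_r(x^ω) and ∂_s(x^ω) repeat
  -- a variable.
  have hc : c = 0 := by
    have h1 := H.act_pure_odd_var hf hd hi (v := {r, s})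
      (by rw [Finset.card_pair hsr.symm]; exact even_two)
    rw [Finset.sum_eq_add_of_mem r s (Finset.mem_univ _) (Finset.mem_univ _) hsr.symm,
      pd_pair_left hsr.symm, pd_pair_right hsr.symm, hEs s hsr.symm, ← hE, hEr] at h1
    · simp only [map_add, map_smul, map_neg, LinearMap.add_apply, LinearMap.smul_apply,
        pd_xomega, mul_mono_mono] at h1
      have d1 : Disjoint ({r} : Finset (Fin n)) {s} := by simpa using hsr.symm
      have d2 : ¬ Disjoint (Finset.univ.erase r) ({s} : Finset (Fin n)) := by simp [hsr]
      have d3 : ¬ Disjoint (Finset.univ.erase s) ({r} : Finset (Fin n)) := by simp [hsr.symm]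
      simp only [if_pos d1, if_pos d1.symm, if_neg d2, if_neg d3, smul_zero, add_zero,
        divCoeff_zero_left, mul_one, Finset.union_comm {s} {r}, smul_smul,
        neg_one_pow_inversions_pair hsr.symm, ← neg_smul, ← add_smul] at h1
      rw [smul_eq_zero] at h1
      rcases h1 with h1 | h1
      · have h2 := neg_one_pow_mul_self (F := F) (inversions {r} {s})
        have h3 : (2 : F) * c = 0 := by linear_combination h1 - 2 * c * h2
        exact (mul_eq_zero.1 h3).resolve_left H.two_ne
      · exact absurd h1 (by simp [mono])
    · intro k _ hk
      rw [pd_odd_mono, if_neg (by simp [hk.1, hk.2])]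
      simp
  refine ⟨b, fun l => ?_, fun hodd => ?_⟩
  · by_cases hl : r = l
    · subst hl
      rw [← hE, hEr, hc, zero_smul, zero_add]
    · rw [hEs l hl, hc, zero_smul, zero_add]
  · rw [hb, apply_eq_zero_of_par (H.chi_mem_par _ (.inr r)), zero_mul]
    simp only [Finset.card_erase_of_mem (Finset.mem_univ r), Finset.card_univ, Fintype.card_fin,
      mu, Nat.ModEq]
    rw [Nat.odd_iff] at hodd
    omega

end IsNormalized

end Exterior

end HamSuper

namespace HamSuper

/-! ### Exponents divisible by p, and the top exponent -/

section Divisible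

variable {F : Type*} [Field F] {m n : ℕ} {p : ℕ} {t : Y0 m → ℕ}
  {ψ : O F m n →ₗ[F] Module.End F (O F m n)}

namespace IsNormalized

/-- p^t - γ_i is a positive multiple of p, hence at least 5. So a small amount can be added to such
exponents without leaving the truncated algebra. -/
theorem add_four_le_topExp (H : IsNormalized p t ψ) {γ : Y0 m → ℕ} (hle : γ ≤ topExp p t)
    {i : Y0 m} (h0 : (γ i : F) = 0) : γ i + 4 ≤ topExp p t i := by
  have := H.charP
  rw [CharP.cast_eq_zero_iff F p] at h0
  have h1 := (H.three_le_topExp i).2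
  have h2 : γ i ≤ topExp p t i := hle i
  have h3 : p ∣ p ^ t i - γ i := Nat.dvd_sub (dvd_pow_self p (H.t_pos i).ne') h0
  have h4 := Nat.le_of_dvd (by omega) h3
  have h5 := H.three_lt_p
  have h6 : p ≠ 4 := by
    rintro rfl
    exact absurd H.prime (by norm_num)
  omega

theorem mem_of_le (H : IsNormalized p t ψ) {γ : Y0 m → ℕ} (hle : γ ≤ topExp p t)
    (h0 : ∀ i, (γ i : F) = 0) {α : Y0 m → ℕ} (hα : ∀ i, α i ≤ γ i + 3) {u : Finset (Fin n)}
    (hu : Even u.card) : mono F (α, u) ∈ potentials F p m n t := by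
  have hm := H.one_lt_m
  refine mono_mem_potentials_of_lt (i := .inl ⟨0, by omega⟩) (fun i => ?_) hu ?_
  · have h1 := H.add_four_le_topExp hle (h0 i)
    have h2 := hα i
    change α i ≤ topExp p t i
    omega
  · have h1 := H.add_four_le_topExp hle (h0 (.inl ⟨0, by omega⟩))
    have h2 := hα (.inl ⟨0, by omega⟩)
    omega

theorem add_single_le {γ : Y0 m → ℕ} (i l : Y0 m) : (γ + Pi.single i 1 : Y0 m → ℕ) l ≤ γ l + 1 := by
  by_cases hl : l = i
  · subst hl; simp
  · simp [hl]

/-- The hypothesis m > 1 provides a second symplectic pair, free to serve as an auxiliary variable.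
-/
theorem exists_other_pair (H : IsNormalized p t ψ) (j : Y0 m) : ∃ i, i ≠ j ∧ i ≠ j.swap := by
  have hm := H.one_lt_m
  have hc : ({j, j.swap} : Finset (Y0 m)).card < (Finset.univ : Finset (Y0 m)).card := by
    refine (Finset.card_insert_le _ _).trans_lt ?_
    simp
    omega
  obtain ⟨k, -, hk⟩ := Finset.exists_mem_notMem_of_card_lt_card hc
  simp only [Finset.mem_insert, Finset.mem_singleton, not_or] at hk
  exact ⟨k, hk⟩

/-- The coefficients of `χ` on `x^(γ) x_j x^u`, `γ` divisible by `p`, do not depend on `j`. -/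
theorem chi_swap_eq (H : IsNormalized p t ψ) {γ : Y0 m → ℕ} (hle : γ ≤ topExp p t)
    (h0 : ∀ i, (γ i : F) = 0) {u : Finset (Fin n)} (hu : Even u.card) (i j : Y0 m) :
    (tau (.inl j : Y m n) : F) • chi ψ (.inl j.swap) (mono F (γ + Pi.single j 1, u)) =
      (tau (.inl i : Y m n) : F) • chi ψ (.inl i.swap) (mono F (γ + Pi.single i 1, u)) := by
  have hmem : ∀ l, mono F (γ + Pi.single l 1, u) ∈ potentials F p m n t := fun l =>
    H.mem_of_le hle h0 (fun x => (add_single_le l x).trans (by omega)) hu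
  by_cases hij : i = j
  · rw [hij]
  have hf := hmem j
  -- The symplectic transformation taking x_j to x_i is generated by x_i^(2) if i = j', and by x_i
  -- x_{j'} otherwise.
  by_cases hij' : i = j.swap
  · have e : ham F (mono F (Pi.single i 1 + Pi.single i 1, ∅)) (mono F (γ + Pi.single j 1, u)) =
        (tau (.inl i : Y m n) : F) • mono F (γ + Pi.single i 1, u) := by
      rw [← Pi.single_add, ham_single i 1, hij', Sum.swap_swap, pd_even_mono_add, mul_pure_mono,
        divCoeff_single, add_comm γ]
      simp [h0]
    have hs : ∑ x, (Pi.single i 1 + Pi.single i 1 : Y0 m → ℕ) x = 2 := by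
      simp [Finset.sum_add_distrib]
    have hg := H.pure_mem (δ := Pi.single i 1 + Pi.single i 1) (by omega)
    have h := H.chi_ham hf hg (by rw [e]; exact Submodule.smul_mem _ _ (hmem i)) (.inl i.swap)
    rw [e, act_of_eq_zero (H.low (Pi.single i 1 + Pi.single i 1, ∅) (by simp)
      (by simp only [Finset.card_empty]; omega)) (mono F (γ + Pi.single j 1, u)), sub_zero,
      map_smul, H.act_two hf hg, if_pos (by simp), mul_one'] at h
    rw [h, hij', Sum.swap_swap]
  · have hji' : j ≠ i.swap := fun h => hij' (by rw [h, Sum.swap_swap])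
    have hs : ∑ x, (Pi.single i 1 + Pi.single j.swap 1 : Y0 m → ℕ) x = 2 := by
      simp [Finset.sum_add_distrib]
    have hg := H.pure_mem (δ := Pi.single i 1 + Pi.single j.swap 1) (by omega)
    -- The quadratic x_i x_{j'} also produces a monomial containing x_{j'} ∂_{i'}(x^(γ)) x_j; its
    -- exponent at j is 1 mod p, which `live_even` forbids for the coefficient in question.
    have key : mul F (mono F (Pi.single j.swap 1, ∅))
          (pd F (.inl i.swap) (mono F (γ + Pi.single j 1, u))) ∈ potentials F p m n t ∧
        chi ψ (.inl i.swap) (mul F (mono F (Pi.single j.swap 1, ∅))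
          (pd F (.inl i.swap) (mono F (γ + Pi.single j 1, u)))) = 0 := by
      by_cases hz : γ i.swap = 0
      · rw [pd_even_mono, if_pos (by simp [hz, hji'.symm])]
        simp
      obtain ⟨β, hβ⟩ := exists_add_single (α := γ) (i := i.swap) (k := 1)
        (Nat.one_le_iff_ne_zero.2 hz)
      have hβle : ∀ x, β x ≤ γ x := fun x => by rw [hβ]; simp
      rw [hβ, add_right_comm, pd_even_mono_add, mul_pure_mono]
      have hm' : mono F (Pi.single j.swap 1 + (β + Pi.single j 1), u) ∈ potentials F p m n t := by
        refine H.mem_of_le hle h0 (fun x => ?_) hu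
        have h1 := add_single_le (γ := β) j x
        have h2 := add_single_le (γ := β + Pi.single j 1) j.swap x
        rw [add_comm] at h2
        have := hβle x
        omega
      refine ⟨Submodule.smul_mem _ _ hm', ?_⟩
      rw [map_smul]
      by_contra hne
      have h3 := (H.live_even hm' (right_ne_zero_of_smul hne)).2 j
        (by rw [Sum.swap_swap]; exact Ne.symm hij)
      have hβj : (β j : F) = 0 := by
        have := h0 j
        rw [hβ] at this
        simpa [hji'] using this
      simp [(swap_ne_self j).symm, hβj] at h3
    have e : ham F (mono F (Pi.single i 1 + Pi.single j.swap 1, ∅)) (mono F (γ + Pi.single j 1, u)) =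
        (tau (.inl i : Y m n) : F) • mul F (mono F (Pi.single j.swap 1, ∅))
          (pd F (.inl i.swap) (mono F (γ + Pi.single j 1, u))) +
        (tau (.inl j.swap : Y m n) : F) • mono F (γ + Pi.single i 1, u) := by
      have := ham_single_add_single (F := F) hij' 0 (mono F (γ + Pi.single j 1, u))
      rw [Nat.zero_add] at this
      rw [this, Sum.swap_swap, pd_even_mono_add, mul_pure_mono, divCoeff_single,
        add_comm γ (Pi.single i 1)]
      simp [h0]
    have h := H.chi_ham hf hg (by
      rw [e]
      exact Submodule.add_mem _ (Submodule.smul_mem _ _ key.1)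
        (Submodule.smul_mem _ _ (hmem i))) (.inl i.swap)
    rw [e, act_of_eq_zero (H.low (Pi.single i 1 + Pi.single j.swap 1, ∅) (by simp)
      (by simp only [Finset.card_empty]; omega)) (mono F (γ + Pi.single j 1, u)), sub_zero,
      map_add, map_smul, map_smul, key.2, smul_zero, zero_add, H.act_two hf hg,
      if_neg (by simpa using hij'), if_pos (by simp), mul_one', tau_swap, tau_swap] at h
    push_cast at h
    rw [neg_smul, neg_smul, neg_inj] at h
    have hj := tau_mul_self (F := F) (.inl j : Y m n)
    have hi := tau_mul_self (F := F) (.inl i : Y m n)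
    have h5 := congrArg (fun x => ((tau (.inl i : Y m n) : F) * (tau (.inl j : Y m n) : F)) • x) h
    simp only [smul_smul] at h5
    rw [mul_assoc, hj, mul_one, mul_right_comm, hi, one_mul] at h5
    exact h5.symm

/-- `χ` vanishes on `x^(π) x^u` if `u` is neither empty nor full. -/
theorem chi_top_eq_zero (H : IsNormalized p t ψ) {u : Finset (Fin n)} (hu : Even u.card)
    (h1 : u ≠ ∅) (h2 : u ≠ Finset.univ) (j : Y m n) :
    chi ψ j (mono F (topExp p t, u)) = 0 := by
  have hm := H.one_lt_m
  obtain ⟨l, hl⟩ := Finset.nonempty_iff_ne_empty.2 h1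
  obtain ⟨k, hk⟩ : ∃ k, k ∉ u := by
    by_contra hcon; push Not at hcon
    exact h2 (Finset.eq_univ_iff_forall.2 hcon)
  have hkl : k ≠ l := by rintro rfl; exact hk hl
  -- With l ∈ u and k ∉ u, x^(π) x^u is up to sign the bracket of x^(δ) x_k x_l and x^(β) x^w, where
  -- δ is the r-part of π, β = π - δ, and w is u with l replaced by k. Only ∂_k contributes, because
  -- x_k occurs in both factors. Both have even degree at least 3, so both terms of the recursion
  -- vanish.
  let r : Y0 m := .inl ⟨0, by omega⟩
  set δ : Y0 m → ℕ := Pi.single r (topExp p t r) with hδ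
  set β : Y0 m → ℕ := Function.update (topExp p t) r 0 with hβ
  have hδβ : δ + β = topExp p t := by
    ext x
    by_cases hx : x = r
    · subst hx; simp [hδ, hβ]
    · simp [hδ, hβ, hx]
  have hc : divCoeff F δ β = 1 := by
    rw [hδ, divCoeff_single]; simp [hβ]
  set w : Finset (Fin n) := insert k (u.erase l) with hw
  have hwk : k ∈ w := Finset.mem_insert_self _ _
  have hwl : l ∉ w := by simp [hw, hkl.symm]
  have hwc : Even w.card := by
    rw [hw, Finset.card_insert_of_notMem (by simp [hk]), Finset.card_erase_add_one hl]
    exact hu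
  have h4 := (H.three_le_topExp r).1
  have h4' := (H.three_le_topExp r.swap).1
  have hg : mono F (δ, {k, l}) ∈ potentials F p m n t := by
    refine mono_mem_potentials_of_lt (i := r.swap) (fun x => ?_)
      (by rw [Finset.card_pair hkl]; exact even_two) ?_
    · by_cases hx : x = r
      · subst hx; simp [hδ]
      · simp [hδ, hx]
    · rw [hδ, Pi.single_eq_of_ne (swap_ne_self r)]; omega
  have hf : mono F (β, w) ∈ potentials F p m n t := by
    refine mono_mem_potentials_of_lt (i := r) (fun x => ?_) hwc ?_
    · by_cases hx : x = r
      · subst hx; simp [hβ]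
      · simp [hβ, hx]
    · rw [hβ, Function.update_self]; omega
  have ht : mono F (topExp p t, u) ∈ potentials F p m n t :=
    mono_mem_potentials le_rfl hu fun h => h2 h.2
  have e : ham F (mono F (δ, {k, l})) (mono F (β, w)) =
      ((-1 : F) ^ inversions {k} {l} * (-1) ^ inversions {k} (u.erase l) *
        (-1) ^ inversions {l} (u.erase l)) • mono F (topExp p t, u) := by
    rw [ham_apply (potentials_le_par p t hg), Finset.sum_eq_single (.inr k)]
    · rw [conj_inr, pd_pair_left hkl, pd_odd_mono, if_pos hwk, map_smul, map_smul,
        LinearMap.smul_apply, hw, Finset.erase_insert (by simp [hk]), mul_mono_mono,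
        if_pos (by simp), hc, hδβ, Finset.singleton_union, Finset.insert_erase hl]
      simp only [smul_smul]
      congr 1
      simp [tau]
      ring
    · rintro (i | k') _ hne
      · rw [conj_inl, pd_even_mono, pd_even_mono]
        have hnd : ¬ Disjoint ({k, l} : Finset (Fin n)) w := fun h =>
          Finset.disjoint_left.1 h (Finset.mem_insert_self k {l}) hwk
        split_ifs <;> simp only [map_zero, smul_zero, LinearMap.zero_apply, mul_mono_mono, if_neg hnd]
      · by_cases hk' : k' = l
        · subst hk'
          rw [conj_inr, pd_odd_mono _ β, if_neg hwl]
          simp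
        · have : k' ≠ k := fun h => hne (by rw [h])
          rw [pd_odd_mono k' δ, if_neg (by simp [this, hk'])]
          simp
    · simp
  have hgd : mono F (δ, {k, l}) ∈ evenDegGE F m n 3 := by
    refine mono_mem_evenDegGE ?_
    simp [hδ]
    omega
  have hfd : mono F (β, w) ∈ evenDegGE F m n 3 := by
    refine mono_mem_evenDegGE ?_
    have := Finset.single_le_sum (f := β) (fun _ _ => Nat.zero_le _) (Finset.mem_univ r.swap)
    have h6 : β r.swap = topExp p t r.swap := Function.update_of_ne (swap_ne_self r) _ _
    simp only
    omega
  have h := H.chi_ham hf hg (by rw [e]; exact Submodule.smul_mem _ _ ht) j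
  rw [e, H.act_high hf hg hgd, H.act_high hg hf hfd, sub_zero, map_smul, smul_eq_zero] at h
  refine h.resolve_left ?_
  exact mul_ne_zero (mul_ne_zero (neg_one_pow_ne_zero _) (neg_one_pow_ne_zero _))
    (neg_one_pow_ne_zero _)

/-- An auxiliary pair i, i' turns the product x_r^(a+1) x^(β) into a bracket, that of x_r^(a+1) x_i
and x^(β) x_i^(c) x_{i'}. Both factors have even degree at least p, so χ of the bracket is zero. The
binomial coefficient is the structure constant of the product and must be a unit; c = 0 and c = 1
serve the odd and the even ∂_j. -/
theorem chi_split (H : IsNormalized p t ψ) {β : Y0 m → ℕ} {r : Y0 m} {a : ℕ}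
    (hle : Pi.single r (a + 1) + β ≤ topExp p t)
    (h0 : ∀ i, ((Pi.single r (a + 1) + β : Y0 m → ℕ) i : F) = 0)
    (hβ0 : ∀ i, (β i : F) = 0) (ha : ((a + 1 : ℕ) : F) = 0) (hβ : β ≠ 0)
    (hc : (((a + 1) + β r).choose (a + 1) : F) ≠ 0) {i : Y0 m} (hir : i ≠ r) (hir' : i ≠ r.swap)
    {c : ℕ} (hc1 : c ≤ 1) (j : Y m n) :
    chi ψ j (mono F (Pi.single r (a + 1) + β + Pi.single i c, ∅)) = 0 := by
  have := H.charP
  have hp := H.three_lt_p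
  have hsw := swap_ne_self i
  have hri : r ≠ i.swap := fun h => hir' (by rw [h, Sum.swap_swap])
  have hsr : i.swap ≠ r.swap := by rw [Ne, swap_eq_iff, Sum.swap_swap]; exact hir
  set γ : Y0 m → ℕ := Pi.single r (a + 1) + β with hγ
  have hsc : ∀ x, (Pi.single i c : Y0 m → ℕ) x ≤ 1 := fun x => by
    by_cases hx : x = i
    · subst hx; simpa using hc1
    · simp [hx]
  have hsum1 : ∀ x y, (Pi.single x 1 : Y0 m → ℕ) y ≤ 1 := fun x y => by
    by_cases hx : y = x
    · subst hx; simp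
    · simp [hx]
  have hγx : ∀ x, γ x = (Pi.single r (a + 1) : Y0 m → ℕ) x + β x := fun x => rfl
  have hg : mono F (Pi.single r (a + 1) + Pi.single i 1, ∅) ∈ potentials F p m n t := by
    refine H.mem_of_le hle h0 (fun x => ?_) (by simp)
    have := hsum1 i x
    simp only [Pi.add_apply]
    rw [hγx]
    omega
  have hf : mono F (β + Pi.single i c + Pi.single i.swap 1, ∅) ∈ potentials F p m n t := by
    refine H.mem_of_le hle h0 (fun x => ?_) (by simp)
    have h1 := hsum1 i.swap x
    have h2 := hsc x
    simp only [Pi.add_apply]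
    rw [hγx]
    omega
  have hmain : mono F (γ + Pi.single i c, ∅) ∈ potentials F p m n t := by
    refine H.mem_of_le hle h0 (fun x => ?_) (by simp)
    have h2 := hsc x
    simp only [Pi.add_apply]
    omega
  have hage : p ≤ a + 1 :=
    Nat.le_of_dvd (by omega) ((CharP.cast_eq_zero_iff F p _).1 ha)
  have hgd : mono F (Pi.single r (a + 1) + Pi.single i 1, ∅) ∈ evenDegGE F m n 3 := by
    refine mono_mem_evenDegGE ?_
    simp [Finset.sum_add_distrib]
    omega
  have hfd : mono F (β + Pi.single i c + Pi.single i.swap 1, ∅) ∈ evenDegGE F m n 3 := by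
    refine mono_mem_evenDegGE ?_
    obtain ⟨x, hx⟩ : ∃ x, β x ≠ 0 := by
      by_contra hcon; push Not at hcon; exact hβ (funext hcon)
    have h1 : p ≤ β x :=
      Nat.le_of_dvd (by omega) ((CharP.cast_eq_zero_iff F p _).1 (hβ0 x))
    have h2 := Finset.single_le_sum (f := β) (fun _ _ => Nat.zero_le _) (Finset.mem_univ x)
    simp only [Pi.add_apply, Finset.sum_add_distrib]
    omega
  -- The derivatives at r and r' give an unwanted monomial with exponents 1 + c at i and 1 at i' mod
  -- p, on which χ is known to vanish.
  have key : mul F (mono F (Pi.single r a + Pi.single i 1, ∅))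
        (pd F (.inl r.swap) (mono F (β + Pi.single i c + Pi.single i.swap 1, ∅))) ∈
          potentials F p m n t ∧
      chi ψ j (mul F (mono F (Pi.single r a + Pi.single i 1, ∅))
        (pd F (.inl r.swap) (mono F (β + Pi.single i c + Pi.single i.swap 1, ∅)))) = 0 := by
    by_cases hz : β r.swap = 0
    · rw [pd_even_mono, if_pos (by simp [hz, hir'.symm, hsr.symm])]
      simp
    obtain ⟨β', hβ'⟩ := exists_add_single (α := β) (i := r.swap) (k := 1)
      (Nat.one_le_iff_ne_zero.2 hz)
    have hβle : ∀ x, β' x ≤ β x := fun x => by rw [hβ']; simp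
    have hβi : β' i = β i := by rw [hβ']; simp [hir']
    have hβi' : β' i.swap = β i.swap := by rw [hβ']; simp [hsr]
    rw [hβ', show β' + Pi.single r.swap 1 + Pi.single i c + Pi.single i.swap 1 =
      β' + Pi.single i c + Pi.single i.swap 1 + Pi.single r.swap 1 by abel, pd_even_mono_add,
      mul_pure_mono]
    set ε : Y0 m → ℕ :=
      Pi.single r a + Pi.single i 1 + (β' + Pi.single i c + Pi.single i.swap 1) with hε
    have hεmem : mono F (ε, ∅) ∈ potentials F p m n t := by
      refine H.mem_of_le hle h0 (fun x => ?_) (by simp)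
      have h1 := hsum1 i.swap x
      have h2 := hsc x
      have h3 := hsum1 i x
      have h4 := hβle x
      have h5 : (Pi.single r a : Y0 m → ℕ) x ≤ (Pi.single r (a + 1) : Y0 m → ℕ) x := by
        by_cases hx : x = r
        · subst hx; simp
        · simp [hx]
      simp only [hε, Pi.add_apply]
      rw [hγx]
      omega
    refine ⟨Submodule.smul_mem _ _ hεmem, ?_⟩
    have hεi : (ε i : F) = 1 + c := by
      simp [hε, hir, hsw.symm, hβi, hβ0]
    have hεi' : (ε i.swap : F) = 1 := by
      simp [hε, hri.symm, hsw, hβi', hβ0]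
    rw [map_smul, smul_eq_zero]
    right
    interval_cases c
    · exact H.chi_eq_zero_of_one_one hεmem (i := i) (by simpa using hεi) hεi' j
    · refine H.chi_eq_zero_of_lt hεmem (i := i) ?_ ?_
        (H.lt_of_cast_eq (mono_mem_potentials_iff.1 hεmem).1 (Or.inr hεi')) j
      · rw [hεi]; push_cast; intro h; exact H.two_ne (by linear_combination h)
      · rw [hεi]; push_cast; intro h; exact one_ne_zero (α := F) (by linear_combination h)
  have e : ham F (mono F ((Pi.single r (a + 1) + Pi.single i 1, ∅) : Mon m n))
      (mono F (β + Pi.single i c + Pi.single i.swap 1, ∅)) =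
      (tau (.inl r : Y m n) : F) • mul F (mono F (Pi.single r a + Pi.single i 1, ∅))
        (pd F (.inl r.swap) (mono F (β + Pi.single i c + Pi.single i.swap 1, ∅))) +
      ((tau (.inl i : Y m n) : F) * (((a + 1) + β r).choose (a + 1) : ℕ)) •
        mono F (γ + Pi.single i c, ∅) := by
    rw [ham_single_add_single hir.symm a, pd_even_mono_add i.swap, mul_pure_mono, divCoeff_single,
      smul_smul, ← add_assoc, ← hγ]
    simp [hir.symm]
  have h := H.chi_ham hf hg (by
    rw [e]
    exact Submodule.add_mem _ (Submodule.smul_mem _ _ key.1)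
      (Submodule.smul_mem _ _ hmain)) j
  rw [e, H.act_high hf hg hgd, H.act_high hg hf hfd, sub_zero, map_add, map_smul, key.2, smul_zero,
    zero_add, map_smul, smul_eq_zero] at h
  exact h.resolve_left (mul_ne_zero (tau_ne_zero _) hc)

end IsNormalized

end Divisible

end HamSuper

namespace HamSuper

/-! ### Splitting exponents by Lucas' theorem -/

section Arithmetic

/-- By Lucas' theorem a common factor p can be cancelled from both entries mod p, down to the
binomial coefficient (d choose 1) = d. -/
theorem not_dvd_choose_pow_mul {p : ℕ} (hp : p.Prime) {d : ℕ} (hd : ¬ p ∣ d) (s : ℕ) :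
    ¬ p ∣ (p ^ s * d).choose (p ^ s) := by
  have := Fact.mk hp
  induction s with
  | zero => simpa using hd
  | succ s ih =>
    have h := Choose.choose_modEq_choose_mod_mul_choose_div_nat (n := p ^ (s + 1) * d)
      (k := p ^ (s + 1)) (p := p)
    have e1 : p ^ (s + 1) * d = p * (p ^ s * d) := by ring
    have e2 : p ^ (s + 1) = p * p ^ s := by ring
    rw [e1, e2, Nat.mul_mod_right, Nat.mul_mod_right, Nat.mul_div_cancel_left _ hp.pos,
      Nat.mul_div_cancel_left _ hp.pos, Nat.choose_self, one_mul] at h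
    rw [e1, e2]
    rwa [h.dvd_iff dvd_rfl]

/-- A nonzero exponent divisible by `p` is a power of `p` in one variable, or a divided power with
this exponent is a product of two divided powers with exponents divisible by `p`. -/
theorem exists_split {p m : ℕ} (hp : p.Prime) {γ : Y0 m → ℕ} (hγ : γ ≠ 0) (hd : ∀ i, p ∣ γ i)
    (hs : ∀ r s, 1 ≤ s → γ ≠ Pi.single r (p ^ s)) :
    ∃ (r : Y0 m) (a : ℕ) (β : Y0 m → ℕ), γ = Pi.single r (a + 1) + β ∧ β ≠ 0 ∧ (∀ i, p ∣ β i) ∧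
      p ∣ a + 1 ∧ ¬ p ∣ ((a + 1) + β r).choose (a + 1) := by
  obtain ⟨r, hr⟩ : ∃ r, γ r ≠ 0 := by
    by_contra hcon; push Not at hcon; exact hγ (funext hcon)
  -- If γ involves only the variable r, then γ_r = p^s d with d prime to p and d ≥ 2, and p^s is
  -- split off. Otherwise the whole r-part is split off, with binomial coefficient 1.
  by_cases hu : Function.update γ r 0 = 0
  · have hγr : γ = Pi.single r (γ r) := by
      ext x
      by_cases hx : x = r
      · subst hx; simp
      · have := congrFun hu x
        simpa [hx] using this
    obtain ⟨s, d, hpd, he⟩ := Nat.exists_eq_pow_mul_and_not_dvd hr p hp.ne_one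
    have hs1 : 1 ≤ s := by
      by_contra hcon
      obtain rfl : s = 0 := by omega
      rw [pow_zero, one_mul] at he
      exact hpd (he ▸ hd r)
    have hd2 : 2 ≤ d := by
      rcases d with _ | _ | d
      · simp at hpd
      · exact absurd (by rw [hγr, he]; simp) (hs r s hs1)
      · omega
    have hps := hp.pos
    have hpos : 0 < p ^ s := pow_pos hps s
    refine ⟨r, p ^ s - 1, Pi.single r (p ^ s * (d - 1)), ?_, ?_, ?_, ?_, ?_⟩
    · rw [← Pi.single_add, hγr, he]
      congr 1
      obtain ⟨d, rfl⟩ : ∃ e, d = e + 1 := ⟨d - 1, by omega⟩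
      rw [Nat.add_sub_cancel, Nat.sub_add_cancel hpos]
      ring
    · intro h
      have := congrFun h r
      simp only [Pi.single_eq_same, Pi.zero_apply, Nat.mul_eq_zero] at this
      omega
    · intro i
      by_cases hi : i = r
      · subst hi
        rw [Pi.single_eq_same]
        exact (dvd_pow_self p (by omega)).mul_right _
      · simp [hi]
    · rw [Nat.sub_add_cancel hpos]
      exact dvd_pow_self p (by omega)
    · rw [Nat.sub_add_cancel hpos, Pi.single_eq_same]
      have : p ^ s + p ^ s * (d - 1) = p ^ s * d := by
        obtain ⟨d, rfl⟩ : ∃ e, d = e + 1 := ⟨d - 1, by omega⟩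
        rw [Nat.add_sub_cancel]; ring
      rw [this]
      exact not_dvd_choose_pow_mul hp hpd s
  · refine ⟨r, γ r - 1, Function.update γ r 0, ?_, hu, ?_, ?_, ?_⟩
    · rw [Nat.sub_add_cancel (Nat.one_le_iff_ne_zero.2 hr)]
      ext x
      by_cases hx : x = r
      · subst hx; simp
      · simp [hx]
    · intro i
      by_cases hi : i = r
      · subst hi; simp
      · simpa [hi] using hd i
    · rw [Nat.sub_add_cancel (Nat.one_le_iff_ne_zero.2 hr)]
      exact hd r
    · simpa using hp.ne_one

end Arithmetic

/-! ### The parameters attached to a nonzero exponent divisible by p -/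

section Parameters

variable {F : Type*} [Field F] {m n : ℕ} {p : ℕ} {t : Y0 m → ℕ}
  {ψ : O F m n →ₗ[F] Module.End F (O F m n)}

theorem pd_odd_pure (k : Fin n) (α : Y0 m → ℕ) : pd F (.inr k) (mono F (α, ∅)) = 0 := by
  rw [pd_odd_mono, if_neg (by simp)]

/-- A nonempty u of even size keeps a variable after ∂_l, and x^ω kills every odd variable. -/
theorem mul_xomega_pd (l : Fin n) {u : Finset (Fin n)} (hu : Even u.card) :
    mul F (xomega F : O F m n) (pd F (.inr l) (mono F (0, u))) = 0 := by
  rw [pd_odd_mono]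
  split_ifs with hl
  · rw [map_smul, xomega, mul_mono_mono, if_neg, smul_zero]
    intro hdis
    have h : u.erase l = ∅ := Finset.eq_empty_of_forall_notMem fun x hx =>
      Finset.disjoint_left.1 hdis (Finset.mem_univ x) hx
    have := Finset.card_erase_add_one hl
    rw [h, Finset.card_empty] at this
    rw [← this] at hu
    exact absurd hu (by decide)
  · simp

theorem mul_odd_pure (α : Y0 m → ℕ) (u : Finset (Fin n)) :
    mul F (mono F (0, u)) (mono F (α, ∅)) = mono F (α, u) := by
  rw [mul_mono_mono, if_pos (by simp), divCoeff_zero_left]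
  simp [inversions]

theorem ham_single_mixed (i : Y0 m) {u : Finset (Fin n)} (hu : Even u.card) (f : O F m n) :
    ham F (mono F (Pi.single i 1, u)) f =
      (tau (.inl i : Y m n) : F) • mul F (mono F (0, u)) (pd F (.inl i.swap) f) +
        ∑ k : Fin n, mul F (pd F (.inr k) (mono F (Pi.single i 1, u))) (pd F (.inr k) f) := by
  rw [ham_apply (mono_mem_par _ (by simpa [Nat.ModEq] using Nat.even_iff.1 hu)),
    Fintype.sum_sum_type (α₁ := Y0 m) (α₂ := Fin n)]
  congr 1
  · rw [Finset.sum_eq_single i]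
    · rw [pd_even_mono_single, if_pos rfl, conj_inl]
    · intro j _ hj
      rw [pd_even_mono_single, if_neg hj]; simp
    · simp
  · simp [conj, tau]

theorem ham_single_mixed_pure (i : Y0 m) {u : Finset (Fin n)} (hu : Even u.card)
    (α : Y0 m → ℕ) :
    ham F (mono F (Pi.single i 1, u)) (mono F (α + Pi.single i.swap 1, ∅)) =
      (tau (.inl i : Y m n) : F) • mono F (α, u) := by
  rw [ham_single_mixed i hu, pd_even_mono_add, mul_odd_pure]
  simp [pd_odd_pure]

namespace IsNormalized

theorem p_le_sum (H : IsNormalized p t ψ) {γ : Y0 m → ℕ} (h0 : ∀ i, (γ i : F) = 0) (hγ : γ ≠ 0) :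
    p ≤ ∑ i, γ i := by
  have := H.charP
  obtain ⟨x, hx⟩ : ∃ x, γ x ≠ 0 := by
    by_contra hcon; push Not at hcon; exact hγ (funext hcon)
  have h1 : p ≤ γ x :=
    Nat.le_of_dvd (by omega) ((CharP.cast_eq_zero_iff F p _).1 (h0 x))
  exact h1.trans (Finset.single_le_sum (f := γ) (fun _ _ => Nat.zero_le _) (Finset.mem_univ x))

/-- `χ` vanishes on `x^(γ)` and `x^(γ) x_i` if `γ` is divisible by `p` and not a power of `p` in
one variable. -/
theorem chi_eq_zero_of_not_pow (H : IsNormalized p t ψ) {γ : Y0 m → ℕ} (hle : γ ≤ topExp p t)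
    (h0 : ∀ i, (γ i : F) = 0) (hγ : γ ≠ 0) (hs : ∀ r s, 1 ≤ s → γ ≠ Pi.single r (p ^ s)) :
    (∀ j, chi ψ j (mono F (γ, ∅)) = 0) ∧
      ∀ i, chi ψ (.inl i.swap) (mono F (γ + Pi.single i 1, ∅)) = 0 := by
  have := H.charP
  obtain ⟨r, a, β, rfl, hβ, hβd, ha, hc⟩ :=
    exists_split H.prime hγ (fun i => (CharP.cast_eq_zero_iff F p _).1 (h0 i)) hs
  obtain ⟨i, hi, hi'⟩ := H.exists_other_pair r
  have key := fun {c : ℕ} (hc1 : c ≤ 1) (j : Y m n) => H.chi_split hle h0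
    (fun i => (CharP.cast_eq_zero_iff F p _).2 (hβd i)) ((CharP.cast_eq_zero_iff F p _).2 ha) hβ
    (fun h => hc ((CharP.cast_eq_zero_iff F p _).1 h)) hi hi' hc1 j
  refine ⟨fun j => by simpa using key (Nat.zero_le 1) j, fun j => ?_⟩
  have h := H.chi_swap_eq (u := ∅) hle h0 (by simp) i j
  rw [key le_rfl, smul_zero, smul_eq_zero] at h
  exact h.resolve_left (tau_ne_zero _)

/-- The values of `χ` on `x^(γ) x^u` and `x^(γ) x_j x^u` for `γ ≠ 0` divisible by `p`. -/
theorem exists_parameters (H : IsNormalized p t ψ) {γ : Y0 m → ℕ} (hle : γ ≤ topExp p t)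
    (h0 : ∀ i, (γ i : F) = 0) (hγ : γ ≠ 0) :
    ∃ b c d : F,
      (∀ u : Finset (Fin n), Even u.card → ∀ l, chi ψ (.inr l) (mono F (γ, u)) =
        c • pd F (.inr l) (mono F (0, u)) + b • mul F (mono F (0, u)) (pd F (.inr l) (xomega F))) ∧
      (∀ u : Finset (Fin n), Even u.card → ∀ j,
        chi ψ (.inl j.swap) (mono F (γ + Pi.single j 1, u)) =
          (tau (.inl j : Y m n) : F) •
            (c • mono F (0, u) + d • mul F (mono F (0, u)) (xomega F))) ∧
      (Odd n → b = 0 ∧ d = 0) ∧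
      ((∀ r s, 1 ≤ s → γ ≠ Pi.single r (p ^ s)) → b = 0 ∧ c = 0 ∧ d = 0) := by
  have hm := H.one_lt_m
  have hp := H.three_lt_p
  have hn := H.three_lt_n
  have hps := H.p_le_sum h0 hγ
  let i₀ : Y0 m := .inl ⟨0, by omega⟩
  have hmem : ∀ {u : Finset (Fin n)}, Even u.card → mono F (γ, u) ∈ potentials F p m n t :=
    fun hu => H.mem_of_le hle h0 (fun _ => Nat.le_add_right _ _) hu
  have hmem1 : ∀ {u : Finset (Fin n)} (j : Y0 m), Even u.card →
      mono F (γ + Pi.single j 1, u) ∈ potentials F p m n t :=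
    fun j hu => H.mem_of_le hle h0 (fun x => (add_single_le j x).trans (by omega)) hu
  have he : Even (∅ : Finset (Fin n)).card := by simp
  -- The parameter b comes from the odd part of χ on x^(γ), c and d from its even part on x^(γ) x_j;
  -- by `chi_swap_eq` the latter need only be known for one j. The factor T = ±1 normalizes away the
  -- sign of i₀.
  obtain ⟨b, hb, hbn⟩ := H.chi_pure_odd (hmem he) (by omega) (i := i₀) (by rw [h0]; simp)
  obtain ⟨c', d', hcd, hdn⟩ := H.chi_pure_even (hmem1 i₀ he) i₀.swap
  set T : F := (tau (.inl i₀ : Y m n) : F) with hT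
  have hTT : T * T = 1 := tau_mul_self _
  have hcd' : ∀ j, chi ψ (.inl j.swap) (mono F (γ + Pi.single j 1, ∅)) =
      (tau (.inl j : Y m n) : F) • ((T * c') • mono F (0, ∅) + (T * d') • xomega F) := by
    intro j
    have h := H.chi_swap_eq (u := ∅) hle h0 he i₀ j
    have h2 := congrArg (fun x => (tau (.inl j : Y m n) : F) • x) h
    simp only [smul_smul, tau_mul_self, one_smul] at h2
    rw [h2, hcd, mul_smul, smul_add, ← hT]
    simp only [smul_smul]
  refine ⟨b, T * c', T * d', fun u hu l => ?_, fun u hu j => ?_, fun ho => ?_, fun hs => ?_⟩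
  -- The factor x^u is introduced by the bracket of x_{i₀'} x^u with x^(γ) x_{i₀}, a multiple of
  -- x^(γ) x^u.
  · have hf := hmem1 i₀ he
    have hg := H.single_mem i₀.swap hu
    have e := ham_single_mixed_pure (F := F) i₀.swap hu γ
    rw [Sum.swap_swap] at e
    have h := H.chi_ham hf hg (by rw [e]; exact Submodule.smul_mem _ _ (hmem hu)) (.inr l)
    rw [e, H.act_high hg hf (mono_mem_evenDegGE (by simp only [Pi.add_apply, Finset.sum_add_distrib]; omega)),
      sub_zero, H.act_one_odd hf hg, Sum.swap_swap, pd_even_mono_add, hb, hcd' i₀, map_smul,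
      tau_swap, ← hT] at h
    simp only [map_smul, map_add, LinearMap.smul_apply, LinearMap.add_apply, one_mul',
      mul_xomega_pd l hu, smul_zero, add_zero] at h
    push_cast at h
    have h2 := congrArg (fun x => (-T) • x) h
    simp only [smul_sub, smul_smul] at h2
    rw [show (-((T : F))) * (-T) = 1 by rw [neg_mul_neg, hTT], one_smul] at h2
    rw [h2, ← sub_eq_zero]
    have : -T * (T * (T * c')) = -(T * c') := by
      rw [← mul_assoc T T, hTT, one_mul, neg_mul]
    rw [this, ← hT, show -T * (-T * b) = b by linear_combination b * hTT]
    module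
  -- Here x^u is introduced by a pair other than that of j, which avoids the derivative terms of
  -- x^u.
  · obtain ⟨i, hi, hi'⟩ := H.exists_other_pair j
    have hf : mono F (γ + Pi.single j 1 + Pi.single i 1, ∅) ∈ potentials F p m n t :=
      H.mem_of_le hle h0 (fun x => (add_single_le i x).trans
        ((Nat.add_le_add_right (add_single_le j x) 1).trans (by omega))) he
    have hg := H.single_mem i.swap hu
    have e := ham_single_mixed_pure (F := F) i.swap hu (γ + Pi.single j 1)
    rw [Sum.swap_swap] at e
    have h := H.chi_ham hf hg (by rw [e]; exact Submodule.smul_mem _ _ (hmem1 j hu)) (.inl j.swap)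
    rw [e, H.act_high hg hf (mono_mem_evenDegGE (by simp only [Pi.add_apply, Finset.sum_add_distrib]; omega)),
      sub_zero, H.act_one hf hg, Sum.swap_swap, Sum.swap_swap, pd_even_mono_add,
      if_neg (fun h => hi' (by rw [h, Sum.swap_swap])), sub_zero, map_smul, hcd' j] at h
    have h3 := smul_right_injective _ (tau_ne_zero (F := F) (.inl i.swap : Y m n)) h
    rw [h3]
    simp only [map_smul, map_add, mul_one']
  · exact ⟨hbn ho, by rw [hdn ho, mul_zero]⟩
  · obtain ⟨h1, h2⟩ := H.chi_eq_zero_of_not_pow hle h0 hγ hs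
    have hune : (Finset.univ : Finset (Fin n)) ≠ ∅ := by
      rw [← Finset.nonempty_iff_ne_empty]
      exact ⟨⟨0, by omega⟩, Finset.mem_univ _⟩
    have h3 := h2 i₀
    rw [hcd] at h3
    have hc : c' = 0 := by
      have := DFunLike.congr_fun h3 ((0, ∅) : Mon m n)
      simpa [mono_apply, xomega, hune] using this
    have hd : d' = 0 := by
      have := DFunLike.congr_fun h3 ((0, Finset.univ) : Mon m n)
      simpa [mono_apply, xomega, hune.symm] using this
    have hb0 : b = 0 := by
      have h4 := hb ⟨0, by omega⟩
      rw [h1, pd_xomega, eq_comm, smul_eq_zero, smul_eq_zero] at h4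
      rcases h4 with h4 | h4 | h4
      · exact h4
      · exact absurd h4 (neg_one_pow_ne_zero _)
      · exact absurd h4 (by simp [mono])
    simp [hc, hd, hb0]

end IsNormalized

end Parameters

end HamSuper

namespace HamSuper

/-! ### Exponent zero: the multiple of ad Γ' -/

section ZeroExponent

variable {F : Type*} [Field F] {m n : ℕ} {p : ℕ} {t : Y0 m → ℕ}
  {ψ : O F m n →ₗ[F] Module.End F (O F m n)}

theorem even_mem_par {α : Y0 m → ℕ} {u : Finset (Fin n)} (hu : Even u.card) :
    mono F (α, u) ∈ par F m n 0 :=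
  mono_mem_par _ (by simpa [Nat.ModEq] using Nat.even_iff.1 hu)

theorem mul_comm_even {e : ℕ} {f g : O F m n} (hf : f ∈ par F m n e) (hg : g ∈ par F m n 0) :
    mul F f g = mul F g f := by
  rw [mul_super_comm hf hg]; simp

theorem mul_odd_coeff {u w : Finset (Fin n)} (h : Disjoint u w) (α : Y0 m → ℕ) (f : O F m n) :
    mul F (mono F (0, u)) f (α, u ∪ w) = (-1) ^ inversions u w * f (α, w) := by
  induction f using O_induction with
  | zero => simp
  | add f g hf hg => simp [hf, hg, mul_add]
  | smul c f hf =>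
    rw [map_smul, Finsupp.smul_apply, Finsupp.smul_apply, hf, smul_eq_mul, smul_eq_mul]; ring
  | mono a =>
    obtain ⟨β, v⟩ := a
    rw [mul_mono_mono, divCoeff_zero_left, zero_add, mul_one, mono_apply]
    split_ifs with h1 h2 h2
    · obtain ⟨rfl, rfl⟩ := Prod.mk.inj h2
      simp [mono_apply]
    · rw [Finsupp.smul_apply, mono_apply, if_neg, smul_zero, mul_zero]
      intro h3
      obtain ⟨h4, h5⟩ := Prod.mk.inj h3
      refine h2 (Prod.ext h4 ?_)
      have h6 := congrArg (· \ u) h5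
      simpa [Finset.union_sdiff_distrib, Finset.sdiff_eq_self_of_disjoint h1.symm,
        Finset.sdiff_eq_self_of_disjoint h.symm] using h6
    · obtain ⟨rfl, rfl⟩ := Prod.mk.inj h2
      exact absurd h h1
    · simp

theorem mul_pd_pd_eq_zero {u v : Finset (Fin n)}
    (h : ∀ k ∈ u, k ∈ v → ¬ Disjoint (u.erase k) (v.erase k)) (α β : Y0 m → ℕ) (k : Fin n) :
    mul F (pd F (.inr k) (mono F (α, u))) (pd F (.inr k) (mono F (β, v))) = 0 := by
  rw [pd_odd_mono, pd_odd_mono]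
  split_ifs with h1 h2
  · rw [map_smul, map_smul, LinearMap.smul_apply, mul_mono_mono, if_neg (h k h1 h2)]
    simp
  all_goals simp

theorem not_disjoint_erase_of_disjoint {u v : Finset (Fin n)} (huv : Disjoint u v) :
    ∀ k ∈ u, k ∈ v → ¬ Disjoint (u.erase k) (v.erase k) :=
  fun _ h1 h2 => absurd h2 (Finset.disjoint_left.1 huv h1)

namespace IsNormalized

/-- `χ` on `x_i x^u`, which does not depend on `i`. -/
theorem chi_single_swap (H : IsNormalized p t ψ) {u : Finset (Fin n)} (hu : Even u.card)
    (i j : Y0 m) :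
    chi ψ (.inl j.swap) (mono F (Pi.single j 1, u)) = ((tau (.inl j : Y m n) : F) *
      (tau (.inl i : Y m n) : F)) • chi ψ (.inl i.swap) (mono F (Pi.single i 1, u)) := by
  have h := H.chi_swap_eq (γ := 0) (u := u) (fun _ => Nat.zero_le _) (by simp) hu i j
  rw [zero_add, zero_add] at h
  rw [mul_smul, ← h, smul_smul, tau_mul_self, one_smul]

/-- `χ` on `x_i x^u` is a derivation in `x^u`. -/
theorem chi_single_mul (H : IsNormalized p t ψ) {u v : Finset (Fin n)} (hu : Even u.card)
    (hv : Even v.card) (huv : ∀ k ∈ u, k ∈ v → ¬ Disjoint (u.erase k) (v.erase k)) (i : Y0 m) :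
    chi ψ (.inl i.swap) (mul F (mono F (Pi.single i 1, u)) (mono F (0, v))) =
      mul F (mono F (0, u)) (chi ψ (.inl i.swap) (mono F (Pi.single i 1, v))) +
      mul F (mono F (0, v)) (chi ψ (.inl i.swap) (mono F (Pi.single i 1, u))) := by
  -- The product x_i x^u x^v is, up to sign, the bracket of x_i x_j x^u with x_{j'} x^v. The
  -- condition on u and v says that the odd derivatives contribute nothing to it; it still allows u
  -- = v of size two.
  obtain ⟨j, hj, hj'⟩ := H.exists_other_pair i
  have hij' : i ≠ j.swap := fun h => hj' (by rw [h, Sum.swap_swap])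
  have hf := H.single_mem j.swap hv
  have hg : mono F (Pi.single i 1 + Pi.single j 1, u) ∈ potentials F p m n t :=
    H.mem_of_le (γ := 0) (fun _ => Nat.zero_le _) (by simp) (fun x => by
      have h1 := add_single_le (γ := (Pi.single i 1 : Y0 m → ℕ)) j x
      have h2 := add_single_le (γ := (0 : Y0 m → ℕ)) i x
      rw [zero_add] at h2
      omega) hu
  have e : ham F (mono F (Pi.single i 1 + Pi.single j 1, u)) (mono F (Pi.single j.swap 1, v)) =
      (tau (.inl j : Y m n) : F) • mul F (mono F (Pi.single i 1, u)) (mono F (0, v)) := by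
    rw [ham_apply (even_mem_par hu), Finset.sum_eq_single (.inl j)]
    · rw [pd_even_mono_add, conj_inl, pd_even_mono_single, if_pos rfl]
    · rintro (a | k) _ ha
      · rw [conj_inl, pd_even_mono_single, if_neg, map_zero, smul_zero]
        intro h
        exact ha (by rw [swap_eq_iff, Sum.swap_swap] at h; rw [h])
      · rw [conj_inr, mul_pd_pd_eq_zero huv, smul_zero]
    · simp
  have hm : mul F (mono F (Pi.single i 1, u)) (mono F (0, v)) ∈ potentials F p m n t := by
    rw [mul_mono_mono]
    split_ifs with hd
    · rw [add_zero]
      refine Submodule.smul_mem _ _ (H.single_mem i ?_)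
      rw [Finset.card_union_of_disjoint hd]
      exact hu.add hv
    · exact Submodule.zero_mem _
  have h := H.chi_ham hf hg (by rw [e]; exact Submodule.smul_mem _ _ hm) (.inl i.swap)
  have h1 := H.chi_single_swap hv i j.swap
  rw [Sum.swap_swap] at h1
  rw [e, map_smul, H.act_two hf hg, Sum.swap_swap, if_neg hj.symm, if_pos rfl, H.act_one hg hf,
    Sum.swap_swap, Sum.swap_swap, if_neg hij', sub_zero, pd_even_mono_add, h1, map_smul,
    LinearMap.smul_apply, tau_swap, tau_swap,
    mul_comm_even (H.chi_mem_par _ _) (even_mem_par hu)] at h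
  push_cast at h
  have h2 := congrArg (fun x => (tau (.inl j : Y m n) : F) • x) h
  have hT := tau_mul_self (F := F) (.inl j : Y m n)
  have hS := tau_mul_self (F := F) (.inl i : Y m n)
  simp only [smul_smul, smul_sub] at h2
  rw [hT, one_smul] at h2
  rw [h2]
  generalize (tau (.inl j : Y m n) : F) = T at *
  generalize (tau (.inl i : Y m n) : F) = S at *
  rw [show T * (-S * (-T * S)) = 1 by linear_combination (S * S) * hT + hS,
    show T * -T = -1 by linear_combination -hT]
  module

/-- `χ` on `x^u`. -/
theorem chi_zero_mul (H : IsNormalized p t ψ) {u v : Finset (Fin n)} (hu : Even u.card)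
    (hv : Even v.card) (huv : Disjoint u v) (i : Y0 m) (l : Fin n) :
    chi ψ (.inr l) (mul F (mono F (0, u)) (mono F (0, v))) =
      mul F (mono F (0, u)) (chi ψ (.inr l) (mono F (0, v))) +
      mul F (mono F (0, v)) (chi ψ (.inr l) (mono F (0, u))) +
      (tau (.inl i : Y m n) : F) •
        (mul F (chi ψ (.inl i.swap) (mono F (Pi.single i 1, v))) (pd F (.inr l) (mono F (0, u))) +
         mul F (chi ψ (.inl i.swap) (mono F (Pi.single i 1, u))) (pd F (.inr l) (mono F (0, v)))) := by
  -- The product x^u x^v is, up to sign, the bracket of x_i x^u with x_{i'} x^v.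
  have hf := H.single_mem i.swap hv
  have hg := H.single_mem i hu
  have e : ham F (mono F (Pi.single i 1, u)) (mono F (Pi.single i.swap 1, v)) =
      (tau (.inl i : Y m n) : F) • mul F (mono F (0, u)) (mono F (0, v)) := by
    rw [ham_single_mixed i hu, pd_even_mono_single, if_pos rfl, Finset.sum_eq_zero, add_zero]
    intro k _
    exact mul_pd_pd_eq_zero (not_disjoint_erase_of_disjoint huv) _ _ k
  have hm : mul F (mono F (0, u)) (mono F (0, v)) ∈ potentials F p m n t := by
    rw [mul_mono_mono, if_pos huv, add_zero]
    refine Submodule.smul_mem _ _ (H.zero_mem ?_)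
    rw [Finset.card_union_of_disjoint huv]
    exact hu.add hv
  have h := H.chi_ham hf hg (by rw [e]; exact Submodule.smul_mem _ _ hm) (.inr l)
  have h1 := H.chi_single_swap hv i i.swap
  rw [Sum.swap_swap] at h1
  rw [e, map_smul, H.act_one_odd hf hg, H.act_one_odd hg hf, pd_even_mono_single, if_pos rfl,
    Sum.swap_swap, pd_even_mono_single, if_pos rfl, h1, map_smul,
    LinearMap.smul_apply, tau_swap] at h
  push_cast at h
  have h2 := congrArg (fun x => (tau (.inl i : Y m n) : F) • x) h
  have hT := tau_mul_self (F := F) (.inl i : Y m n)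
  simp only [smul_smul, smul_sub] at h2
  rw [hT, one_smul] at h2
  rw [h2]
  generalize (tau (.inl i : Y m n) : F) = T at *
  rw [show T * (-T * T) = -T by linear_combination (-T) * hT,
    show T * -T = -1 by linear_combination -hT]
  module

/-- `χ` on `x_i x_k x_l` is a combination of `x_k x_l` and `x^ω`. -/
theorem chi_single_pair_aux (H : IsNormalized p t ψ) {k l : Fin n} (hkl : k ≠ l) (i : Y0 m) :
    ∃ c d : F, chi ψ (.inl i.swap) (mono F (Pi.single i 1, {k, l})) =
      c • mono F (0, {k, l}) + d • xomega F := by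
  have hn := H.three_lt_n
  have hu : Even ({k, l} : Finset (Fin n)).card := by rw [Finset.card_pair hkl]; exact even_two
  have hf := H.single_mem i hu
  set b := chi ψ (.inl i.swap) (mono F (Pi.single i 1, {k, l})) with hb
  have hrot : ∀ r s : Fin n, r ≠ s → rot F r s (mono F (Pi.single i 1, {k, l})) = 0 →
      rot F r s b = 0 := by
    intro r s hrs h0
    rw [hb, ← H.chi_rot_even hf hrs (by rw [h0]; exact Submodule.zero_mem _), h0, map_zero]
  -- The derivation rule at u = v = {k, l}: the square is zero, so 2 x_k x_l b = 0.
  have hsq : mul F (mono F (0, {k, l})) b = 0 := by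
    have h := H.chi_single_mul hu hu (by
      intro x hx _ hd
      rw [disjoint_self, Finset.bot_eq_empty] at hd
      have := Finset.card_erase_add_one hx
      rw [hd, Finset.card_pair hkl, Finset.card_empty] at this
      omega) i
    rw [mul_mono_mono, if_neg, map_zero, ← hb, ← two_smul F, eq_comm, smul_eq_zero] at h
    · exact h.resolve_left H.two_ne
    · rw [disjoint_self]
      exact Finset.insert_ne_empty _ _
  have hune : (Finset.univ : Finset (Fin n)) ≠ {k, l} := by
    intro h
    have := congrArg Finset.card h
    rw [Finset.card_pair hkl, Finset.card_univ, Fintype.card_fin] at this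
    omega
  refine ⟨b (0, {k, l}), b (0, Finset.univ), Finsupp.ext ?_⟩
  rintro ⟨α, w⟩
  simp only [Finsupp.add_apply, Finsupp.smul_apply, mono_apply, xomega, smul_eq_mul, mul_ite,
    mul_one, mul_zero, Prod.mk.injEq]
  by_cases hα : α = 0
  swap
  · rw [hb, chi_apply_of_ne _ _ hα, if_neg (fun h => hα h.1.symm), if_neg (fun h => hα h.1.symm),
      add_zero]
  subst hα
  by_cases h1 : w = {k, l}
  · subst h1
    rw [if_pos ⟨rfl, rfl⟩, if_neg (fun h => hune h.2), add_zero]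
  by_cases h2 : w = Finset.univ
  · subst h2
    rw [if_neg (fun h => hune h.2.symm), if_pos ⟨rfl, rfl⟩, zero_add]
  rw [if_neg (fun h => h1 h.2.symm), if_neg (fun h => h2 h.2.symm), add_zero]
  have hkm : k ∈ ({k, l} : Finset (Fin n)) := by simp
  have hlm : l ∈ ({k, l} : Finset (Fin n)) := by simp
  -- Monomials with neither k nor l die by `hsq`, those with exactly one by the rotation in k and l,
  -- and those with both, apart from x_k x_l and x^ω, by rotations in two other indices.
  by_cases hk : k ∈ w <;> by_cases hl : l ∈ w
  · obtain ⟨s, hs⟩ : ∃ s, s ∉ w := by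
      by_contra hcon; push Not at hcon
      exact h2 (Finset.eq_univ_iff_forall.2 hcon)
    obtain ⟨r, hr, hr'⟩ : ∃ r ∈ w, r ∉ ({k, l} : Finset (Fin n)) := by
      by_contra hcon; push Not at hcon
      refine h1 (Finset.Subset.antisymm hcon ?_)
      intro x hx
      rcases Finset.mem_insert.1 hx with rfl | hx
      · exact hk
      · rwa [Finset.mem_singleton.1 hx]
    have hs' : s ∉ ({k, l} : Finset (Fin n)) := by
      intro h
      rcases Finset.mem_insert.1 h with rfl | h
      · exact hs hk
      · rw [Finset.mem_singleton] at h
        exact hs (h ▸ hl)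
    have hrs : r ≠ s := by rintro rfl; exact hs hr
    exact coeff_eq_zero_of_rot hrs (hrot r s hrs (rot_mono_of_notMem hr' hs' _)) hr hs 0
  · exact coeff_eq_zero_of_rot hkl (hrot k l hkl (rot_mono_of_mem hkl hkm hlm _)) hk hl 0
  · exact coeff_eq_zero_of_rot hkl.symm
      (hrot l k hkl.symm (rot_mono_of_mem hkl.symm hlm hkm _)) hl hk 0
  · have h := mul_odd_coeff (F := F) (u := {k, l}) (w := w) (by
      rw [Finset.disjoint_left]
      intro x hx
      rcases Finset.mem_insert.1 hx with rfl | hx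
      · exact hk
      · rwa [Finset.mem_singleton.1 hx]) (0 : Y0 m → ℕ) b
    rw [hsq, Finsupp.zero_apply, eq_comm, mul_eq_zero] at h
    exact h.resolve_left (neg_one_pow_ne_zero _)

/-- The rotation exchanging l for r takes x_k x_l to ± x_k x_r but kills x^ω. So moving to another
pair keeps c and removes d. -/
theorem chi_single_pair_transfer (H : IsNormalized p t ψ) {k l r : Fin n} (hkl : k ≠ l)
    (hkr : k ≠ r) (hlr : l ≠ r) (i : Y0 m) {c d : F}
    (h : chi ψ (.inl i.swap) (mono F (Pi.single i 1, {k, l})) =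
      c • mono F (0, {k, l}) + d • xomega F) :
    chi ψ (.inl i.swap) (mono F (Pi.single i 1, {k, r})) = c • mono F (0, {k, r}) := by
  have hu : Even ({k, l} : Finset (Fin n)).card := by rw [Finset.card_pair hkl]; exact even_two
  have hv : Even ({k, r} : Finset (Fin n)).card := by rw [Finset.card_pair hkr]; exact even_two
  have hl : l ∈ ({k, l} : Finset (Fin n)) := by simp
  have hr : r ∉ ({k, l} : Finset (Fin n)) := by simp [hkr.symm, hlr.symm]
  have hs : insert r (({k, l} : Finset (Fin n)).erase l) = {k, r} := by
    ext x
    simp only [Finset.mem_insert, Finset.mem_erase, Finset.mem_singleton]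
    constructor
    · rintro (rfl | ⟨h1, rfl | h2⟩)
      · exact Or.inr rfl
      · exact Or.inl rfl
      · exact absurd h2 h1
    · rintro (rfl | rfl)
      · exact Or.inr ⟨hkl, Or.inl rfl⟩
      · exact Or.inl rfl
  have h1 := H.chi_rot_even (H.single_mem i hu) hlr (by
    rw [rot_mono hl hr, hs]
    exact Submodule.smul_mem _ _ (H.single_mem i hv)) i.swap
  rw [h, map_add, map_smul, map_smul, xomega,
    rot_mono_of_mem hlr (Finset.mem_univ _) (Finset.mem_univ _), rot_mono hl hr, rot_mono hl hr, hs,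
    map_smul, smul_zero, add_zero, smul_comm] at h1
  exact smul_right_injective _
    (mul_ne_zero (neg_one_pow_ne_zero _) (neg_one_pow_ne_zero _)) h1

theorem chi_single_pair (H : IsNormalized p t ψ) (i : Y0 m) :
    ∃ c : F, ∀ k l : Fin n, k ≠ l → chi ψ (.inl i.swap) (mono F (Pi.single i 1, {k, l})) =
      c • mono F (0, {k, l}) := by
  have hn := H.three_lt_n
  have key : ∀ k l r : Fin n, k ≠ l → k ≠ r → l ≠ r → ∀ c : F,
      chi ψ (.inl i.swap) (mono F (Pi.single i 1, {k, l})) = c • mono F (0, {k, l}) →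
      chi ψ (.inl i.swap) (mono F (Pi.single i 1, {k, r})) = c • mono F (0, {k, r}) := by
    intro k l r hkl hkr hlr c h
    exact H.chi_single_pair_transfer hkl hkr hlr i (d := 0) (by rw [h, zero_smul, add_zero])
  let z : Fin n := ⟨0, by omega⟩
  let o : Fin n := ⟨1, by omega⟩
  let w : Fin n := ⟨2, by omega⟩
  have hzo : z ≠ o := by simp [z, o]
  have hzw : z ≠ w := by simp [z, w]
  have how : o ≠ w := by simp [w, o]
  -- One transfer away from the starting pair removes x^ω; any two pairs are then joined by
  -- transfers sharing an index.
  obtain ⟨c, d, hcd⟩ := H.chi_single_pair_aux hzw i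
  have h1 := H.chi_single_pair_transfer hzw hzo how.symm i hcd
  have h2 : ∀ r, z ≠ r → chi ψ (.inl i.swap) (mono F (Pi.single i 1, {z, r})) =
      c • mono F (0, {z, r}) := by
    intro r hr
    by_cases hor : o = r
    · rw [← hor]; exact h1
    · exact key z o r hzo hr hor c h1
  refine ⟨c, fun k l hkl => ?_⟩
  by_cases hzk : z = k
  · rw [← hzk]; exact h2 l (by rwa [hzk])
  by_cases hzl : z = l
  · rw [← hzl, Finset.pair_comm]; exact h2 k hzk
  refine key k z l (Ne.symm hzk) hkl hzl c ?_
  rw [Finset.pair_comm]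
  exact h2 k hzk

theorem exists_pair_of_even {u : Finset (Fin n)} (hu : Even u.card) (h0 : u ≠ ∅) :
    ∃ k l v, k ≠ l ∧ Disjoint ({k, l} : Finset (Fin n)) v ∧ u = {k, l} ∪ v ∧ Even v.card ∧
      v.card + 2 = u.card := by
  obtain ⟨k, hk⟩ := Finset.nonempty_iff_ne_empty.2 h0
  have h1 := Finset.card_erase_add_one hk
  obtain ⟨l, hl⟩ : (u.erase k).Nonempty := by
    rw [Finset.nonempty_iff_ne_empty]
    intro h
    rw [h, Finset.card_empty] at h1
    rw [← h1] at hu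
    exact absurd hu (by decide)
  have h2 := Finset.card_erase_add_one hl
  have hlk : l ≠ k := Finset.ne_of_mem_erase hl
  refine ⟨k, l, (u.erase k).erase l, hlk.symm, ?_, ?_, ?_, by omega⟩
  · rw [Finset.disjoint_left]
    intro x hx
    rcases Finset.mem_insert.1 hx with rfl | hx
    · simp
    · rw [Finset.mem_singleton.1 hx]; simp
  · rw [Finset.insert_union, Finset.singleton_union, Finset.insert_erase hl,
      Finset.insert_erase hk]
  · have h3 : u.card = ((u.erase k).erase l).card + 2 := by omega
    rw [h3, Nat.even_add] at hu
    exact hu.2 even_two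

/-- The values of `χ` on `x^u` and `x_j x^u`. -/
theorem exists_parameter_zero (H : IsNormalized p t ψ) : ∃ c : F,
    (∀ u : Finset (Fin n), Even u.card → ∀ l, chi ψ (.inr l) (mono F (0, u)) =
      (c * ((u.card : F) - 2)) • pd F (.inr l) (mono F (0, u))) ∧
    (∀ u : Finset (Fin n), Even u.card → ∀ j,
      chi ψ (.inl j.swap) (mono F (Pi.single j 1, u)) =
        (tau (.inl j : Y m n) : F) • (c * u.card) • mono F (0, u)) := by
  have hm := H.one_lt_m
  let i : Y0 m := .inl ⟨0, by omega⟩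
  have hτ : (tau (.inl i : Y m n) : F) = 1 := by simp [i, tau]
  obtain ⟨c', hc'⟩ := H.chi_single_pair i
  -- Halving the constant of a pair makes the value on x_i x^u equal to c|u|, which is the effect of
  -- c ad Γ'.
  obtain ⟨c, rfl⟩ : ∃ c, c' = c * 2 := ⟨c' / 2, by rw [div_mul_cancel₀ _ H.two_ne]⟩
  have hB : ∀ (N : ℕ) (u : Finset (Fin n)), u.card = N → Even u.card →
      chi ψ (.inl i.swap) (mono F (Pi.single i 1, u)) = (c * u.card) • mono F (0, u) ∧
      ∀ l, chi ψ (.inr l) (mono F (0, u)) =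
        (c * ((u.card : F) - 2)) • pd F (.inr l) (mono F (0, u)) := by
    intro N
    induction N using Nat.strong_induction_on with
    | _ N ih =>
      intro u hN hu
      by_cases h0 : u = ∅
      · subst h0
        refine ⟨?_, fun l => ?_⟩
        · rw [chi_apply, H.low _ (by simp) (by simp)]; simp
        · rw [chi_apply, H.low _ (by simp) (by simp)]; simp [pd_odd_pure]
      -- A pair is split off u; the values on pairs and the two product rules determine the values
      -- on u from those on v.
      obtain ⟨k, l', v, hkl, hdis, huv, hv, hcard⟩ := exists_pair_of_even hu h0
      have hw : Even ({k, l'} : Finset (Fin n)).card := by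
        rw [Finset.card_pair hkl]; exact even_two
      obtain ⟨hv1, hv2⟩ := ih v.card (by omega) v rfl hv
      have hw1 := hc' k l' hkl
      have hc2 : (u.card : F) = v.card + 2 := by rw [← hcard]; push_cast; rfl
      have hww := neg_one_pow_ne_zero (F := F) (inversions {k, l'} v)
      have e0 : mul F (mono F ((0, {k, l'}) : Mon m n)) (mono F (0, v)) =
          ((-1 : F) ^ inversions {k, l'} v) • mono F (0, u) := by
        rw [mul_mono_mono, if_pos hdis, divCoeff_zero_left, mul_one, add_zero, huv]
      have e1 : mul F (mono F (Pi.single i 1, {k, l'})) (mono F (0, v)) =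
          ((-1 : F) ^ inversions {k, l'} v) • mono F (Pi.single i 1, u) := by
        rw [mul_mono_mono, if_pos hdis, divCoeff_zero_right, mul_one, add_zero, huv]
      refine ⟨?_, fun l => ?_⟩
      · have h := H.chi_single_mul hw hv (not_disjoint_erase_of_disjoint hdis) i
        rw [e1, hv1, hw1, map_smul, map_smul, map_smul, mul_comm_even (even_mem_par hv)
          (even_mem_par hw), ← add_smul, e0, smul_comm] at h
        rw [smul_right_injective _ hww h, hc2]
        congr 1
        ring
      -- The pair itself has degree 2, so ψ vanishes on it; the Leibniz rule for ∂_l reassembles the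
      -- terms, which accounts for the shift |u| - 2.
      · have h := H.chi_zero_mul hw hv hdis i l
        have hlow : chi ψ (.inr l) (mono F (0, {k, l'})) = 0 := by
          rw [chi_apply, H.pair_low hkl]; simp
        have hpd := pd_odd_mul l (even_mem_par (F := F) (α := (0 : Y0 m → ℕ)) hw) (mono F (0, v))
        rw [e0, map_smul, pow_zero, one_smul, mul_comm_even (pd_mem_par (even_mem_par hw) _)
          (even_mem_par hv)] at hpd
        rw [e0, hlow, hv1, hw1, hv2 l, hτ, one_smul] at h
        simp only [map_smul, LinearMap.smul_apply, map_zero, add_zero] at h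
        have h3 : ((-1 : F) ^ inversions {k, l'} v) • chi ψ (.inr l) (mono F (0, u)) =
            ((-1 : F) ^ inversions {k, l'} v) •
              ((c * ((u.card : F) - 2)) • pd F (.inr l) (mono F (0, u))) := by
          rw [h, smul_comm, hpd, hc2]
          module
        exact smul_right_injective _ hww h3
  refine ⟨c, fun u hu => (hB _ u rfl hu).2, fun u hu j => ?_⟩
  rw [H.chi_single_swap hu i j, (hB _ u rfl hu).1, hτ, mul_one]

end IsNormalized

end ZeroExponent

end HamSuper

namespace HamSuper

/-! ### From the derivation φ to the map ψ -/

section Extension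

variable {F : Type*} [Field F] {p m n : ℕ} {t : Y0 m → ℕ}

theorem isVectorField_of_mem {E : Module.End F (O F m n)} (hE : E ∈ Weven F p m n t) :
    IsVectorField E := by
  refine Submodule.iSup_induction (motive := IsVectorField) _ hE ?_ IsVectorField.zero fun _ _ h h' => h.add h'
  rintro i _ ⟨f, -, rfl⟩
  exact isVectorField_field i f

theorem field_var (i j : Y m n) (f : O F m n) :
    field F i f (var F j) = if i = j then f else 0 := by
  rw [field_apply, pd_var]
  split_ifs
  · exact mul_one' f
  · simp

theorem isEvenField_of_mem {E : Module.End F (O F m n)} (hE : E ∈ Weven F p m n t) :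
    IsEvenField E := by
  intro j
  refine Submodule.iSup_induction (motive := fun E => E (var F j) ∈ par F m n (mu j)) _ hE ?_ (Submodule.zero_mem _) fun _ _ h h' =>
    Submodule.add_mem _ h h'
  rintro i _ ⟨f, hf, rfl⟩
  rw [field_var]
  split_ifs with h
  · subst h
    exact Finsupp.supported_mono (fun a ha => ha.2) hf
  · exact Submodule.zero_mem _

theorem apply_var_mem_of_mem_deg {k : ℤ} {E : Module.End F (O F m n)}
    (hE : E ∈ WevenDeg F p m n t k) (j : Y m n) :
    E (var F j) ∈ truncParityDeg F p m n t (mu j) (k + 1) := by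
  refine Submodule.iSup_induction
    (motive := fun E => E (var F j) ∈ truncParityDeg F p m n t (mu j) (k + 1)) _ hE ?_ (Submodule.zero_mem _) fun _ _ h h' =>
    Submodule.add_mem _ h h'
  rintro i _ ⟨f, hf, rfl⟩
  rw [field_var]
  split_ifs with h
  · subst h
    exact hf
  · exact Submodule.zero_mem _

theorem pd_mono_mem_truncParityDeg {α : Y0 m → ℕ} {u : Finset (Fin n)} (hα : α ≤ topExp p t)
    (hu : Even u.card) (i : Y m n) : pd F i (mono F (α, u)) ∈
      truncParityDeg F p m n t (mu i) (((∑ x, α x + u.card : ℕ) : ℤ) - 1) := by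
  rw [Nat.even_iff] at hu
  rcases i with i | k
  · rw [pd_even_mono]
    split_ifs with h
    · exact Submodule.zero_mem _
    · refine Finsupp.single_mem_supported F _ ⟨fun x => ?_, by simpa [mu, Nat.ModEq] using hu, ?_⟩
      · have h1 : α x ≤ topExp p t x := hα x
        change Function.update α i (α i - 1) x ≤ topExp p t x
        by_cases hx : x = i
        · subst hx
          rw [Function.update_self]
          omega
        · rw [Function.update_of_ne hx]; exact h1
      · have := sum_update_pred h
        simp only
        omega
  · rw [pd_odd_mono]
    split_ifs with h
    · have hc := Finset.card_erase_add_one h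
      refine Submodule.smul_mem _ _ (Finsupp.single_mem_supported F _ ⟨hα, ?_, ?_⟩)
      · simp only [mu, Nat.ModEq]
        omega
      · simp only
        omega
    · exact Submodule.zero_mem _

theorem ham_mono_mem_deg {α : Y0 m → ℕ} {u : Finset (Fin n)} (hα : α ≤ topExp p t)
    (hu : Even u.card) : ham F (mono F (α, u)) ∈
      WevenDeg F p m n t (((∑ x, α x + u.card : ℕ) : ℤ) - 2) := by
  rw [ham_even (even_mem_par hu)]
  refine Submodule.sum_mem _ fun i _ => Submodule.smul_mem _ _
    (Submodule.mem_iSup_of_mem (conj i) (Submodule.mem_map_of_mem ?_))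
  rw [mu_conj]
  have h := pd_mono_mem_truncParityDeg (F := F) hα hu i
  rwa [show (((∑ x, α x + u.card : ℕ) : ℤ) - 1) = ((∑ x, α x + u.card : ℕ) : ℤ) - 2 + 1 by ring]
    at h

theorem ham_mem_Heven {f : O F m n} (hf : f ∈ potentials F p m n t) :
    ham F f ∈ Heven F p m n t :=
  Submodule.mem_map_of_mem hf

open scoped Classical in
/-- The linear map `f ↦ φ(D_H(f))`, extended by zero from the potentials to `𝒪(2m, n)`. -/
noncomputable def pullback (φ : Heven F p m n t →ₗ[F] Weven F p m n t) :
    O F m n →ₗ[F] Module.End F (O F m n) :=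
  Finsupp.linearCombination F fun a =>
    if h : mono F a ∈ potentials F p m n t then (φ ⟨ham F (mono F a), ham_mem_Heven h⟩).1 else 0

theorem pullback_mono (φ : Heven F p m n t →ₗ[F] Weven F p m n t) {a : Mon m n}
    (ha : mono F a ∈ potentials F p m n t) :
    pullback φ (mono F a) = (φ ⟨ham F (mono F a), ham_mem_Heven ha⟩).1 :=
  (Finsupp.linearCombination_single F 1 a).trans ((one_smul _ _).trans (dif_pos ha))

theorem pullback_mem (φ : Heven F p m n t →ₗ[F] Weven F p m n t) (f : O F m n) :
    pullback φ f ∈ Weven F p m n t := by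
  induction f using O_induction with
  | zero => rw [map_zero]; exact Submodule.zero_mem _
  | add f g hf hg => rw [map_add]; exact Submodule.add_mem _ hf hg
  | smul c f hf => rw [map_smul]; exact Submodule.smul_mem _ c hf
  | mono a =>
    rw [pullback, mono, Finsupp.linearCombination_single, one_smul]
    split_ifs
    · exact Subtype.prop _
    · exact Submodule.zero_mem _

theorem pullback_apply (φ : Heven F p m n t →ₗ[F] Weven F p m n t) {f : O F m n}
    (hf : f ∈ potentials F p m n t) : pullback φ f = (φ ⟨ham F f, ham_mem_Heven hf⟩).1 := by
  refine supported_induction (S := {a | a.1 ≤ topExp p t ∧ Even a.2.card ∧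
    a ≠ (topExp p t, Finset.univ)}) (P := fun f hf => pullback φ f =
      (φ ⟨ham F f, ham_mem_Heven hf⟩).1) hf ?_ ?_ ?_ ?_
  · have h0 : (⟨ham F 0, ham_mem_Heven (Submodule.zero_mem _)⟩ : Heven F p m n t) = 0 :=
      Subtype.ext (map_zero _)
    rw [map_zero, h0, map_zero, Submodule.coe_zero]
  · intro f g hf hg h1 h2
    have h0 : (⟨ham F (f + g), ham_mem_Heven (Submodule.add_mem _ hf hg)⟩ : Heven F p m n t) =
        ⟨ham F f, ham_mem_Heven hf⟩ + ⟨ham F g, ham_mem_Heven hg⟩ :=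
      Subtype.ext (map_add _ _ _)
    rw [map_add, h0, map_add, Submodule.coe_add, h1, h2]
  · intro c f hf h1
    have h0 : (⟨ham F (c • f), ham_mem_Heven (Submodule.smul_mem _ c hf)⟩ : Heven F p m n t) =
        c • ⟨ham F f, ham_mem_Heven hf⟩ :=
      Subtype.ext (map_smul _ _ _)
    rw [map_smul, h0, map_smul, Submodule.coe_smul, h1]
  · intro a ha
    exact pullback_mono φ (Finsupp.single_mem_supported F _ ha)

theorem isNormalized_pullback [CharP F p] (hp : 3 < p) (hm : 1 < m) (hn : 3 < n)
    (ht : ∀ i, 0 < t i) {φ : Heven F p m n t →ₗ[F] Weven F p m n t} (hφ : IsDerivation φ)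
    (hneg : ∀ X : Heven F p m n t, X.1 ∈ WevenDeg F p m n t (-1) → φ X = 0)
    (hzero : ∀ X : Heven F p m n t, X.1 ∈ WevenDeg F p m n t 0 → φ X = 0) :
    IsNormalized p t (pullback φ) where
  charP := ‹_›
  three_lt_p := hp
  one_lt_m := hm
  three_lt_n := hn
  t_pos := ht
  vectorField f := isVectorField_of_mem (pullback_mem φ f)
  evenField f := isEvenField_of_mem (pullback_mem φ f)
  der f g hf hg hgf := by
    rw [pullback_apply φ hgf, pullback_apply φ hf, pullback_apply φ hg]
    exact hφ ⟨ham F g, ham_mem_Heven hg⟩ ⟨ham F f, ham_mem_Heven hf⟩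
      ⟨ham F (ham F g f), ham_mem_Heven hgf⟩ (lie_ham (potentials_le_par p t hf) (potentials_le_par p t hg)).symm
  low := by
    rintro ⟨α, u⟩ hu hd
    simp only at hu hd
    have hle : ∀ x, α x < topExp p t x := fun x => by
      have h1 := Finset.single_le_sum (f := α) (fun _ _ => Nat.zero_le _) (Finset.mem_univ x)
      have h2 : p ^ 1 ≤ p ^ t x := Nat.pow_le_pow_right (by omega) (ht x)
      rw [pow_one] at h2
      simp only [topExp]
      omega
    have hα : α ≤ topExp p t := fun x => (hle x).le
    have hf : mono F (α, u) ∈ potentials F p m n t :=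
      mono_mem_potentials_of_lt hα hu (hle (.inl ⟨0, by omega⟩))
    rw [pullback_apply φ hf]
    have hdeg := ham_mono_mem_deg (F := F) hα hu
    -- Degree 0 is the constant, which D_H kills; degrees 1 and 2 are the hypotheses on degrees -1
    -- and 0 of 𝓗.
    obtain h | h | h : ∑ x, α x + u.card = 0 ∨ ∑ x, α x + u.card = 1 ∨ ∑ x, α x + u.card = 2 := by
      omega
    · have hu0 : u = ∅ := Finset.card_eq_zero.1 (by omega)
      have hα0 : α = 0 := by
        funext x
        have h1 := Finset.single_le_sum (f := α) (fun _ _ => Nat.zero_le _) (Finset.mem_univ x)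
        simp only [Pi.zero_apply]
        omega
      have h0 : (⟨ham F (mono F (α, u)), ham_mem_Heven hf⟩ : Heven F p m n t) = 0 :=
        Subtype.ext (show ham F (mono F (α, u)) = 0 by rw [hu0, hα0]; exact ham_const 1)
      rw [h0, map_zero]
      rfl
    · rw [h] at hdeg
      rw [hneg _ (by simpa using hdeg)]
      rfl
    · rw [h] at hdeg
      rw [hzero _ (by simpa using hdeg)]
      rfl

end Extension

end HamSuper

namespace HamSuper

/-! ### The odd Euler field, D_H(x^ω) and powers of ∂_r -/

section Euler

variable {F : Type*} [Field F] {m n : ℕ}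

theorem gammaPrime_mono (α : Y0 m → ℕ) (u : Finset (Fin n)) :
    GammaPrime F (mono F (α, u)) = (u.card : F) • mono F (α, u) := by
  have h : ∀ k : Fin n, field F (.inr k) (var F (.inr k)) (mono F (α, u)) =
      if k ∈ u then mono F (α, u) else 0 := by
    intro k
    rw [field_apply, pd_odd_mono]
    split_ifs with hk
    · rw [var, map_smul, mul_mono_mono, if_pos (by simp), divCoeff_zero_left, mul_one, zero_add,
        Finset.singleton_union, Finset.insert_erase hk, smul_smul, neg_one_pow_mul_self, one_smul]
    · simp
  rw [GammaPrime, LinearMap.sum_apply, Finset.sum_congr rfl fun k _ => h k, Finset.sum_ite_mem,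
    Finset.univ_inter, Finset.sum_const, Nat.cast_smul_eq_nsmul]

theorem pd_gammaPrime (i : Y0 m) (f : O F m n) :
    pd F (.inl i) (GammaPrime F f) = GammaPrime F (pd F (.inl i) f) := by
  induction f using O_induction with
  | zero => simp
  | add f g hf hg => simp [hf, hg]
  | smul c f hf => simp [hf]
  | mono a =>
    obtain ⟨α, u⟩ := a
    rw [gammaPrime_mono, map_smul, pd_even_mono]
    split_ifs
    · simp
    · rw [gammaPrime_mono]

theorem ev0_gammaPrime (f : O F m n) :
    ev0 F m n (GammaPrime F f) = GammaPrime F (ev0 F m n f) := by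
  induction f using O_induction with
  | zero => simp
  | add f g hf hg => simp [hf, hg]
  | smul c f hf => simp [hf]
  | mono a =>
    obtain ⟨α, u⟩ := a
    rw [gammaPrime_mono, map_smul, ev0_mono]
    split_ifs
    · rw [gammaPrime_mono]
    · simp

theorem gammaPrime_var (j : Y m n) : GammaPrime F (var F j) = (mu j : F) • var F j := by
  rcases j with j | k <;> simp [var, gammaPrime_mono, mu]

theorem isVectorField_gammaPrime : IsVectorField (GammaPrime F : Module.End F (O F m n)) :=
  IsVectorField.sum fun _ _ => isVectorField_field _ _

theorem isEvenField_gammaPrime : IsEvenField (GammaPrime F : Module.End F (O F m n)) := by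
  intro j
  rw [gammaPrime_var]
  refine Submodule.smul_mem _ _ ?_
  rcases j with j | k <;> exact mono_mem_par _ (by simp [mu, Nat.ModEq])

theorem ham_xomega_var_even (j : Y0 m) :
    ham F (xomega F) (var F (.inl j) : O F m n) = 0 := by
  have h := ham_mono_var (F := F) ((0, Finset.univ) : Mon m n) (.inl j.swap)
  rw [conj_inl, Sum.swap_swap] at h
  rw [xomega, h]
  simp [monoPartial]

theorem ham_xomega_var_odd (hn : Even n) (l : Fin n) :
    ham F (xomega F) (var F (.inr l) : O F m n) = pd F (.inr l) (xomega F) := by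
  rw [xomega, ham_var (even_mem_par (by simpa using hn)), conj_inr]
  simp [tau]

theorem pd_ham_xomega_var (i : Y0 m) (j : Y m n) :
    pd F (.inl i) (ham F (xomega F) (var F j)) = 0 := by
  rcases j with j | l
  · rw [ham_xomega_var_even, map_zero]
  · have h := ham_mono_var (F := F) ((0, Finset.univ) : Mon m n) (.inr l)
    rw [conj_inr] at h
    rw [xomega, h, ← pd_mono, map_zsmul, pd_odd_mono]
    split_ifs
    · rw [map_smul, pd_even_mono_zero]; simp
    · simp

/-- Proved from the definition of D_H, since for odd n the potential x^ω is odd and the formulas for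
even potentials do not apply. -/
theorem isVectorField_ham_xomega : IsVectorField (ham F (xomega F) : Module.End F (O F m n)) := by
  rw [ham, xomega, mono, Finsupp.linearCombination_single, one_smul]
  refine IsVectorField.sum fun i _ => ?_
  have h := (isVectorField_field (conj i) (monoPartial F i ((0, Finset.univ) : Mon m n))).smul
    ((tau i * (-1) ^ (mu i * (Finset.univ : Finset (Fin n)).card) : ℤ) : F)
  convert h using 1
  exact LinearMap.ext fun x => (Int.cast_smul_eq_zsmul F _ _).symm

theorem pd_pow_mem_par (r : Y0 m) (q : ℕ) {f : O F m n} (hf : f ∈ par F m n 0) :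
    (pd F (.inl r) ^ q) f ∈ par F m n 0 := by
  induction q with
  | zero => simpa using hf
  | succ q ih =>
    rw [pow_succ']
    exact pd_mem_par ih (.inl r)

theorem pd_comm_even (i : Y0 m) (j : Y m n) (f : O F m n) :
    pd F (.inl i) (pd F j f) = pd F j (pd F (.inl i) f) := by
  rw [pd_comm]; simp [mu]

theorem pd_pow_comm (i : Y m n) (r : Y0 m) (q : ℕ) (f : O F m n) :
    pd F i ((pd F (.inl r) ^ q) f) = (pd F (.inl r) ^ q) (pd F i f) := by
  induction q with
  | zero => simp
  | succ q ih =>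
    rw [pow_succ', Module.End.mul_apply, Module.End.mul_apply, ← pd_comm_even, ih]

/-- ∂_r is itself Hamiltonian, with potential ± x_{r'}, so D_H intertwines it with its adjoint
action. -/
theorem ad_pd_ham (r : Y0 m) {f : O F m n} (hf : f ∈ par F m n 0) :
    ad F (pd F (.inl r)) (ham F f) = ham F (pd F (.inl r) f) := by
  have h1 : var F (.inl r.swap) ∈ par F m n 0 := even_mem_par (by simp)
  have h2 : (pd F (.inl r) : Module.End F (O F m n)) =
      (tau (.inl r.swap : Y m n) : F) • ham F (var F (.inl r.swap)) := by
    refine LinearMap.ext fun h => ?_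
    rw [LinearMap.smul_apply, ham_var_even, Sum.swap_swap, smul_smul, tau_mul_self, one_smul]
  change ⁅(pd F (.inl r) : Module.End F (O F m n)), ham F f⁆ = _
  have h3 : ⁅(pd F (.inl r) : Module.End F (O F m n)), ham F f⁆ =
      (tau (.inl r.swap : Y m n) : F) • ⁅ham F (var F (.inl r.swap : Y m n)), ham F f⁆ := by
    rw [h2]
    simp only [Ring.lie_def, smul_mul_assoc, mul_smul_comm, smul_sub]
  rw [h3, lie_ham hf h1, ham_var_even, Sum.swap_swap, map_smul, smul_smul, tau_mul_self, one_smul]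

theorem ad_pd_pow_ham (r : Y0 m) (q : ℕ) {f : O F m n} (hf : f ∈ par F m n 0) :
    (ad F (pd F (.inl r)) ^ q) (ham F f) = ham F ((pd F (.inl r) ^ q) f) := by
  induction q with
  | zero => simp
  | succ q ih =>
    rw [pow_succ', pow_succ', Module.End.mul_apply, Module.End.mul_apply, ih,
      ad_pd_ham r (pd_pow_mem_par r q hf)]

theorem pd_pow_apply (r : Y0 m) (q : ℕ) (f : O F m n) (α : Y0 m → ℕ) (u : Finset (Fin n)) :
    (pd F (.inl r) ^ q) f (α, u) = f (α + Pi.single r q, u) := by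
  induction q generalizing α with
  | zero => simp
  | succ q ih =>
    rw [pow_succ', Module.End.mul_apply, pd_even_apply, ih, add_assoc, ← Pi.single_add, add_comm 1]

theorem ev0_pd_pow_mono (r : Y0 m) (q : ℕ) (α : Y0 m → ℕ) (u : Finset (Fin n)) :
    ev0 F m n ((pd F (.inl r) ^ q) (mono F (α, u))) =
      if α = Pi.single r q then mono F (0, u) else 0 := by
  refine Finsupp.ext ?_
  rintro ⟨β, v⟩
  by_cases hβ : β = 0
  · subst hβ
    rw [ev0_apply_zero, pd_pow_apply, zero_add, mono_apply]
    split_ifs with h1 h2 h2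
    · rw [mono_apply, if_pos]; rw [(Prod.mk.inj h1).2]
    · exact absurd (Prod.mk.inj h1).1 h2
    · rw [mono_apply, if_neg]
      intro h3
      exact h1 (Prod.ext h2 (Prod.mk.inj h3).2)
    · rfl
  · rw [ev0_apply_of_ne _ hβ]
    split_ifs
    · rw [mono_apply, if_neg (fun h => hβ (Prod.mk.inj h).1.symm)]
    · rfl

theorem ev0_pd_pow_pd_mono (r i : Y0 m) (q : ℕ) (α : Y0 m → ℕ) (u : Finset (Fin n)) :
    ev0 F m n ((pd F (.inl r) ^ q) (pd F (.inl i) (mono F (α, u)))) =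
      if α = Pi.single r q + Pi.single i 1 then mono F (0, u) else 0 := by
  by_cases hα : α i = 0
  · rw [pd_even_mono, if_pos hα, if_neg]
    · simp
    · rintro rfl
      simp at hα
  · obtain ⟨β, rfl⟩ := exists_add_single (α := α) (i := i) (k := 1) (Nat.one_le_iff_ne_zero.2 hα)
    rw [pd_even_mono_add, ev0_pd_pow_mono]
    simp only [add_left_inj]

end Euler

/-! ### The right-hand side as a map on potentials -/

section Model

variable {F : Type*} [Field F] {m n : ℕ}

/-- The linear map `f ↦ (Γ_λ + μ ad Γ' + ∑ (λ_r^(s) Φ_r^(s) + μ_r^(s) Θ_r^(s) +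
η_r^(s) (ad ∂_r)^(p^s)))(D_H(f))`. -/
noncomputable def model (p : ℕ) (t : Y0 m → ℕ) (lam₀ mu₀ : F) (lam mu eta : Y0 m → ℕ → F) :
    O F m n →ₗ[F] Module.End F (O F m n) :=
  (Finsupp.lapply (topExp p t, (∅ : Finset (Fin n)))).smulRight (lam₀ • ham F (xomega F)) +
    mu₀ • (ad F (GammaPrime F)).comp (ham F) +
      ∑ r, ∑ s ∈ Finset.Ico 1 (t r),
        (lam r s • (LinearMap.mulRight F (ham F (xomega F))).comp
            ((mul F).comp (pd F (.inl r) ^ p ^ s)) +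
          mu r s • (LinearMap.mulLeft F (mul F (xomega F))).comp
            ((ham F).comp (pd F (.inl r) ^ p ^ s)) +
          eta r s • (ham F).comp (pd F (.inl r) ^ p ^ s))

variable {p : ℕ} {t : Y0 m → ℕ} {lam₀ mu₀ : F} {lam mu eta : Y0 m → ℕ → F}

theorem model_apply (f : O F m n) : model p t lam₀ mu₀ lam mu eta f =
    f (topExp p t, ∅) • lam₀ • ham F (xomega F) + mu₀ • ⁅(GammaPrime F : Module.End F (O F m n)), ham F f⁆ +
      ∑ r, ∑ s ∈ Finset.Ico 1 (t r),
        (lam r s • (mul F ((pd F (.inl r) ^ p ^ s) f) * ham F (xomega F)) +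
          mu r s • (mul F (xomega F) * ham F ((pd F (.inl r) ^ p ^ s) f)) +
          eta r s • ham F ((pd F (.inl r) ^ p ^ s) f)) := by
  rw [model, LinearMap.add_apply, LinearMap.add_apply, LinearMap.smul_apply, LinearMap.sum_apply]
  congr 1
  refine Finset.sum_congr rfl fun r _ => ?_
  rw [LinearMap.sum_apply]
  rfl

theorem isVectorField_model {f : O F m n} (hf : f ∈ par F m n 0) :
    IsVectorField (model p t lam₀ mu₀ lam mu eta f) := by
  rw [model_apply]
  refine ((isVectorField_ham_xomega.smul _).smul _ |>.add
    ((isVectorField_gammaPrime.lie isEvenField_gammaPrime (isVectorField_ham hf)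
      (isEvenField_ham hf)).smul _)).add (IsVectorField.sum fun r _ => IsVectorField.sum fun s _ => ?_)
  have h := isVectorField_ham (pd_pow_mem_par r (p ^ s) hf)
  exact (((isVectorField_ham_xomega.mulLeft _).smul _).add ((h.mulLeft _).smul _)).add (h.smul _)

theorem model_var {f : O F m n} (hf : f ∈ par F m n 0) (j : Y m n) :
    model p t lam₀ mu₀ lam mu eta f (var F j) =
      f (topExp p t, ∅) • lam₀ • ham F (xomega F) (var F j) +
      mu₀ • (tau (conj j) : F) • (GammaPrime F (pd F (conj j) f) -
        (HamSuper.mu j : F) • pd F (conj j) f) +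
      ∑ r, ∑ s ∈ Finset.Ico 1 (t r),
        (lam r s • mul F ((pd F (.inl r) ^ p ^ s) f) (ham F (xomega F) (var F j)) +
          mu r s • (tau (conj j) : F) •
            mul F (xomega F) ((pd F (.inl r) ^ p ^ s) (pd F (conj j) f)) +
          eta r s • (tau (conj j) : F) • (pd F (.inl r) ^ p ^ s) (pd F (conj j) f)) := by
  have h : ⁅(GammaPrime F : Module.End F (O F m n)), ham F f⁆ (var F j) = (tau (conj j) : F) •
      (GammaPrime F (pd F (conj j) f) - (HamSuper.mu j : F) • pd F (conj j) f) := by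
    rw [Ring.lie_def, LinearMap.sub_apply, Module.End.mul_apply, Module.End.mul_apply,
      gammaPrime_var, map_smul, ham_var hf, map_smul, smul_sub, smul_comm (HamSuper.mu j : F)]
  simp only [model_apply, LinearMap.add_apply, LinearMap.smul_apply, LinearMap.sum_apply,
    Module.End.mul_apply, h, ham_var (pd_pow_mem_par _ _ hf), pd_pow_comm, map_smul]

/-- Each term is built from operations commuting with ∂_i, because x^ω and D_H(x^ω) involve no even
variable. This is the property that lets the model be compared with ψ at the origin only. -/
theorem pd_model {f : O F m n} (hf : f ∈ potentials F p m n t) (i : Y0 m) (j : Y m n) :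
    pd F (.inl i) (model p t lam₀ mu₀ lam mu eta f (var F j)) =
      model p t lam₀ mu₀ lam mu eta (pd F (.inl i) f) (var F j) := by
  -- The term Γ is the exception: ∂_i annihilates its value, and on the other side ∂_i f has no
  -- component x^(π), as exponents exceeding π are excluded.
  have h0 : pd F (.inl i) f (topExp p t, ∅) = 0 := by
    rw [pd_even_apply]
    by_contra hne
    have h1 := ((Finsupp.mem_supported F _).1 hf (Finsupp.mem_support_iff.2 hne)).1 i
    simp at h1
  have hx : pd F (.inl i) (xomega F : O F m n) = 0 := pd_even_mono_zero i _
  rw [model_var (potentials_le_par p t hf),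
    model_var (potentials_le_par p t (pd_mem_potentials hf i)), h0]
  simp only [map_add, map_smul, map_sub, map_sum, pd_even_mul, pd_ham_xomega_var, hx, map_zero,
    LinearMap.zero_apply, smul_zero, zero_smul, zero_add, add_zero, pd_pow_comm, pd_gammaPrime,
    pd_comm_even i (conj j)]

end Model

end HamSuper

namespace HamSuper

/-! ### Comparing ψ with the model at the origin -/

section Comparison

variable {F : Type*} [Field F] {m n : ℕ} {p : ℕ} {t : Y0 m → ℕ} {lam₀ mu₀ : F}
  {lam mu eta : Y0 m → ℕ → F}

/-- For odd n the field D_H(x^ω) carries an extra sign, which is harmless since its coefficient is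
then zero. -/
theorem smul_ham_xomega {c : F} (hc : Odd n → c = 0) (l : Fin n) :
    c • ham F (xomega F) (var F (.inr l) : O F m n) = c • pd F (.inr l) (xomega F) := by
  rcases Nat.even_or_odd n with hn | hn
  · rw [ham_xomega_var_odd hn]
  · rw [hc hn, zero_smul, zero_smul]

theorem mul_xomega_comm {u : Finset (Fin n)} (hu : Even u.card) :
    mul F (xomega F : O F m n) (mono F (0, u)) = mul F (mono F (0, u)) (xomega F) :=
  mul_comm_even (e := n) (mono_mem_par _ (by simp [Nat.ModEq])) (even_mem_par hu)

theorem ev0_xomega : ev0 F m n (xomega F) = xomega F := ev0_mono_zero _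

theorem ev0_model_odd (h₀ : Odd n → lam₀ = 0)
    (hlam : Odd n → ∀ r, ∀ s ∈ Finset.Ico 1 (t r), lam r s = 0) (α : Y0 m → ℕ)
    {u : Finset (Fin n)} (hu : Even u.card) (l : Fin n) :
    ev0 F m n (model p t lam₀ mu₀ lam mu eta (mono F (α, u)) (var F (.inr l))) =
      (if α = topExp p t ∧ u = ∅ then lam₀ • pd F (.inr l) (xomega F) else 0) +
      (if α = 0 then (mu₀ * ((u.card : F) - 2)) • pd F (.inr l) (mono F (0, u)) else 0) +
      ∑ r, ∑ s ∈ Finset.Ico 1 (t r), if α = Pi.single r (p ^ s) then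
        eta r s • pd F (.inr l) (mono F (0, u)) +
          lam r s • mul F (mono F (0, u)) (pd F (.inr l) (xomega F)) else 0 := by
  rw [model_var (even_mem_par hu), map_add, map_add, map_sum]
  congr 1
  · congr 1
    · rw [smul_ham_xomega h₀, map_smul, map_smul, ev0_pd_odd, ev0_xomega, mono_apply]
      simp only [Prod.mk.injEq]
      split_ifs
      · rw [one_smul]
      · rw [zero_smul]
    · rw [conj_inr, map_smul, map_smul, map_sub, map_smul, ev0_gammaPrime, ev0_pd_odd, ev0_mono]
      split_ifs with h
      · subst h
        have hτ : (tau (.inr l : Y m n) : F) = 1 := by simp [tau]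
        rw [hτ, one_smul, pd_odd_mono]
        split_ifs with hl
        · have hc := Finset.card_erase_add_one hl
          have hc' : (u.card : F) = (u.erase l).card + 1 := by rw [← hc]; push_cast; rfl
          rw [map_smul, gammaPrime_mono, hc']
          simp only [HamSuper.mu, Nat.cast_one]
          module
        · simp
      · simp
  · refine Finset.sum_congr rfl fun r _ => ?_
    rw [map_sum]
    refine Finset.sum_congr rfl fun s hs => ?_
    have hτ : (tau (.inr l : Y m n) : F) = 1 := by simp [tau]
    rw [conj_inr, hτ, one_smul, one_smul, ← map_smul (mul F _), smul_ham_xomega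
      (fun ho => hlam ho r s hs), ← pd_pow_comm]
    simp only [map_add, map_smul, ev0_mul, ev0_pd_odd, ev0_pd_pow_mono, ev0_xomega]
    split_ifs
    · rw [mul_xomega_pd l hu, smul_zero, add_zero, add_comm]
    · simp

theorem ev0_model_even (α : Y0 m → ℕ) {u : Finset (Fin n)} (hu : Even u.card) (i : Y0 m) :
    ev0 F m n (model p t lam₀ mu₀ lam mu eta (mono F (α, u)) (var F (.inl i.swap))) =
      (if α = Pi.single i 1 then (tau (.inl i : Y m n) : F) • (mu₀ * u.card) • mono F (0, u)
        else 0) +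
      ∑ r, ∑ s ∈ Finset.Ico 1 (t r), if α = Pi.single r (p ^ s) + Pi.single i 1 then
        (tau (.inl i : Y m n) : F) • (eta r s • mono F (0, u) +
          mu r s • mul F (mono F (0, u)) (xomega F)) else 0 := by
  rw [model_var (even_mem_par hu), map_add, map_add, map_sum, ham_xomega_var_even, smul_zero,
    smul_zero, map_zero, zero_add, conj_inl, Sum.swap_swap]
  congr 1
  · have h := ev0_pd_pow_pd_mono (F := F) i i 0 α u
    rw [pow_zero, Module.End.one_apply, Pi.single_zero, zero_add] at h
    rw [map_smul, map_smul, map_sub, map_smul, ev0_gammaPrime, h]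
    split_ifs
    · rw [gammaPrime_mono]
      simp only [HamSuper.mu, Nat.cast_zero, zero_smul, sub_zero]
      module
    · simp
  · refine Finset.sum_congr rfl fun r _ => ?_
    rw [map_sum]
    refine Finset.sum_congr rfl fun s _ => ?_
    rw [map_zero, smul_zero, zero_add]
    simp only [map_add, map_smul, ev0_mul, ev0_pd_pow_pd_mono, ev0_xomega]
    split_ifs
    · rw [mul_xomega_comm hu]
      module
    · simp

/-- The exponents p^s ε_r are pairwise distinct, so evaluation at one of them isolates a single
parameter. -/
theorem sum_single_pow {M : Type*} [AddCommMonoid M] (hp : 1 < p) {r : Y0 m} {s : ℕ}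
    (hs : s ∈ Finset.Ico 1 (t r)) (G : Y0 m → ℕ → M) :
    (∑ r', ∑ s' ∈ Finset.Ico 1 (t r'),
      if (Pi.single r (p ^ s) : Y0 m → ℕ) = Pi.single r' (p ^ s') then G r' s' else 0) = G r s := by
  have hne : p ^ s ≠ 0 := by positivity
  rw [Finset.sum_eq_single r]
  · rw [Finset.sum_eq_single s]
    · rw [if_pos rfl]
    · intro s' _ h
      rw [if_neg]
      intro h2
      exact h (Nat.pow_right_injective hp (Pi.single_injective r h2)).symm
    · exact fun h => absurd hs h
  · intro r' _ h
    refine Finset.sum_eq_zero fun s' _ => if_neg fun h2 => hne ?_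
    have h3 := congrFun h2 r
    rwa [Pi.single_eq_same, Pi.single_eq_of_ne h.symm] at h3
  · simp

/-- `χ` determines `ψ`: if it agrees with that of a model, then `ψ` is the model. -/
theorem IsNormalized.eq_model {ψ : O F m n →ₗ[F] Module.End F (O F m n)}
    (H : IsNormalized p t ψ)
    (h : ∀ (α : Y0 m → ℕ) (u : Finset (Fin n)), mono F (α, u) ∈ potentials F p m n t → ∀ j,
      chi ψ j (mono F (α, u)) =
        ev0 F m n (model p t lam₀ mu₀ lam mu eta (mono F (α, u)) (var F j)))
    {f : O F m n} (hf : f ∈ potentials F p m n t) : ψ f = model p t lam₀ mu₀ lam mu eta f := by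
  -- Induction on the even degree: the difference of the two coefficients vanishes at the origin by
  -- hypothesis, and its even derivatives belong to monomials of smaller degree.
  have key : ∀ (N : ℕ) (α : Y0 m → ℕ) (u : Finset (Fin n)), ∑ x, α x = N →
      mono F (α, u) ∈ potentials F p m n t →
      ψ (mono F (α, u)) = model p t lam₀ mu₀ lam mu eta (mono F (α, u)) := by
    intro N
    induction N with
    | zero =>
      intro α u hN hf
      refine (H.vectorField _).ext (isVectorField_model (potentials_le_par p t hf)) fun j => ?_
      have hα : α = 0 := by
        funext x
        have h1 := Finset.single_le_sum (f := α) (fun _ _ => Nat.zero_le _) (Finset.mem_univ x)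
        simp only [Pi.zero_apply]
        omega
      rw [← sub_eq_zero]
      refine eq_zero_of_ev0_of_pd ?_ fun i => ?_
      · rw [map_sub, ← h α u hf j, chi_apply, sub_self]
      · rw [map_sub, ← H.psi_pd hf, pd_model hf, hα, pd_even_mono_zero]
        simp
    | succ N ih =>
      intro α u hN hf
      refine (H.vectorField _).ext (isVectorField_model (potentials_le_par p t hf)) fun j => ?_
      rw [← sub_eq_zero]
      refine eq_zero_of_ev0_of_pd ?_ fun i => ?_
      · rw [map_sub, ← h α u hf j, chi_apply, sub_self]
      · have hm := pd_mem_potentials hf i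
        rw [map_sub, ← H.psi_pd hf, pd_model hf]
        rw [pd_even_mono] at hm ⊢
        split_ifs at hm ⊢ with h0
        · simp
        · have := sum_update_pred h0
          rw [ih _ _ (by omega) hm, sub_self]
  refine supported_induction (S := {a | a.1 ≤ topExp p t ∧ Even a.2.card ∧
    a ≠ (topExp p t, Finset.univ)}) (P := fun f _ => ψ f = model p t lam₀ mu₀ lam mu eta f)
    hf (by simp) ?_ ?_ ?_
  · intro f g _ _ h1 h2
    rw [map_add, map_add, h1, h2]
  · intro c f _ h1
    rw [map_smul, map_smul, h1]
  · rintro ⟨α, u⟩ ha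
    exact key _ α u rfl (Finsupp.single_mem_supported F _ ha)

theorem potential_mem (X : Heven F p m n t) :
    potential F p m n t X ∈ potentials F p m n t :=
  Finsupp.supported_mono Set.sdiff_subset (Subtype.prop
    ((LinearEquiv.ofBijective (hamRestrict F p m n t) (hamRestrict_bijective F p m n t)).symm X))

theorem ham_potential (X : Heven F p m n t) : ham F (potential F p m n t X) = X.1 :=
  congrArg Subtype.val ((LinearEquiv.ofBijective (hamRestrict F p m n t)
    (hamRestrict_bijective F p m n t)).apply_symm_apply X)

theorem model_potential (X : Heven F p m n t) :
    (Gamma F p m n t lam₀ + mu₀ • adGammaPrime F p m n t +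
      ∑ r, ∑ s ∈ Finset.Ico 1 (t r), (lam r s • Phi F p m n t r s + mu r s • Theta F p m n t r s +
        eta r s • adPow F p m n t r s)) X =
      model p t lam₀ mu₀ lam mu eta (potential F p m n t X) := by
  have hpar := potentials_le_par p t (potential_mem X)
  have hpow : ∀ r s, adPow F p m n t r s X =
      ham F ((pd F (.inl r) ^ p ^ s) (potential F p m n t X)) := by
    intro r s
    rw [← ad_pd_pow_ham r _ hpar, ham_potential]
    rfl
  rw [model_apply, LinearMap.add_apply, LinearMap.add_apply, LinearMap.smul_apply,
    LinearMap.sum_apply, ham_potential]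
  congr 1
  refine Finset.sum_congr rfl fun r _ => ?_
  rw [LinearMap.sum_apply]
  refine Finset.sum_congr rfl fun s _ => ?_
  rw [← hpow]
  rfl

end Comparison

end HamSuper

namespace HamSuper

/-! ### Assembling the parameters -/

section Main

variable {F : Type*} [Field F] {m n : ℕ} {p : ℕ} {t : Y0 m → ℕ}
  {ψ : O F m n →ₗ[F] Module.End F (O F m n)}

namespace IsNormalized

theorem single_pow_le (H : IsNormalized p t ψ) {r : Y0 m} {s : ℕ}
    (hs : s ∈ Finset.Ico 1 (t r)) : (Pi.single r (p ^ s) : Y0 m → ℕ) ≤ topExp p t := by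
  have hp := H.three_lt_p
  intro x
  change (Pi.single r (p ^ s) : Y0 m → ℕ) x ≤ topExp p t x
  by_cases hx : x = r
  · subst hx
    rw [Pi.single_eq_same]
    have := Nat.pow_lt_pow_right (a := p) (by omega) (Finset.mem_Ico.1 hs).2
    simp only [topExp]
    omega
  · rw [Pi.single_eq_of_ne hx]; exact Nat.zero_le _

theorem mem_Ico_of_single_pow_le (H : IsNormalized p t ψ) {r : Y0 m} {s : ℕ} (hs : 1 ≤ s)
    (h : (Pi.single r (p ^ s) : Y0 m → ℕ) ≤ topExp p t) : s ∈ Finset.Ico 1 (t r) := by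
  have hp := H.three_lt_p
  refine Finset.mem_Ico.2 ⟨hs, ?_⟩
  have h1 : (Pi.single r (p ^ s) : Y0 m → ℕ) r ≤ topExp p t r := h r
  rw [Pi.single_eq_same] at h1
  have h2 := (H.three_le_topExp r).2
  by_contra hcon
  have := Nat.pow_le_pow_right (n := p) (by omega) (not_lt.1 hcon)
  omega

theorem cast_single_pow (H : IsNormalized p t ψ) (r : Y0 m) {s : ℕ} (hs : 1 ≤ s) (i : Y0 m) :
    ((Pi.single r (p ^ s) : Y0 m → ℕ) i : F) = 0 := by
  have := H.charP
  rw [CharP.cast_eq_zero_iff F p]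
  by_cases hi : i = r
  · subst hi
    rw [Pi.single_eq_same]
    exact dvd_pow_self p (by omega)
  · rw [Pi.single_eq_of_ne hi]; exact dvd_zero p

theorem exists_model (H : IsNormalized p t ψ) :
    ∃ (lam₀ mu₀ : F) (lam mu eta : Y0 m → ℕ → F),
      (∀ f ∈ potentials F p m n t, ψ f = model p t lam₀ mu₀ lam mu eta f) ∧
      (Odd n → lam₀ = 0 ∧ ∀ r, ∀ s ∈ Finset.Ico 1 (t r), lam r s = 0 ∧ mu r s = 0) ∧
      ∀ r, ∀ s ∈ Finset.Ico 1 (t r), ∀ j,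
        chi ψ (.inl j.swap) (mono F (Pi.single r (p ^ s) + Pi.single j 1, ∅)) =
          (tau (.inl j : Y m n) : F) • (eta r s • mono F (0, ∅) + mu r s • xomega F) := by
  have hm := H.one_lt_m
  have hn := H.three_lt_n
  have hp := H.three_lt_p
  let i₀ : Y0 m := .inl ⟨0, by omega⟩
  have htop : ∀ i, (topExp p t i : F) ≠ 1 := fun i h => H.two_ne (by
    rw [H.cast_topExp] at h; linear_combination -h)
  have htop0 : ∀ i, (topExp p t i : F) ≠ 0 := fun i => by
    rw [H.cast_topExp]; exact neg_ne_zero.2 one_ne_zero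
  have hune : (Finset.univ : Finset (Fin n)) ≠ ∅ := by
    rw [← Finset.nonempty_iff_ne_empty]
    exact ⟨⟨0, by omega⟩, Finset.mem_univ _⟩
  have hpne : ∀ (r : Y0 m) (s : ℕ), (Pi.single r (p ^ s) : Y0 m → ℕ) ≠ 0 := fun r s h => by
    have h1 := congrFun h r
    rw [Pi.single_eq_same, Pi.zero_apply] at h1
    exact absurd h1 (by positivity)
  have hmemtop : mono F (topExp p t, (∅ : Finset (Fin n))) ∈ potentials F p m n t :=
    mono_mem_potentials le_rfl (by simp) fun h => hune h.2.symm
  -- The parameter of Γ is read off at x^(π), where every exponent is -1 mod p and hence not 1.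
  obtain ⟨lam₀, hl, hl0⟩ := H.chi_pure_odd hmemtop (i := i₀) (by
    have h1 := Finset.single_le_sum (f := topExp p t) (fun _ _ => Nat.zero_le _)
      (Finset.mem_univ i₀)
    have h2 := (H.three_le_topExp i₀).1
    omega) (htop i₀)
  obtain ⟨mu₀, hA0, hB0⟩ := H.exists_parameter_zero
  have hpar : ∀ (r : Y0 m) (s : ℕ), ∃ b c d : F, s ∈ Finset.Ico 1 (t r) →
      (∀ u : Finset (Fin n), Even u.card → ∀ l, chi ψ (.inr l) (mono F (Pi.single r (p ^ s), u)) =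
        c • pd F (.inr l) (mono F (0, u)) + b • mul F (mono F (0, u)) (pd F (.inr l) (xomega F))) ∧
      (∀ u : Finset (Fin n), Even u.card → ∀ j,
        chi ψ (.inl j.swap) (mono F (Pi.single r (p ^ s) + Pi.single j 1, u)) =
          (tau (.inl j : Y m n) : F) •
            (c • mono F (0, u) + d • mul F (mono F (0, u)) (xomega F))) ∧
      (Odd n → b = 0 ∧ d = 0) := by
    intro r s
    by_cases hs : s ∈ Finset.Ico 1 (t r)
    · obtain ⟨b, c, d, h1, h2, h3, -⟩ := H.exists_parameters (H.single_pow_le hs)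
        (H.cast_single_pow r (Finset.mem_Ico.1 hs).1) (hpne r s)
      exact ⟨b, c, d, fun _ => ⟨h1, h2, h3⟩⟩
    · exact ⟨0, 0, 0, fun h => absurd h hs⟩
  -- The three constants b, c, d at p^s ε_r are the coefficients of Φ, (ad ∂_r)^{p^s} and Θ, in this
  -- order.
  choose lam eta mu hpar using hpar
  have hlam : Odd n → ∀ r, ∀ s ∈ Finset.Ico 1 (t r), lam r s = 0 := fun ho r s hs =>
    ((hpar r s hs).2.2 ho).1
  refine ⟨lam₀, mu₀, lam, mu, eta, fun f hf => H.eq_model ?_ hf, fun ho => ⟨hl0 ho, fun r s hs =>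
    (hpar r s hs).2.2 ho⟩, fun r s hs j => ?_⟩
  swap
  · rw [(hpar r s hs).2.1 ∅ (by simp) j, one_mul']
  rintro α u hα (i | l)
  · obtain ⟨hle, hu, hne⟩ := mono_mem_potentials_iff.1 hα
    obtain ⟨i, rfl⟩ : ∃ i', i = Sum.swap i' := ⟨i.swap, (Sum.swap_swap i).symm⟩
    rw [ev0_model_even α hu]
    -- Unless α = γ + ε_i with γ divisible by p, both sides vanish, the left one by `live_even`.
    -- Otherwise γ is zero, a power p^s ε_r, or neither, and in the last case χ vanishes.
    by_cases hdiv : ∃ γ : Y0 m → ℕ, α = γ + Pi.single i 1 ∧ ∀ x, (γ x : F) = 0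
    · obtain ⟨γ, rfl, h0⟩ := hdiv
      have hγle : γ ≤ topExp p t := fun x => le_trans (by simp) (hle x)
      have hcond : ∀ r s, (γ + Pi.single i 1 = Pi.single r (p ^ s) + Pi.single i 1) ↔
          γ = Pi.single r (p ^ s) := fun r s => add_left_inj _
      have hcond0 : (γ + Pi.single i 1 = Pi.single i 1) ↔ γ = 0 := by simp
      simp only [hcond, hcond0]
      by_cases hγ : γ = 0
      · subst hγ
        rw [if_pos rfl, Finset.sum_eq_zero, add_zero, zero_add, hB0 u hu]
        intro r _
        exact Finset.sum_eq_zero fun s _ => if_neg fun h => hpne r s h.symm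
      · rw [if_neg hγ, zero_add]
        by_cases hpow : ∃ r s, 1 ≤ s ∧ γ = Pi.single r (p ^ s)
        · obtain ⟨r, s, hs, rfl⟩ := hpow
          have hs' := H.mem_Ico_of_single_pow_le hs hγle
          rw [sum_single_pow (by omega) hs' fun r s => (tau (.inl i : Y m n) : F) •
            (eta r s • mono F (0, u) + mu r s • mul F (mono F (0, u)) (xomega F)),
            (hpar r s hs').2.1 u hu]
        · push Not at hpow
          obtain ⟨b, c, d, -, h2, -, h4⟩ := H.exists_parameters hγle h0 hγ
          obtain ⟨-, hc, hd⟩ := h4 hpow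
          rw [h2 u hu, hc, hd, Finset.sum_eq_zero]
          · simp
          · intro r _
            exact Finset.sum_eq_zero fun s hs => if_neg (hpow r s (Finset.mem_Ico.1 hs).1)
    · have hchi : chi ψ (.inl i.swap) (mono F (α, u)) = 0 := by
        by_contra hcon
        obtain ⟨h1, h2⟩ := H.live_even hα hcon
        rw [Sum.swap_swap] at h1 h2
        have hi : 1 ≤ α i := Nat.one_le_iff_ne_zero.2 fun h => by
          rw [h, Nat.cast_zero] at h1; exact zero_ne_one h1
        obtain ⟨γ, rfl⟩ := exists_add_single hi
        refine hdiv ⟨γ, rfl, fun x => ?_⟩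
        by_cases hx : x = i
        · subst hx
          simpa using h1
        · simpa [hx] using h2 x hx
      rw [hchi, if_neg fun h => hdiv ⟨0, by rw [h, zero_add], by simp⟩, Finset.sum_eq_zero,
        add_zero]
      intro r _
      exact Finset.sum_eq_zero fun s hs => if_neg fun h =>
        hdiv ⟨_, h, H.cast_single_pow r (Finset.mem_Ico.1 hs).1⟩
  · obtain ⟨hle, hu, hne⟩ := mono_mem_potentials_iff.1 hα
    rw [ev0_model_odd hl0 hlam α hu]
    -- The same division for odd ∂_l, with the additional exponent π allowed by `live_odd`; there
    -- only u = ∅ contributes.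
    by_cases hdiv : ∀ x, (α x : F) = 0
    · rw [if_neg (fun h => htop0 i₀ (by rw [← h.1]; exact hdiv i₀)), zero_add]
      by_cases hα0 : α = 0
      · subst hα0
        rw [if_pos rfl, Finset.sum_eq_zero, add_zero, hA0 u hu]
        intro r _
        exact Finset.sum_eq_zero fun s _ => if_neg fun h => hpne r s h.symm
      · rw [if_neg hα0, zero_add]
        by_cases hpow : ∃ r s, 1 ≤ s ∧ α = Pi.single r (p ^ s)
        · obtain ⟨r, s, hs, rfl⟩ := hpow
          have hs' := H.mem_Ico_of_single_pow_le hs hle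
          rw [sum_single_pow (by omega) hs' fun r s => eta r s • pd F (.inr l) (mono F (0, u)) +
            lam r s • mul F (mono F (0, u)) (pd F (.inr l) (xomega F)), (hpar r s hs').1 u hu]
        · push Not at hpow
          obtain ⟨b, c, d, h1, -, -, h4⟩ := H.exists_parameters hle hdiv hα0
          obtain ⟨hb, hc, -⟩ := h4 hpow
          rw [h1 u hu, hb, hc, Finset.sum_eq_zero]
          · simp
          · intro r _
            exact Finset.sum_eq_zero fun s hs => if_neg (hpow r s (Finset.mem_Ico.1 hs).1)
    · have hα0 : α ≠ 0 := fun h => hdiv (by simp [h])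
      rw [if_neg hα0, add_zero, Finset.sum_eq_zero, add_zero]
      · by_cases hαt : α = topExp p t
        · subst hαt
          by_cases hu0 : u = ∅
          · subst hu0
            rw [if_pos ⟨rfl, rfl⟩, hl]
          · rw [if_neg fun h => hu0 h.2, H.chi_top_eq_zero hu hu0 fun h => hne ⟨rfl, h⟩]
        · rw [if_neg fun h => hαt h.1]
          by_contra hcon
          exact (H.live_odd hα hcon).elim hdiv hαt
      · intro r _
        exact Finset.sum_eq_zero fun s hs => if_neg fun h => hdiv fun x => by
          rw [h]; exact H.cast_single_pow r (Finset.mem_Ico.1 hs).1 x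

end IsNormalized

/-- A homogeneous operator cannot have nonzero coefficients of `1` and `x^ω` at the same `∂_j`. -/
theorem mul_eq_zero_of_homogeneous (hn : n ≠ 0) {k : ℤ} {E : Module.End F (O F m n)}
    (hE : E ∈ WevenDeg F p m n t k) {j : Y m n} {τ c d : F} (hτ : τ ≠ 0)
    (h : ev0 F m n (E (var F j)) = τ • (c • mono F (0, ∅) + d • xomega F)) : d * c = 0 := by
  have hune : (Finset.univ : Finset (Fin n)) ≠ ∅ := by
    rw [← Finset.nonempty_iff_ne_empty]
    exact ⟨⟨0, by omega⟩, Finset.mem_univ _⟩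
  by_contra hcon
  obtain ⟨hd, hc⟩ := mul_ne_zero_iff.1 hcon
  have hmem := (Finsupp.mem_supported F _).1 (apply_var_mem_of_mem_deg hE j)
  have h1 : E (var F j) (0, ∅) ≠ 0 := by
    rw [← ev0_apply_zero, h]
    simpa [mono_apply, xomega, hune] using ⟨hτ, hc⟩
  have h2 : E (var F j) (0, Finset.univ) ≠ 0 := by
    rw [← ev0_apply_zero, h]
    simpa [mono_apply, xomega, hune.symm] using ⟨hτ, hd⟩
  -- The monomials 1 and x^ω would both lie in the support of one homogeneous coefficient, which
  -- would force 0 = n.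
  have h3 := (hmem (Finsupp.mem_support_iff.2 h1)).2.2
  have h4 := (hmem (Finsupp.mem_support_iff.2 h2)).2.2
  rw [← h3] at h4
  simp at h4
  exact hn h4

end Main

end HamSuper

theorem mainTheorem2 {F : Type*} [Field F] (p : ℕ) [CharP F p] (hp : 3 < p)
    (m n : ℕ) (hm : 1 < m) (hn : 3 < n) (t : HamSuper.Y0 m → ℕ) (ht : ∀ i, 0 < t i)
    (φ : HamSuper.Heven F p m n t →ₗ[F] HamSuper.Weven F p m n t)
    (hφ : HamSuper.IsDerivation φ)
    (hneg : ∀ X : HamSuper.Heven F p m n t, X.1 ∈ HamSuper.WevenDeg F p m n t (-1) → φ X = 0)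
    (hzero : ∀ X : HamSuper.Heven F p m n t, X.1 ∈ HamSuper.WevenDeg F p m n t 0 → φ X = 0) :
    ∃ (lam₀ mu₀ : F) (lam mu eta : HamSuper.Y0 m → ℕ → F),
      (HamSuper.Weven F p m n t).subtype.comp φ =
        HamSuper.Gamma F p m n t lam₀ + mu₀ • HamSuper.adGammaPrime F p m n t +
          ∑ r, ∑ s ∈ Finset.Ico 1 (t r),
            (lam r s • HamSuper.Phi F p m n t r s + mu r s • HamSuper.Theta F p m n t r s +
              eta r s • HamSuper.adPow F p m n t r s) ∧
      (HamSuper.IsHomogeneous φ → ∀ r, ∀ s ∈ Finset.Ico 1 (t r), mu r s * eta r s = 0) ∧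
      (Odd n → lam₀ = 0 ∧ ∀ r, ∀ s ∈ Finset.Ico 1 (t r), lam r s = 0 ∧ mu r s = 0) := by
  have H := HamSuper.isNormalized_pullback hp hm hn ht hφ hneg hzero
  obtain ⟨lam₀, mu₀, lam, mu, eta, h1, h2, h3⟩ := H.exists_model
  refine ⟨lam₀, mu₀, lam, mu, eta, LinearMap.ext fun X => ?_, ?_, h2⟩
  · have hX := HamSuper.potential_mem X
    rw [HamSuper.model_potential, ← h1 _ hX, HamSuper.pullback_apply φ hX]
    change (φ X).1 = _
    congr 2
    exact Subtype.ext (HamSuper.ham_potential X).symm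
  · rintro ⟨d, hd⟩ r s hs
    -- Homogeneity is tested on x^(p^s ε_r) x_j: at the origin the coefficient of ∂_{j'} is ±(η + μ
    -- x^ω).
    let j : HamSuper.Y0 m := .inl ⟨0, by omega⟩
    have hle := H.single_pow_le hs
    have h0 : ∀ i, ((Pi.single r (p ^ s) : HamSuper.Y0 m → ℕ) i : F) = 0 :=
      H.cast_single_pow r (Finset.mem_Ico.1 hs).1
    have hf : HamSuper.mono F (Pi.single r (p ^ s) + Pi.single j 1, ∅) ∈
        HamSuper.potentials F p m n t :=
      H.mem_of_le hle h0 (fun x => (HamSuper.IsNormalized.add_single_le j x).trans (by omega))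
        (by simp)
    have h4 := h3 r s hs j
    rw [HamSuper.chi_apply, HamSuper.pullback_apply φ hf] at h4
    exact HamSuper.mul_eq_zero_of_homogeneous (by omega) (hd _ _
      (HamSuper.ham_mono_mem_deg (HamSuper.mono_mem_potentials_iff.1 hf).1 (by simp)))
      (HamSuper.tau_ne_zero _) h4
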